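/- **Theorem (NC$^2$ computability of IT-SHAP).** *Tensors.* Let $D\ge 1$ be the number of features, feature $j$ taking values in $[N_j]$, and let $k\ge 1$ be the interaction order. A tensor train (TT) with bond dimensions $d_0,\dots,d_D$ is a sequence of arrays $G^{(j)}\in\mathbb{R}^{d_{j-1}\times n_j\times d_j}$, $1\le j\le D$; it represents the tensor $$(l,i_1,\dots,i_D,r)\mapsto\sum_{p_1,\dots,p_{D-1}}\prod_{j=1}^{D}G^{(j)}_{p_{j-1},i_j,p_j},\qquad p_0=l\in[d_0],\quad p_D=r\in[d_D].$$ The numbers $d_1,\dots,d_{D-1}$ are its ranks. Let the model tensor $\mathcal T^M$ (indices $x_1,\dots,x_D$ and an output index $y\in[n_{\rm out}]$) and the background-distribution tensor $\mathcal T^P$ (a probability distribution on $\prod_j[N_j]$) be given by TTs with $d_0=1$, $d_D=n_{\rm out}$ and with $d_0=d_D=1$ respectively. For a routing index $\tau\in\{1,2\}^D$ put $U(\tau)=\{i:\tau_i=1\}$ and let $\mathrm{do}(x',\tau,x)_j=x_j$ if $\tau_j=1$ and $x'_j$ if $\tau_j=2$. The Value Tensor is $$\mathcal V_{x,\tau,y}=\mathbb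 E_{x'\sim P}\bigl[\mathcal T^M_{\mathrm{do}(x',\tau,x),\,y}\bigr].$$ The order-$k$ weight tensor (MWCT) is $$\widetilde{\mathcal W}^{(k)}_{S,\tau}=\frac kD\sum_{\substack{T\subseteq[D]\setminus S,\ W\subseteq S\\ T\cup W=U(\tau)}}\frac{(-1)^{|S|-|W|}}{\binom{D-1}{|T|}},$$ and the order-$k$ IT-SHAP tensor is $\mathcal T^{(k)}_{S,x,y}=\sum_{\tau}\widetilde{\mathcal W}^{(k)}_{S,\tau}\,\mathcal V_{x,\tau,y}$. All statements below hold under each of the following two conventions for the interaction sets $S$: (a) $S$ ranges over the nonempty sets with $|S|\le k$ and the formula above is used for all of them; (b) $S$ ranges over all sets with $|S|\le k$, and for $|S|<k$ the weight is replaced by that of the discrete derivative at the empty set, $\sum_{W\subseteq S,\,W=U(\tau)}(-1)^{|S|-|W|}$, as in the definition of the Shapley–Taylor interaction index. *Complexity.* Consider the following problem. An instance consists of $D$, $k$, TTs with rational entries for $\mathcal T^M$ and $\mathcal T^P$, a list $S_1,\dots,S_m$ of interaction sets together with a TT with rational entries and $d_0=m$, $d_D=1$ that represents $(a,\tau)\mapsto\widetilde{\mathcal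 W}^{(k)}_{S_a,\tau}$, and indices $a$, $x$, $y$. It is encoded as a bit string: size parameters in unary, cores zero-padded to common dimensions, entries by sign, numerator and denominator in binary of a common length $b$. The output is a code (sign, numerator, nonzero denominator, not necessarily in lowest terms) of the rational number $\mathcal T^{(k)}_{S_a,x,y}$. Then for every polynomial bound on the ranks in terms of $D$ and $k$: 1. the problem, restricted to instances in which all ranks of the three given TTs satisfy this bound, is in NC$^2$: it is solved by a logspace-uniform family of Boolean circuits of fan-in at most two, of size polynomial in the input length $n$ and depth $O(\log^2 n)$; 2. the length of the input on these instances is bounded by a polynomial in $D$, $k$, $\max_jN_j$, $n_{\rm out}$, $m$ and $b$. *Ranks.* Let $\mathcal T^M$, $\mathcal T^P$ and the MWCT on a list $S_1,\dots,S_m$ of interaction sets be given by TTs with real entries and bond dimensions $d^M_j$, $d^P_j$, $d^{W}_j$. Then $\mathcal V$, with modes the pairs $(x_j,\tau_j)$, has a TT with bond dimensions at most $d^M_jd^P_j$; and for every TT of $\mathcal V$ of this kind, with bond dimensions $d^V_j$, the tensor $(a,x,y)\mapsto\mathcal T^{(k)}_{S_a,x,y}$ has a TT with bond dimensions at most $d^W_j\,d^V_j$.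 -/

import Mathlib

namespace ITSHAP

/-! ## Boolean circuits and the class NC² -/

/-- Gates of fan-in at most two; arguments of internal gates are gate numbers. -/
inductive Gate where
  | input (i : ℕ)
  | const (b : Bool)
  | not (a : ℕ)
  | and (a b : ℕ)
  | or (a b : ℕ)

/-- The gates whose values a gate reads. -/
def Gate.args : Gate → List ℕ
  | .input _ => []
  | .const _ => []
  | .not a => [a]
  | .and a b => [a, b]
  | .or a b => [a, b]

/-- The value of a gate on input word `x`, given the values `v` of all gates. -/
def Gate.value (x : List Bool) (v : ℕ → Bool) : Gate → Bool
  | .input i => x.getD i false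
  | .const b => b
  | .not a => !(v a)
  | .and a b => v a && v b
  | .or a b => v a || v b

/-- Numerical description `(tag, first argument, second argument)` of a gate. -/
def Gate.code : Gate → ℕ × ℕ × ℕ
  | .input i => (0, i, 0)
  | .const b => (1, b.toNat, 0)
  | .not a => (2, a, 0)
  | .and a b => (3, a, b)
  | .or a b => (4, a, b)

/-- A Boolean circuit with gates `0, …, size - 1` and output gates
`out 0, …, out (outputs - 1)`. -/
structure Circuit where
  inputs : ℕ
  size : ℕ
  gate : ℕ → Gate
  outputs : ℕ
  out : ℕ → ℕ

/-- All references made by the circuit are in range. -/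
def Circuit.InRange (C : Circuit) : Prop :=
  (∀ g < C.size, (∀ a ∈ (C.gate g).args, a < C.size) ∧
    ∀ i, C.gate g = Gate.input i → i < C.inputs) ∧
  ∀ o < C.outputs, C.out o < C.size

/-- The wiring is acyclic and every directed path has at most `d` edges. -/
def Circuit.DepthLE (C : Circuit) (d : ℕ) : Prop :=
  ∃ level : ℕ → ℕ, ∀ g < C.size, level g ≤ d ∧ ∀ a ∈ (C.gate g).args, level a < level g

/-- `v` assigns to every gate its value on the input word `x`. -/
def Circuit.IsValuation (C : Circuit) (x : List Bool) (v : ℕ → Bool) : Prop :=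
  ∀ g < C.size, v g = (C.gate g).value x v

/-- On the input word `x` the circuit outputs the word `y`. -/
def Circuit.Outputs (C : Circuit) (x y : List Bool) : Prop :=
  ∃ v, C.IsValuation x v ∧ y = (List.range C.outputs).map fun o => v (C.out o)

/-- In an acyclic circuit the gate values, hence the output, are determined by the input. -/
theorem Circuit.IsValuation.unique {C : Circuit} {d : ℕ} (hr : C.InRange) (hd : C.DepthLE d)
    {x : List Bool} {v w : ℕ → Bool} (hv : C.IsValuation x v) (hw : C.IsValuation x w) :
    ∀ g < C.size, v g = w g := by
  obtain ⟨level, hl⟩ := hd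
  suffices h : ∀ t g, level g ≤ t → g < C.size → v g = w g from fun g hg => h _ g le_rfl hg
  intro t
  induction t with
  | zero =>
    intro g hg hs
    have h1 := (hl g hs).2
    rw [hv g hs, hw g hs]
    cases hc : C.gate g with
    | input i => rfl
    | const b => rfl
    | not a => have := h1 a (by simp [hc, Gate.args]); omega
    | and a b => have := h1 a (by simp [hc, Gate.args]); omega
    | or a b => have := h1 a (by simp [hc, Gate.args]); omega
  | succ t ih =>
    intro g hg hs
    have key : ∀ a ∈ (C.gate g).args, v a = w a := fun a ha =>
      ih a (by have := (hl g hs).2 a ha; omega) ((hr.1 g hs).1 a ha)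
    rw [hv g hs, hw g hs]
    cases hc : C.gate g with
    | input i => rfl
    | const b => rfl
    | not a => simp [Gate.value, key a (by simp [hc, Gate.args])]
    | and a b =>
      simp [Gate.value, key a (by simp [hc, Gate.args]), key b (by simp [hc, Gate.args])]
    | or a b =>
      simp [Gate.value, key a (by simp [hc, Gate.args]), key b (by simp [hc, Gate.args])]

/-- Programs for a register machine with finitely many registers holding natural numbers
(`sub` is truncated subtraction, `div` is the floor of the quotient; `loop r p` repeats `p` as
long as register `r` is nonzero). -/
inductive RegProgram where
  | const (r c : ℕ)
  | add (r a b : ℕ)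
  | sub (r a b : ℕ)
  | mul (r a b : ℕ)
  | div (r a b : ℕ)
  | seq (p q : RegProgram)
  | loop (r : ℕ) (p : RegProgram)

/-- `p.Runs B σ σ'`: started with register contents `σ`, the program `p` halts with contents
`σ'`, and no number larger than `B` is ever written into a register. -/
inductive RegProgram.Runs (B : ℕ) : RegProgram → (ℕ → ℕ) → (ℕ → ℕ) → Prop where
  | const {r c : ℕ} {σ : ℕ → ℕ} (h : c ≤ B) :
      Runs B (.const r c) σ (Function.update σ r c)
  | add {r a b : ℕ} {σ : ℕ → ℕ} (h : σ a + σ b ≤ B) :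
      Runs B (.add r a b) σ (Function.update σ r (σ a + σ b))
  | sub {r a b : ℕ} {σ : ℕ → ℕ} (h : σ a - σ b ≤ B) :
      Runs B (.sub r a b) σ (Function.update σ r (σ a - σ b))
  | mul {r a b : ℕ} {σ : ℕ → ℕ} (h : σ a * σ b ≤ B) :
      Runs B (.mul r a b) σ (Function.update σ r (σ a * σ b))
  | div {r a b : ℕ} {σ : ℕ → ℕ} (h : σ a / σ b ≤ B) :
      Runs B (.div r a b) σ (Function.update σ r (σ a / σ b))
  | seq {p q : RegProgram} {σ σ' σ'' : ℕ → ℕ} (hp : Runs B p σ σ') (hq : Runs B q σ' σ'') :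
      Runs B (.seq p q) σ σ''
  | loop_done {r : ℕ} {p : RegProgram} {σ : ℕ → ℕ} (h : σ r = 0) :
      Runs B (.loop r p) σ σ
  | loop_step {r : ℕ} {p : RegProgram} {σ σ' σ'' : ℕ → ℕ} (h : σ r ≠ 0)
      (hp : Runs B p σ σ') (hl : Runs B (.loop r p) σ' σ'') :
      Runs B (.loop r p) σ σ''

/-- Initial register contents: the two arguments in registers `0` and `1`, zero elsewhere. -/
def initRegs (n i : ℕ) : ℕ → ℕ := fun r => if r = 0 then n else if r = 1 then i else 0

/-- `f n i` is computable in logarithmic space from `n` and `i` (given in unary): a fixed program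
computes it in register `0`, and all registers stay polynomially bounded in `n + i`, so that its
boundedly many registers occupy `O(log (n + i))` bits. -/
def LogSpaceComputable (f : ℕ → ℕ → ℕ) : Prop :=
  ∃ (p : RegProgram) (c : ℕ), ∀ n i, ∃ σ : ℕ → ℕ,
    p.Runs (c * (n + i) ^ c + c) (initRegs n i) σ ∧ σ 0 = f n i

/-- Logarithmic-space uniformity of a circuit family: from `n` and a gate number one can compute
in logarithmic space the size, the outputs and the gates of the `n`-th circuit. -/
def Uniform (C : ℕ → Circuit) : Prop :=
  LogSpaceComputable (fun n _ => (C n).size) ∧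
  LogSpaceComputable (fun n _ => (C n).outputs) ∧
  LogSpaceComputable (fun n o => (C n).out o) ∧
  LogSpaceComputable (fun n g => ((C n).gate g).code.1) ∧
  LogSpaceComputable (fun n g => ((C n).gate g).code.2.1) ∧
  LogSpaceComputable (fun n g => ((C n).gate g).code.2.2)

/-- The computational problem "given (the encoding of) an instance in `valid`, output a word
that is a solution of it" is in (the function version of) uniform NC²: it is solved by a
logspace-uniform family of Boolean circuits of fan-in at most two, one for each input length
`n`, of polynomial size and depth `O((log n) ^ 2)`. -/
def InNC2 {Inst : Type} (encode : Inst → List Bool) (valid : Inst → Prop)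
    (solution : Inst → List Bool → Prop) : Prop :=
  ∃ (C : ℕ → Circuit) (c : ℕ), Uniform C ∧
    (∀ n, (C n).inputs = n ∧ (C n).InRange ∧ (C n).size ≤ c * n ^ c + c ∧
      (C n).DepthLE (c * Nat.log 2 n ^ 2 + c)) ∧
    ∀ I, valid I → ∃ y, (C (encode I).length).Outputs (encode I) y ∧ solution I y

/-! ## Tensor trains -/

/-- A tensor train with `D` cores over `K`. The `j`-th core is an array indexed by
`d j × ι j × d (j + 1)`; the first and the last bond index stay open and have sizes `a`, `b`. -/
structure TT {D : ℕ} (ι : Fin D → Type) (a b : ℕ) (K : Type) where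
  d : Fin (D + 1) → ℕ
  left : d 0 = a
  right : d (Fin.last D) = b
  core : (j : Fin D) → ι j → Fin (d j.castSucc) → Fin (d j.succ) → K

/-- The entry with indices `l, x 0, …, x (D - 1), r` of the tensor represented by a tensor
train: sum over all bond indices with prescribed ends of the product of the core entries. -/
def TT.eval {D : ℕ} {ι : Fin D → Type} {a b : ℕ} {K : Type} [Field K] (t : TT ι a b K)
    (l : Fin a) (x : (j : Fin D) → ι j) (r : Fin b) : K :=
  ∑ p : (j : Fin (D + 1)) → Fin (t.d j),
    if (p 0 : ℕ) = l ∧ (p (Fin.last D) : ℕ) = r then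
      ∏ j : Fin D, t.core j (x j) (p j.castSucc) (p j.succ)
    else 0

/-! ## The IT-SHAP tensor

Features are indexed by `Fin D`, feature `j` has the values `Fin (N j)`. A routing index
`τ : Fin D → Fin 2` has `τ j = 0` if feature `j` keeps the value of the explained input and
`τ j = 1` if it is drawn from the background distribution. -/

/-- The subset encoded by a routing index. -/
def routed {D : ℕ} (τ : Fin D → Fin 2) : Finset (Fin D) := Finset.univ.filter fun j => τ j = 0

/-- The intervened input: `x j` where `τ j = 0`, and `x' j` elsewhere. -/
def intervene {D : ℕ} {N : Fin D → ℕ} (x' : (j : Fin D) → Fin (N j)) (τ : Fin D → Fin 2)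
    (x : (j : Fin D) → Fin (N j)) : (j : Fin D) → Fin (N j) :=
  fun j => if τ j = 0 then x j else x' j

/-- The Value Tensor: expectation over `x' ∼ P` of the model output at the intervened input. -/
def valueTensor {D : ℕ} {N : Fin D → ℕ} {nOut : ℕ} {K : Type} [Field K]
    (M : ((j : Fin D) → Fin (N j)) → Fin nOut → K) (P : ((j : Fin D) → Fin (N j)) → K)
    (x : (j : Fin D) → Fin (N j)) (τ : Fin D → Fin 2) (y : Fin nOut) : K :=
  ∑ x', P x' * M (intervene x' τ x) y

/-- The weights that the closed form of the Shapley-Taylor index,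
`(k / D) ∑_{T ⊆ Sᶜ} δ_S F(T) / C(D - 1, |T|)`, puts on the values of `F`. -/
def closedFormWeight {D : ℕ} (K : Type) [Field K] (k : ℕ) (S : Finset (Fin D))
    (τ : Fin D → Fin 2) : K :=
  (k : K) / (D : K) * ∑ T ∈ Sᶜ.powerset, ∑ W ∈ S.powerset,
    if T ∪ W = routed τ then (-1) ^ (S.card - W.card) / ((D - 1).choose T.card : K) else 0

/-- The weights that the discrete derivative `δ_S F(∅)` puts on the values of `F`. -/
def derivativeWeight {D : ℕ} (K : Type) [Field K] (S : Finset (Fin D))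
    (τ : Fin D → Fin 2) : K :=
  ∑ W ∈ S.powerset, if W = routed τ then (-1) ^ (S.card - W.card) else 0

/-- The two conventions for interaction sets `S` with fewer than `k` elements: use the closed
form for them as well, or use `δ_S F(∅)` as in the definition of the Shapley-Taylor index. -/
inductive LowerOrder where
  | closedForm
  | shapleyTaylor

/-- The Modified Weighted Coalitional Tensor of order `k`. -/
def mwct {D : ℕ} (K : Type) [Field K] (conv : LowerOrder) (k : ℕ) (S : Finset (Fin D))
    (τ : Fin D → Fin 2) : K :=
  match conv with
  | .closedForm => closedFormWeight K k S τ
  | .shapleyTaylor =>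
    if S.card < k then derivativeWeight K S τ else closedFormWeight K k S τ

/-- The order-`k` interaction sets. The closed form is undefined for the empty set. -/
def Admissible {D : ℕ} (conv : LowerOrder) (k : ℕ) (S : Finset (Fin D)) : Prop :=
  S.card ≤ k ∧ (conv = .closedForm → S.Nonempty)

/-- The order-`k` IT-SHAP tensor: contraction of the MWCT with the Value Tensor. -/
def itShap {D : ℕ} {N : Fin D → ℕ} {nOut : ℕ} {K : Type} [Field K] (conv : LowerOrder) (k : ℕ)
    (M : ((j : Fin D) → Fin (N j)) → Fin nOut → K) (P : ((j : Fin D) → Fin (N j)) → K)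
    (S : Finset (Fin D)) (x : (j : Fin D) → Fin (N j)) (y : Fin nOut) : K :=
  ∑ τ : Fin D → Fin 2, mwct K conv k S τ * valueTensor M P x τ y

/-! ## The computational problem -/

/-- An instance: tensor trains for the model, the background distribution and the MWCT (the
latter on an explicit list `sets` of interaction sets), and the indices `s`, `x`, `y` of the
entry that has to be computed. -/
structure Instance where
  D : ℕ
  k : ℕ
  N : Fin D → ℕ
  nOut : ℕ
  m : ℕ
  model : TT (fun j => Fin (N j)) 1 nOut ℚ
  dist : TT (fun j => Fin (N j)) 1 1 ℚ
  sets : Fin m → Finset (Fin D)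
  weight : TT (fun _ : Fin D => Fin 2) m 1 ℚ
  s : Fin m
  x : (j : Fin D) → Fin (N j)
  y : Fin nOut

namespace Instance

/-- The model tensor. -/
def modelTensor (I : Instance) (x : (j : Fin I.D) → Fin (I.N j)) (y : Fin I.nOut) : ℚ :=
  I.model.eval 0 x y

/-- The background-distribution tensor. -/
def distTensor (I : Instance) (x : (j : Fin I.D) → Fin (I.N j)) : ℚ := I.dist.eval 0 x 0

/-- The distribution tensor is a probability distribution, and the third tensor train
represents the MWCT on the listed interaction sets. -/
def WellPosed (conv : LowerOrder) (I : Instance) : Prop :=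
  1 ≤ I.D ∧ 1 ≤ I.k ∧
  (∀ x, 0 ≤ I.distTensor x) ∧ ∑ x, I.distTensor x = 1 ∧
  (∀ a, Admissible conv I.k (I.sets a)) ∧
  ∀ a τ, I.weight.eval a τ 0 = mwct ℚ conv I.k (I.sets a) τ

/-- All (inner) tensor-train ranks are at most `c (D + k) ^ c + c`. -/
def PolyRanks (c : ℕ) (I : Instance) : Prop :=
  ∀ j : Fin (I.D + 1), j ≠ 0 → j ≠ Fin.last I.D →
    I.model.d j ≤ c * (I.D + I.k) ^ c + c ∧ I.dist.d j ≤ c * (I.D + I.k) ^ c + c ∧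
      I.weight.d j ≤ c * (I.D + I.k) ^ c + c

/-- The entry of the IT-SHAP tensor that has to be computed. -/
def answer (conv : LowerOrder) (I : Instance) : ℚ :=
  itShap conv I.k I.modelTensor I.distTensor (I.sets I.s) I.x I.y

end Instance

/-! ## Encoding of instances and answers by bit strings -/

/-- Unary code of a natural number. -/
def unary (n : ℕ) : List Bool := List.replicate n true ++ [false]

/-- The `w` lowest binary digits of `v`, least significant first. -/
def binary (w v : ℕ) : List Bool := (List.range w).map fun i => v.testBit i

/-- The word of length `w` with a single one, at position `i`. -/
def oneHot (w i : ℕ) : List Bool := (List.range w).map fun j => decide (j = i)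

/-- A rational number as sign, numerator and denominator, the latter with `b` digits each. -/
def encodeRat (b : ℕ) (q : ℚ) : List Bool :=
  decide (q < 0) :: (binary b q.num.natAbs ++ binary b q.den)

/-- Number of binary digits needed for the numerators and denominators in a tensor train. -/
def TT.bits {D : ℕ} {n : Fin D → ℕ} {a b : ℕ} (t : TT (fun j => Fin (n j)) a b ℚ) : ℕ :=
  Finset.univ.sup fun j => Finset.univ.sup fun i => Finset.univ.sup fun u =>
    Finset.univ.sup fun v => max (t.core j i u v).num.natAbs.size (t.core j i u v).den.size

/-- Core entries, extended by zero beyond the dimensions of the core. -/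
def TT.entry {D : ℕ} {n : Fin D → ℕ} {a b : ℕ} (t : TT (fun j => Fin (n j)) a b ℚ)
    (j i u v : ℕ) : ℚ :=
  if hj : j < D then
    if h : i < n ⟨j, hj⟩ ∧ u < t.d (Fin.castSucc ⟨j, hj⟩) ∧ v < t.d (Fin.succ ⟨j, hj⟩) then
      t.core ⟨j, hj⟩ ⟨i, h.1⟩ ⟨u, h.2.1⟩ ⟨v, h.2.2⟩
    else 0
  else 0

/-- The cores of a tensor train, zero-padded to common dimensions `R × N × R`, entry by entry
with `b` binary digits for numerators and denominators. -/
def TT.encode {D : ℕ} {n : Fin D → ℕ} {a b : ℕ} (t : TT (fun j => Fin (n j)) a b ℚ)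
    (N R w : ℕ) : List Bool :=
  (List.range D).flatMap fun j => (List.range N).flatMap fun i =>
    (List.range R).flatMap fun u => (List.range R).flatMap fun v => encodeRat w (t.entry j i u v)

namespace Instance

/-- The largest mode size. -/
def maxMode (I : Instance) : ℕ := Finset.univ.sup I.N

/-- The largest bond dimension, open ends included. -/
def maxBond (I : Instance) : ℕ :=
  Finset.univ.sup fun j => max (I.model.d j) (max (I.dist.d j) (I.weight.d j))

/-- The common number of binary digits for all numerators and denominators. -/
def bits (I : Instance) : ℕ := max 1 (max I.model.bits (max I.dist.bits I.weight.bits))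

/-- Instances as bit strings: the size parameters in unary, the three tensor trains, the
indices of the requested entry, the list of interaction sets, and the true dimensions. -/
def encode (I : Instance) : List Bool :=
  unary I.D ++ unary I.k ++ unary I.maxMode ++ unary I.maxBond ++ unary I.bits ++
  I.model.encode I.maxMode I.maxBond I.bits ++
  I.dist.encode I.maxMode I.maxBond I.bits ++
  I.weight.encode 2 I.maxBond I.bits ++
  oneHot I.maxBond I.s ++
  (List.finRange I.D).flatMap (fun j => oneHot I.maxMode (I.x j)) ++
  oneHot I.maxBond I.y ++
  (List.finRange I.m).flatMap
    (fun a => (List.finRange I.D).map fun j => decide (j ∈ I.sets a)) ++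
  (List.finRange I.D).flatMap (fun j => unary (I.N j)) ++
  (List.finRange (I.D + 1)).flatMap
    (fun j => unary (I.model.d j) ++ unary (I.dist.d j) ++ unary (I.weight.d j))

/-- The numerical parameters of an instance other than its ranks: number of features, order,
largest mode size, number of outputs, number of listed interaction sets, and bit length. -/
def sizeParam (I : Instance) : ℕ := I.D + I.k + I.maxMode + I.nOut + I.m + I.bits

end Instance

/-- The number with the given binary digits, least significant first. -/
def ofBinary : List Bool → ℕ
  | [] => 0
  | b :: l => b.toNat + 2 * ofBinary l

/-- The word `y` is a code of the rational number `q`: a sign bit followed by a numerator and a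
nonzero denominator with equally many binary digits (not necessarily in lowest terms). -/
def IsRatCode (y : List Bool) (q : ℚ) : Prop :=
  ∃ (sgn : Bool) (u v : List Bool), y = sgn :: (u ++ v) ∧ u.length = v.length ∧
    ofBinary v ≠ 0 ∧ q = (if sgn then -1 else 1) * (ofBinary u : ℚ) / (ofBinary v : ℚ)

end ITSHAP

namespace ITSHAP

/-! ## Straight-line arithmetic functions are computable in logarithmic space -/

/-- Functions of two arguments that are given by an expression in `+`, truncated `-`, `*`, `/`. -/
inductive Ar : (ℕ → ℕ → ℕ) → Prop where
  | fst : Ar fun n _ => n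
  | snd : Ar fun _ i => i
  | const (c : ℕ) : Ar fun _ _ => c
  | add {f g : ℕ → ℕ → ℕ} : Ar f → Ar g → Ar fun n i => f n i + g n i
  | sub {f g : ℕ → ℕ → ℕ} : Ar f → Ar g → Ar fun n i => f n i - g n i
  | mul {f g : ℕ → ℕ → ℕ} : Ar f → Ar g → Ar fun n i => f n i * g n i
  | div {f g : ℕ → ℕ → ℕ} : Ar f → Ar g → Ar fun n i => f n i / g n i

/-- `f` is bounded by a polynomial in `s`. -/
def PolyBdd {α : Type} (s f : α → ℕ) : Prop := ∃ c, ∀ x, f x ≤ c * s x ^ c + c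

theorem poly_mono {c d : ℕ} (h : c ≤ d) (s : ℕ) : c * s ^ c + c ≤ d * s ^ d + d := by
  rcases Nat.eq_zero_or_pos s with rfl | hs
  · rcases Nat.eq_zero_or_pos c with rfl | hc
    · simp
    · rw [Nat.zero_pow hc, Nat.zero_pow (by omega)]; omega
  · gcongr

theorem poly_le_pow (c s : ℕ) : c * s ^ c + c ≤ 2 * c * (s + 1) ^ c := by
  have h1 : s ^ c ≤ (s + 1) ^ c := Nat.pow_le_pow_left (by omega) _
  have h2 : 1 ≤ (s + 1) ^ c := Nat.one_le_pow _ _ (by omega)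
  nlinarith [Nat.mul_le_mul_left c h1, Nat.mul_le_mul_left c h2]

theorem pow_le_poly (a c : ℕ) : ∃ d, ∀ s, a * (s + 1) ^ c ≤ d * s ^ d + d := by
  refine ⟨a * 2 ^ c + c, fun s => ?_⟩
  refine le_trans ?_ (poly_mono (c := max (a * 2 ^ c) c) (by omega) s)
  rcases Nat.eq_zero_or_pos s with rfl | hs
  · have : 1 ≤ 2 ^ c := Nat.one_le_pow _ _ (by omega)
    simp only [zero_add, one_pow, mul_one]
    have : a ≤ a * 2 ^ c := Nat.le_mul_of_pos_right _ (by omega)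
    exact le_add_left (this.trans (le_max_left _ _))
  · calc a * (s + 1) ^ c ≤ a * (2 * s) ^ c := by gcongr; omega
      _ = a * 2 ^ c * s ^ c := by rw [mul_pow]; ring
      _ ≤ max (a * 2 ^ c) c * s ^ max (a * 2 ^ c) c := by
        gcongr
        · exact le_max_left _ _
        · exact le_max_right _ _
      _ ≤ _ := Nat.le_add_right _ _

namespace PolyBdd

variable {α : Type} {s f g : α → ℕ}

theorem of_le (hg : PolyBdd s g) (h : ∀ x, f x ≤ g x) : PolyBdd s f :=
  let ⟨c, hc⟩ := hg; ⟨c, fun x => (h x).trans (hc x)⟩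

theorem iff_pow : PolyBdd s f ↔ ∃ a c, ∀ x, f x ≤ a * (s x + 1) ^ c := by
  constructor
  · rintro ⟨c, hc⟩
    exact ⟨2 * c, c, fun x => (hc x).trans (poly_le_pow _ _)⟩
  · rintro ⟨a, c, h⟩
    obtain ⟨d, hd⟩ := pow_le_poly a c
    exact ⟨d, fun x => (h x).trans (hd _)⟩

theorem const (c : ℕ) : PolyBdd s fun _ => c := ⟨c, fun _ => Nat.le_add_left _ _⟩

theorem self : PolyBdd s s := ⟨1, fun x => by simp⟩

theorem add (hf : PolyBdd s f) (hg : PolyBdd s g) : PolyBdd s fun x => f x + g x := by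
  obtain ⟨a, c, h⟩ := iff_pow.1 hf
  obtain ⟨b, d, h'⟩ := iff_pow.1 hg
  refine iff_pow.2 ⟨a + b, c + d, fun x => ?_⟩
  rw [add_mul]
  refine add_le_add ((h x).trans ?_) ((h' x).trans ?_) <;> gcongr <;> omega

theorem mul (hf : PolyBdd s f) (hg : PolyBdd s g) : PolyBdd s fun x => f x * g x := by
  obtain ⟨a, c, h⟩ := iff_pow.1 hf
  obtain ⟨b, d, h'⟩ := iff_pow.1 hg
  refine iff_pow.2 ⟨a * b, c + d, fun x => ?_⟩
  rw [pow_add, mul_mul_mul_comm]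
  exact Nat.mul_le_mul (h x) (h' x)

theorem pow (hf : PolyBdd s f) (k : ℕ) : PolyBdd s fun x => f x ^ k := by
  induction k with
  | zero => simpa using const 1
  | succ k ih => simpa only [pow_succ] using ih.mul hf

end PolyBdd

theorem Ar.polyBdd {f : ℕ → ℕ → ℕ} (hf : Ar f) :
    PolyBdd (fun x : ℕ × ℕ => x.1 + x.2) fun x => f x.1 x.2 := by
  induction hf with
  | fst => exact PolyBdd.self.of_le fun x => Nat.le_add_right _ _
  | snd => exact PolyBdd.self.of_le fun x => Nat.le_add_left _ _
  | const c => exact PolyBdd.const c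
  | add _ _ hf hg => exact hf.add hg
  | sub _ _ hf hg => exact hf.of_le fun x => Nat.sub_le _ _
  | mul _ _ hf hg => exact hf.mul hg
  | div _ _ hf hg => exact hf.of_le fun x => Nat.div_le_self _ _

theorem RegProgram.Runs.mono {B B' : ℕ} (h : B ≤ B') {p : RegProgram} {σ σ' : ℕ → ℕ}
    (hp : p.Runs B σ σ') : p.Runs B' σ σ' := by
  induction hp with
  | const h1 => exact .const (h1.trans h)
  | add h1 => exact .add (h1.trans h)
  | sub h1 => exact .sub (h1.trans h)
  | mul h1 => exact .mul (h1.trans h)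
  | div h1 => exact .div (h1.trans h)
  | seq _ _ h1 h2 => exact .seq h1 h2
  | loop_done h1 => exact .loop_done h1
  | loop_step h1 _ _ h2 h3 => exact .loop_step h1 h2 h3

/-- `f` can be computed into any register `r ≥ 2` without changing the registers below `r`. -/
def Compiles (f : ℕ → ℕ → ℕ) : Prop :=
  ∃ c, ∀ r, 2 ≤ r → ∃ p : RegProgram, ∀ σ : ℕ → ℕ, ∃ σ' : ℕ → ℕ,
    p.Runs (c * (σ 0 + σ 1) ^ c + c) σ σ' ∧ σ' r = f (σ 0) (σ 1) ∧ ∀ q < r, σ' q = σ q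

theorem Compiles.binop {f g h : ℕ → ℕ → ℕ} (hh : Ar h) (op : ℕ → ℕ → ℕ → RegProgram)
    (o : ℕ → ℕ → ℕ) (ho : ∀ n i, h n i = o (f n i) (g n i))
    (hop : ∀ B r a b σ, o (σ a) (σ b) ≤ B →
      (op r a b).Runs B σ (Function.update σ r (o (σ a) (σ b))))
    (hf : Compiles f) (hg : Compiles g) : Compiles h := by
  obtain ⟨c, hf⟩ := hf
  obtain ⟨d, hg⟩ := hg
  obtain ⟨e, he⟩ := hh.polyBdd
  refine ⟨c + d + e, fun r hr => ?_⟩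
  obtain ⟨p, hp⟩ := hf r hr
  obtain ⟨q, hq⟩ := hg (r + 1) (by omega)
  refine ⟨.seq (.seq p q) (op r r (r + 1)), fun σ => ?_⟩
  obtain ⟨σ1, h1, h1r, h1q⟩ := hp σ
  obtain ⟨σ2, h2, h2r, h2q⟩ := hq σ1
  rw [h1q 0 (by omega), h1q 1 (by omega)] at h2 h2r
  have hv : o (σ2 r) (σ2 (r + 1)) = h (σ 0) (σ 1) := by
    rw [h2r, h2q r (by omega), h1r, ho]
  refine ⟨_, .seq (.seq (h1.mono (poly_mono (by omega) _)) (h2.mono (poly_mono (by omega) _)))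
    (hop _ r r (r + 1) σ2 ?_), ?_, fun q hq => ?_⟩
  · rw [hv]
    exact (he (σ 0, σ 1)).trans (poly_mono (by omega) _)
  · simp [hv]
  · rw [Function.update_of_ne (by omega), h2q q (by omega), h1q q hq]

theorem Ar.compiles {f : ℕ → ℕ → ℕ} (hf : Ar f) : Compiles f := by
  have copy : ∀ s < 2, Compiles fun n i => if s = 0 then n else i := by
    intro s hs
    refine ⟨1, fun r hr => ⟨.seq (.const r 0) (.add r s r), fun σ => ?_⟩⟩
    refine ⟨_, .seq (.const (Nat.zero_le _)) (.add ?_), ?_, fun q hq => ?_⟩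
    · have : s ≠ r := by omega
      simp only [Function.update_self, Function.update_of_ne this]
      interval_cases s <;> simp <;> omega
    · have : s ≠ r := by omega
      simp only [Function.update_self, Function.update_of_ne this]
      interval_cases s <;> simp
    · simp [Function.update_of_ne (show q ≠ r by omega)]
  induction hf with
  | fst => simpa using copy 0 (by omega)
  | snd => simpa using copy 1 (by omega)
  | const c =>
    refine ⟨c, fun r hr => ⟨.const r c, fun σ => ⟨_, .const (Nat.le_add_left _ _), by simp,
      fun q hq => Function.update_of_ne (by omega) _ _⟩⟩⟩
  | add h1 h2 hf hg =>
    exact hf.binop (h1.add h2) .add (· + ·) (fun _ _ => rfl) (fun _ _ _ _ _ h => .add h) hg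
  | sub h1 h2 hf hg =>
    exact hf.binop (h1.sub h2) .sub (· - ·) (fun _ _ => rfl) (fun _ _ _ _ _ h => .sub h) hg
  | mul h1 h2 hf hg =>
    exact hf.binop (h1.mul h2) .mul (· * ·) (fun _ _ => rfl) (fun _ _ _ _ _ h => .mul h) hg
  | div h1 h2 hf hg =>
    exact hf.binop (h1.div h2) .div (· / ·) (fun _ _ => rfl) (fun _ _ _ _ _ h => .div h) hg

theorem Ar.logSpaceComputable {f : ℕ → ℕ → ℕ} (hf : Ar f) : LogSpaceComputable f := by
  obtain ⟨c, h⟩ := hf.compiles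
  obtain ⟨e, he⟩ := hf.polyBdd
  obtain ⟨p, hp⟩ := h 2 le_rfl
  refine ⟨.seq p (.seq (.const 3 0) (.add 0 2 3)), c + e, fun n i => ?_⟩
  obtain ⟨σ, h1, h2, -⟩ := hp (initRegs n i)
  have e0 : initRegs n i 0 = n := rfl
  have e1 : initRegs n i 1 = i := rfl
  rw [e0, e1] at h1 h2
  refine ⟨_, .seq (h1.mono (poly_mono (by omega) _))
    (.seq (.const (Nat.zero_le _)) (.add ?_)), ?_⟩
  · simpa [h2] using (he (n, i)).trans (poly_mono (by omega) _)
  · simp [h2]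

/-! ### Closure properties -/

/-- Decidable relations whose characteristic function is arithmetic. -/
def ArP (p : ℕ → ℕ → Prop) : Prop := ∃ f, Ar f ∧ ∀ n i, (f n i = 1 ∧ p n i) ∨ (f n i = 0 ∧ ¬ p n i)

namespace ArP

variable {p q : ℕ → ℕ → Prop} {f g : ℕ → ℕ → ℕ}

theorem le (hf : Ar f) (hg : Ar g) : ArP fun n i => f n i ≤ g n i :=
  ⟨_, (Ar.const 1).sub (hf.sub hg), fun n i => by omega⟩

theorem lt (hf : Ar f) (hg : Ar g) : ArP fun n i => f n i < g n i :=
  ⟨_, (Ar.const 1).sub ((hf.add (.const 1)).sub hg), fun n i => by omega⟩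

theorem eq (hf : Ar f) (hg : Ar g) : ArP fun n i => f n i = g n i :=
  ⟨_, (Ar.const 1).sub ((hf.sub hg).add (hg.sub hf)), fun n i => by omega⟩

theorem and (hp : ArP p) (hq : ArP q) : ArP fun n i => p n i ∧ q n i := by
  obtain ⟨f, hf, h⟩ := hp
  obtain ⟨g, hg, h'⟩ := hq
  refine ⟨_, hf.mul hg, fun n i => ?_⟩
  rcases h n i with ⟨h1, h2⟩ | ⟨h1, h2⟩ <;> rcases h' n i with ⟨h3, h4⟩ | ⟨h3, h4⟩ <;>
    simp [h1, h2, h3, h4]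

theorem not (hp : ArP p) : ArP fun n i => ¬ p n i := by
  obtain ⟨f, hf, h⟩ := hp
  refine ⟨_, (Ar.const 1).sub hf, fun n i => ?_⟩
  rcases h n i with ⟨h1, h2⟩ | ⟨h1, h2⟩ <;> simp [h1, h2]

theorem or (hp : ArP p) (hq : ArP q) : ArP fun n i => p n i ∨ q n i := by
  obtain ⟨f, hf, h⟩ := hp
  obtain ⟨g, hg, h'⟩ := hq
  refine ⟨_, (Ar.const 1).sub ((Ar.const 1).sub (hf.add hg)), fun n i => ?_⟩
  rcases h n i with ⟨h1, h2⟩ | ⟨h1, h2⟩ <;> rcases h' n i with ⟨h3, h4⟩ | ⟨h3, h4⟩ <;>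
    simp [h1, h2, h3, h4]

end ArP

theorem Ar.ite {p : ℕ → ℕ → Prop} [∀ n i, Decidable (p n i)] {f g : ℕ → ℕ → ℕ} (hp : ArP p)
    (hf : Ar f) (hg : Ar g) : Ar fun n i => if p n i then f n i else g n i := by
  obtain ⟨u, hu, h⟩ := hp
  have : (fun n i => if p n i then f n i else g n i) =
      fun n i => u n i * f n i + (1 - u n i) * g n i := by
    funext n i
    rcases h n i with ⟨h1, h2⟩ | ⟨h1, h2⟩ <;> simp [h1, h2]
  rw [this]
  exact (hu.mul hf).add (((Ar.const 1).sub hu).mul hg)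

theorem Ar.mod {f g : ℕ → ℕ → ℕ} (hf : Ar f) (hg : Ar g) : Ar fun n i => f n i % g n i := by
  have : (fun n i => f n i % g n i) = fun n i => f n i - g n i * (f n i / g n i) := by
    funext n i
    have := Nat.mod_add_div (f n i) (g n i)
    omega
  rw [this]
  exact hf.sub (hg.mul (hf.div hg))

theorem Ar.pow {f : ℕ → ℕ → ℕ} (hf : Ar f) (k : ℕ) : Ar fun n i => f n i ^ k := by
  induction k with
  | zero => simpa using Ar.const 1
  | succ k ih => simpa only [pow_succ] using ih.mul hf

/-! ### Addresses with six digits -/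

/-- The address with the given digits to base `B`; `B ^ 6` if one of them is not a digit. -/
def nd (B x0 x1 x2 x3 x4 x5 : ℕ) : ℕ :=
  if x0 < B ∧ x1 < B ∧ x2 < B ∧ x3 < B ∧ x4 < B ∧ x5 < B then
    x0 + B * (x1 + B * (x2 + B * (x3 + B * (x4 + B * x5)))) else B ^ 6

/-- The `i`-th digit of an address. -/
def dg (B g i : ℕ) : ℕ := g / B ^ i % B

theorem nd_of_lt {B x0 x1 x2 x3 x4 x5 : ℕ}
    (h : x0 < B ∧ x1 < B ∧ x2 < B ∧ x3 < B ∧ x4 < B ∧ x5 < B) :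
    nd B x0 x1 x2 x3 x4 x5 < B ^ 6 := by
  obtain ⟨h0, h1, h2, h3, h4, h5⟩ := h
  have step : ∀ x y k, x < B → y < B ^ k → x + B * y < B ^ (k + 1) := by
    intro x y k hx hy
    calc x + B * y < B + B * y := by omega
      _ = B * (y + 1) := by ring
      _ ≤ B * B ^ k := Nat.mul_le_mul_left _ hy
      _ = B ^ (k + 1) := by ring
  rw [nd, if_pos ⟨h0, h1, h2, h3, h4, h5⟩]
  exact step _ _ 5 h0 (step _ _ 4 h1 (step _ _ 3 h2 (step _ _ 2 h3 (step _ _ 1 h4 (by simpa)))))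

theorem lt_of_nd_lt {B x0 x1 x2 x3 x4 x5 : ℕ} (h : nd B x0 x1 x2 x3 x4 x5 < B ^ 6) :
    x0 < B ∧ x1 < B ∧ x2 < B ∧ x3 < B ∧ x4 < B ∧ x5 < B := by
  by_contra hc
  rw [nd, if_neg hc] at h
  exact lt_irrefl _ h

theorem nd_lt {B x0 x1 x2 x3 x4 x5 : ℕ}
    (h : x0 < B ∧ x1 < B ∧ x2 < B ∧ x3 < B ∧ x4 < B ∧ x5 < B) :
    nd B x0 x1 x2 x3 x4 x5 < B ^ 6 := by
  rw [nd, if_pos h]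
  have step : ∀ x y k, x < B → y < B ^ k → x + B * y < B ^ (k + 1) := fun x y k hx hy => by
    calc x + B * y < B * (y + 1) := by rw [mul_add]; omega
      _ ≤ B * B ^ k := Nat.mul_le_mul_left _ hy
      _ = B ^ (k + 1) := (pow_succ' B k).symm
  obtain ⟨h0, h1, h2, h3, h4, h5⟩ := h
  exact step _ _ 5 h0 (step _ _ 4 h1 (step _ _ 3 h2 (step _ _ 2 h3 (step _ _ 1 h4 (by simpa)))))

theorem dg_nd {B x0 x1 x2 x3 x4 x5 : ℕ}
    (h : x0 < B ∧ x1 < B ∧ x2 < B ∧ x3 < B ∧ x4 < B ∧ x5 < B) :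
    dg B (nd B x0 x1 x2 x3 x4 x5) 0 = x0 ∧ dg B (nd B x0 x1 x2 x3 x4 x5) 1 = x1 ∧
    dg B (nd B x0 x1 x2 x3 x4 x5) 2 = x2 ∧ dg B (nd B x0 x1 x2 x3 x4 x5) 3 = x3 ∧
    dg B (nd B x0 x1 x2 x3 x4 x5) 4 = x4 ∧ dg B (nd B x0 x1 x2 x3 x4 x5) 5 = x5 := by
  have hnd : nd B x0 x1 x2 x3 x4 x5 = x0 + B * (x1 + B * (x2 + B * (x3 + B * (x4 + B * x5)))) :=
    if_pos h
  obtain ⟨h0, h1, h2, h3, h4, h5⟩ := h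
  have hB : 0 < B := by omega
  have D : ∀ x y, x < B → (x + B * y) / B = y := fun x y hx => by
    rw [Nat.add_mul_div_left _ _ hB, Nat.div_eq_of_lt hx, zero_add]
  have M : ∀ x y, x < B → (x + B * y) % B = x := fun x y hx => by
    rw [Nat.add_mul_mod_self_left, Nat.mod_eq_of_lt hx]
  have S : ∀ g i, dg B g (i + 1) = dg B (g / B) i := fun g i => by
    rw [dg, dg, pow_succ', Nat.div_div_eq_div_mul]
  have Z : ∀ g, dg B g 0 = g % B := fun g => by simp [dg]
  rw [hnd]
  refine ⟨?_, ?_, ?_, ?_, ?_, ?_⟩ <;>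
    simp only [S, Z, D _ _ h0, D _ _ h1, D _ _ h2, D _ _ h3, D _ _ h4, M _ _ h0, M _ _ h1,
      M _ _ h2, M _ _ h3, M _ _ h4, Nat.mod_eq_of_lt h5]

theorem dg_lt {B g : ℕ} (h : g < B ^ 6) (i : ℕ) : dg B g i < B := by
  rcases Nat.eq_zero_or_pos B with rfl | hB
  · simp at h
  · exact Nat.mod_lt _ hB

theorem Ar.dg {B g : ℕ → ℕ → ℕ} (hB : Ar B) (hg : Ar g) (k : ℕ) :
    Ar fun n i => dg (B n i) (g n i) k :=
  (hg.div (hB.pow k)).mod hB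

theorem Ar.nd {B x0 x1 x2 x3 x4 x5 : ℕ → ℕ → ℕ} (hB : Ar B) (h0 : Ar x0) (h1 : Ar x1)
    (h2 : Ar x2) (h3 : Ar x3) (h4 : Ar x4) (h5 : Ar x5) :
    Ar fun n i => nd (B n i) (x0 n i) (x1 n i) (x2 n i) (x3 n i) (x4 n i) (x5 n i) :=
  Ar.ite (.and (.lt h0 hB) (.and (.lt h1 hB) (.and (.lt h2 hB) (.and (.lt h3 hB)
    (.and (.lt h4 hB) (.lt h5 hB))))))
    (h0.add (hB.mul (h1.add (hB.mul (h2.add (hB.mul (h3.add (hB.mul (h4.add (hB.mul h5))))))))))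
    (hB.pow 6)

end ITSHAP

namespace ITSHAP

/-! ## Circuits from uniform tables of ternary gates -/

/-- Quadruples all of whose components are arithmetic. -/
def ArT (f : ℕ → ℕ → ℕ × ℕ × ℕ × ℕ) : Prop :=
  Ar (fun n i => (f n i).1) ∧ Ar (fun n i => (f n i).2.1) ∧ Ar (fun n i => (f n i).2.2.1) ∧
    Ar fun n i => (f n i).2.2.2

theorem ArT.mk {a b c d : ℕ → ℕ → ℕ} (ha : Ar a) (hb : Ar b) (hc : Ar c) (hd : Ar d) :
    ArT fun n i => (a n i, b n i, c n i, d n i) := ⟨ha, hb, hc, hd⟩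

theorem ArT.ite {p : ℕ → ℕ → Prop} [∀ n i, Decidable (p n i)] {f g : ℕ → ℕ → ℕ × ℕ × ℕ × ℕ}
    (hp : ArP p) (hf : ArT f) (hg : ArT g) : ArT fun n i => if p n i then f n i else g n i := by
  refine ⟨?_, ?_, ?_, ?_⟩ <;> simp only [apply_ite Prod.fst, apply_ite Prod.snd]
  · exact .ite hp hf.1 hg.1
  · exact .ite hp hf.2.1 hg.2.1
  · exact .ite hp hf.2.2.1 hg.2.2.1
  · exact .ite hp hf.2.2.2 hg.2.2.2

/-- The sum bit of a full adder. -/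
def xor3 (a b c : Bool) : Bool := (a ^^ b) ^^ c

/-- The carry bit of a full adder. -/
def maj3 (a b c : Bool) : Bool := (a && b) || (c && (a || b))

/-- The value of a table row `(op, a, b, c)`: a constant, an input bit, a sum bit, a carry bit,
or a selection. -/
def rowVal (x : List Bool) (v : ℕ → Bool) (r : ℕ × ℕ × ℕ × ℕ) : Bool :=
  if r.1 = 0 then false
  else if r.1 = 1 then true
  else if r.1 = 2 then x.getD r.2.1 false
  else if r.1 = 3 then xor3 (v r.2.1) (v r.2.2.1) (v r.2.2.2)
  else if r.1 = 4 then maj3 (v r.2.1) (v r.2.2.1) (v r.2.2.2)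
  else if v r.2.1 then v r.2.2.1 else v r.2.2.2

/-- `v` assigns to every row of the table its value, and `false` outside the table. -/
def TabVal (x : List Bool) (size : ℕ) (T : ℕ → ℕ × ℕ × ℕ × ℕ) (v : ℕ → Bool) : Prop :=
  ∀ g, v g = if g < size then rowVal x v (T g) else false

/-- The gate with a given numerical description. -/
def Gate.ofCode (t x y : ℕ) : Gate :=
  if t = 0 then .input x
  else if t = 1 then .const (decide (x ≠ 0))
  else if t = 2 then .not x
  else if t = 3 then .and x y
  else .or x y

theorem Gate.code_ofCode (t x y : ℕ) : (Gate.ofCode t x y).code =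
    (if t < 4 then t else 4, if t = 1 then (if x = 0 then 0 else 1) else x,
      if t < 3 then 0 else y) := by
  unfold Gate.ofCode
  split_ifs <;> simp_all [Gate.code] <;> omega

/-- The gate that carries the value of row `a`. -/
def rowOut (size a : ℕ) : ℕ := if a < size then 8 * a + 7 else 8 * size + 7

/-- Gate number `s` of the eight gates that evaluate row `g`. -/
def expandRow (n size g : ℕ) (r : ℕ × ℕ × ℕ × ℕ) (s : ℕ) : ℕ × ℕ × ℕ × ℕ :=
  if size ≤ g then (1, 0, 0, 0)
  else if r.1 < 3 then
    if s = 7 then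
      if r.1 = 0 then (1, 0, 0, 0)
      else if r.1 = 1 then (1, 1, 0, 0)
      else if r.2.1 < n then (0, r.2.1, 0, 0) else (1, 0, 0, 0)
    else (1, 0, 0, 0)
  else if s = 0 then (3, rowOut size r.2.1, rowOut size r.2.2.1, 0)
  else if s = 1 then (4, rowOut size r.2.1, rowOut size r.2.2.1, 0)
  else if s = 2 then (2, 8 * g, 0, 0)
  else if s = 3 then (3, 8 * g + 1, 8 * g + 2, 0)
  else if s = 4 then (3, if r.1 = 3 then 8 * g + 3 else 8 * g + 1, rowOut size r.2.2.2, 0)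
  else if s = 5 then
    if r.1 = 3 then (4, 8 * g + 3, rowOut size r.2.2.2, 0) else (2, rowOut size r.2.1, 0, 0)
  else if s = 6 then
    if r.1 = 3 then (2, 8 * g + 4, 0, 0) else (3, 8 * g + 5, rowOut size r.2.2.2, 0)
  else if r.1 = 3 then (3, 8 * g + 5, 8 * g + 6, 0)
  else if r.1 = 4 then (4, 8 * g, 8 * g + 4, 0)
  else (4, 8 * g, 8 * g + 6, 0)

/-- The circuit that evaluates a table. -/
def tableCircuit (n size : ℕ) (T : ℕ → ℕ × ℕ × ℕ × ℕ) (outputs : ℕ) (out : ℕ → ℕ) : Circuit where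
  inputs := n
  size := 8 * (size + 1)
  gate G := let e := expandRow n size (G / 8) (T (G / 8)) (G % 8); Gate.ofCode e.1 e.2.1 e.2.2.1
  outputs := outputs
  out o := rowOut size (out o)

theorem Circuit.exists_isValuation {C : Circuit} {d : ℕ} (hr : C.InRange) (hd : C.DepthLE d)
    (x : List Bool) : ∃ v, C.IsValuation x v := by
  obtain ⟨lev, hl⟩ := hd
  let ev : ℕ → ℕ → Bool := fun t =>
    Nat.rec (fun _ => false) (fun _ v g => (C.gate g).value x v) t
  have hcongr : ∀ (g : Gate) (v w : ℕ → Bool), (∀ a ∈ g.args, v a = w a) →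
      g.value x v = g.value x w := by
    intro g v w h
    cases g <;> simp_all [Gate.args, Gate.value]
  have stable : ∀ t g, g < C.size → lev g < t → ev t g = ev (t + 1) g := by
    intro t
    induction t with
    | zero => intro g _ h; omega
    | succ t ih =>
      intro g hg ht
      refine hcongr _ _ _ fun a ha => ih a ((hr.1 g hg).1 a ha) ?_
      have := (hl g hg).2 a ha
      omega
  refine ⟨ev (d + 1), fun g hg => ?_⟩
  have := (hl g hg).1
  exact stable (d + 1) g hg (by omega)

section

variable {n size : ℕ} {T : ℕ → ℕ × ℕ × ℕ × ℕ} {outputs : ℕ} {out : ℕ → ℕ}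

theorem rowOut_lt (size a : ℕ) : rowOut size a < 8 * (size + 1) := by
  unfold rowOut
  split_ifs <;> omega

theorem Gate.forall_args_ofCode {P : ℕ → Prop} {t x y : ℕ} (hx : 2 ≤ t → P x) (hy : 3 ≤ t → P y) :
    ∀ a ∈ (Gate.ofCode t x y).args, P a := by
  unfold Gate.ofCode
  split_ifs <;> simp only [Gate.args, List.mem_cons, List.not_mem_nil, or_false, forall_eq_or_imp,
    forall_eq, IsEmpty.forall_iff, implies_true]
  · exact hx (by omega)
  · exact ⟨hx (by omega), hy (by omega)⟩
  · exact ⟨hx (by omega), hy (by omega)⟩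

theorem Gate.ofCode_eq_input {t x y i : ℕ} (h : Gate.ofCode t x y = .input i) : t = 0 ∧ x = i := by
  unfold Gate.ofCode at h
  split_ifs at h with h0
  exact ⟨h0, by simpa using h⟩

/-- The references of the gates that evaluate row `g`: earlier gates of the same row, and the
gates that carry the values of the rows it refers to. -/
theorem expandRow_refs {n size g s : ℕ} {r : ℕ × ℕ × ℕ × ℕ} (hs : s < 8) {P : ℕ → Prop}
    (h0 : ∀ k < s, g < size → P (8 * g + k))
    (h1 : 3 ≤ r.1 → P (rowOut size r.2.1) ∧ P (rowOut size r.2.2.1) ∧ P (rowOut size r.2.2.2)) :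
    ((expandRow n size g r s).1 = 0 → (expandRow n size g r s).2.1 < n) ∧
    (2 ≤ (expandRow n size g r s).1 → P (expandRow n size g r s).2.1) ∧
    (3 ≤ (expandRow n size g r s).1 → P (expandRow n size g r s).2.2.1) := by
  generalize he : expandRow n size g r s = e
  unfold expandRow at he
  by_cases hg : size ≤ g
  · rw [if_pos hg] at he
    subst he
    refine ⟨?_, ?_, ?_⟩ <;> intro h <;> simp at h
  rw [if_neg hg] at he
  by_cases h3 : r.1 < 3
  · rw [if_pos h3] at he
    split_ifs at he <;> subst he <;> refine ⟨?_, ?_, ?_⟩ <;> intro h <;> simp_all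
  rw [if_neg h3] at he
  obtain ⟨pa, pb, pc⟩ := h1 (by omega)
  have h0' : ∀ k < s, P (8 * g + k) := fun k hk => h0 k hk (by omega)
  split_ifs at he <;> subst he <;> refine ⟨fun h => ?_, fun h => ?_, fun h => ?_⟩ <;>
    first
    | exact pa
    | exact pb
    | exact pc
    | exact h0' _ (by omega)
    | exact h0' 0 (by omega)
    | exact absurd h (by simp)

theorem tableCircuit_inRange : (tableCircuit n size T outputs out).InRange := by
  refine ⟨fun G hG => ?_, fun o _ => rowOut_lt _ _⟩
  simp only [tableCircuit] at hG ⊢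
  obtain ⟨h1, h2, h3⟩ := expandRow_refs (n := n) (size := size) (g := G / 8) (r := T (G / 8))
    (Nat.mod_lt G (show 0 < 8 by omega)) (P := (· < 8 * (size + 1))) (fun k hk hg => by omega)
    fun _ => ⟨rowOut_lt _ _, rowOut_lt _ _, rowOut_lt _ _⟩
  refine ⟨Gate.forall_args_ofCode h2 h3, fun i hi => ?_⟩
  obtain ⟨h4, h5⟩ := Gate.ofCode_eq_input hi
  exact h5 ▸ h1 h4

theorem tableCircuit_depthLE {d : ℕ} {lev : ℕ → ℕ}
    (h : ∀ g < size, lev g ≤ d ∧ (3 ≤ (T g).1 → ((T g).2.1 < size → lev (T g).2.1 < lev g) ∧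
      ((T g).2.2.1 < size → lev (T g).2.2.1 < lev g) ∧
      ((T g).2.2.2 < size → lev (T g).2.2.2 < lev g))) :
    (tableCircuit n size T outputs out).DepthLE (8 * d + 8) := by
  let L : ℕ → ℕ := fun G => if G / 8 < size then 8 * lev (G / 8) + G % 8 + 1 else 0
  have hL : ∀ g s, g < size → s < 8 → L (8 * g + s) = 8 * lev g + s + 1 := by
    intro g s hg hs
    have h1 : (8 * g + s) / 8 = g := by omega
    have h2 : (8 * g + s) % 8 = s := by omega
    simp only [L, h1, h2, if_pos hg]
  have hr : ∀ g a, (a < size → lev a < lev g) → L (rowOut size a) < 8 * lev g + 1 := by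
    intro g a ha
    unfold rowOut
    split_ifs with hc
    · rw [hL _ _ hc (by omega)]
      have := ha hc
      omega
    · have h1 : (8 * size + 7) / 8 = size := by omega
      simp [L, h1]
  refine ⟨L, fun G hG => ?_⟩
  simp only [tableCircuit]
  rcases Nat.lt_or_ge (G / 8) size with hg | hg
  · obtain ⟨h0, h1⟩ := h _ hg
    have hG' : L G = 8 * lev (G / 8) + G % 8 + 1 := if_pos hg
    refine ⟨by omega, ?_⟩
    have := expandRow_refs (n := n) (size := size) (g := G / 8) (r := T (G / 8))
      (Nat.mod_lt G (show 0 < 8 by omega)) (P := fun a => L a < L G)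
      (fun k hk hg => by rw [hL _ _ hg (by omega)]; omega) fun h3 => by
        obtain ⟨ha, hb, hc⟩ := h1 h3
        have ra := hr (G / 8) _ ha
        have rb := hr (G / 8) _ hb
        have rc := hr (G / 8) _ hc
        exact ⟨by omega, by omega, by omega⟩
    exact Gate.forall_args_ofCode this.2.1 this.2.2
  · have hG' : L G = 0 := if_neg (by omega)
    refine ⟨by omega, ?_⟩
    simp [expandRow, hg, Gate.ofCode, Gate.args]

theorem tableCircuit_isValuation {x : List Bool} (hx : x.length = n) {v : ℕ → Bool}
    (hv : (tableCircuit n size T outputs out).IsValuation x v) :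
    ∃ V, TabVal x size T V ∧ ∀ a, v (rowOut size a) = V a := by
  have key : ∀ g s, g ≤ size → s < 8 → v (8 * g + s) =
      (Gate.ofCode (expandRow n size g (T g) s).1 (expandRow n size g (T g) s).2.1
        (expandRow n size g (T g) s).2.2.1).value x v := by
    intro g s hg hs
    have h1 : (8 * g + s) / 8 = g := by omega
    have h2 : (8 * g + s) % 8 = s := by omega
    have := hv (8 * g + s) (by simp only [tableCircuit]; omega)
    simpa only [tableCircuit, h1, h2] using this
  have hV : ∀ a, v (rowOut size a) = if a < size then v (8 * a + 7) else false := by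
    intro a
    unfold rowOut
    split_ifs with h
    · rfl
    · rw [key size 7 le_rfl (by omega)]
      simp [expandRow, Gate.ofCode, Gate.value]
  refine ⟨fun a => v (rowOut size a), fun g => ?_, fun a => rfl⟩
  beta_reduce
  rw [hV g]
  split_ifs with hg
  swap
  · rfl
  have hng : ¬ size ≤ g := by omega
  have k0 := key g 0 hg.le (by omega)
  have k1 := key g 1 hg.le (by omega)
  have k2 := key g 2 hg.le (by omega)
  have k3 := key g 3 hg.le (by omega)
  have k4 := key g 4 hg.le (by omega)
  have k5 := key g 5 hg.le (by omega)
  have k6 := key g 6 hg.le (by omega)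
  have k7 := key g 7 hg.le (by omega)
  generalize T g = r at *
  unfold expandRow at k0 k1 k2 k3 k4 k5 k6 k7
  simp only [if_neg hng] at k0 k1 k2 k3 k4 k5 k6 k7
  rcases Nat.lt_or_ge r.1 3 with h3 | h3
  · rw [k7]
    unfold rowVal
    obtain h | h | h : r.1 = 0 ∨ r.1 = 1 ∨ r.1 = 2 := by omega
    · simp [h, Gate.ofCode, Gate.value]
    · simp [h, Gate.ofCode, Gate.value]
    · by_cases hn : r.2.1 < n
      · simp [h, hn, Gate.ofCode, Gate.value]
      · simp [h, hn, Gate.ofCode, Gate.value, List.getD, List.getElem?_eq_none (by omega : x.length ≤ r.2.1)]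
  · have hn3 : ¬ r.1 < 3 := by omega
    simp only [if_neg hn3] at k0 k1 k2 k3 k4 k5 k6 k7
    simp [Gate.ofCode, Gate.value] at k0 k1 k2 k3
    unfold rowVal
    rw [if_neg (by omega), if_neg (by omega), if_neg (by omega)]
    by_cases h : r.1 = 3
    · simp [h, Gate.ofCode, Gate.value] at k4 k5 k6 k7 ⊢
      rw [k7, k6, k5, k4, k3, k2, k1, k0]
      unfold xor3
      cases v (rowOut size r.2.1) <;> cases v (rowOut size r.2.2.1) <;> cases v (rowOut size r.2.2.2) <;> rfl
    · by_cases h4 : r.1 = 4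
      · simp [h4, Gate.ofCode, Gate.value] at k4 k5 k6 k7 ⊢
        rw [k7, k4, k1, k0]
        unfold maj3
        cases v (rowOut size r.2.1) <;> cases v (rowOut size r.2.2.1) <;> cases v (rowOut size r.2.2.2) <;> rfl
      · simp [h, h4, Gate.ofCode, Gate.value] at k4 k5 k6 k7 ⊢
        rw [k7, k6, k5, k0]
        cases v (rowOut size r.2.1) <;> cases v (rowOut size r.2.2.1) <;> cases v (rowOut size r.2.2.2) <;> rfl

end

theorem Ar.expandRow {size g s : ℕ → ℕ → ℕ} {r : ℕ → ℕ → ℕ × ℕ × ℕ × ℕ} (hsize : Ar size)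
    (hg : Ar g) (hs : Ar s) (hr : ArT r) :
    ArT fun n i => expandRow n (size n i) (g n i) (r n i) (s n i) := by
  obtain ⟨h1, h2, h3, h4⟩ := hr
  have hout : ∀ {a : ℕ → ℕ → ℕ}, Ar a → Ar fun n i => rowOut (size n i) (a n i) := fun ha =>
    .ite (.lt ha hsize) (.add (.mul (.const 8) ha) (.const 7))
      (.add (.mul (.const 8) hsize) (.const 7))
  have c := Ar.const
  have o2 := hout h2
  have o3 := hout h3
  have o4 := hout h4
  have g8 : ∀ k, Ar fun n i => 8 * g n i + k := fun k => (Ar.mul (c 8) hg).add (c k)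
  have e : ∀ k, ArP fun n i => s n i = k := fun k => .eq hs (c k)
  have f : ∀ k, ArP fun n i => (r n i).1 = k := fun k => .eq h1 (c k)
  have z : ∀ k, ArT fun _ _ => (1, k, 0, 0) := fun k => .mk (c 1) (c k) (c 0) (c 0)
  refine .ite (.le hsize hg) (z 0) (.ite (.lt h1 (c 3)) (.ite (e 7) (.ite (f 0) (z 0)
    (.ite (f 1) (z 1) (.ite (.lt h2 .fst) (.mk (c 0) h2 (c 0) (c 0)) (z 0)))) (z 0)) ?_)
  refine .ite (e 0) (.mk (c 3) o2 o3 (c 0)) (.ite (e 1) (.mk (c 4) o2 o3 (c 0))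
    (.ite (e 2) (.mk (c 2) (g8 0) (c 0) (c 0)) (.ite (e 3) (.mk (c 3) (g8 1) (g8 2) (c 0))
    (.ite (e 4) (.mk (c 3) (.ite (f 3) (g8 3) (g8 1)) o4 (c 0)) ?_))))
  refine .ite (e 5) (.ite (f 3) (.mk (c 4) (g8 3) o4 (c 0)) (.mk (c 2) o2 (c 0) (c 0)))
    (.ite (e 6) (.ite (f 3) (.mk (c 2) (g8 4) (c 0) (c 0)) (.mk (c 3) (g8 5) o4 (c 0)))
    (.ite (f 3) (.mk (c 3) (g8 5) (g8 6) (c 0)) (.ite (f 4) (.mk (c 4) (g8 0) (g8 4) (c 0))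
      (.mk (c 4) (g8 0) (g8 6) (c 0)))))

/-- A problem is in NC² if it is solved by evaluating a uniform table of ternary gates of
polynomial size in which the references descend along `O(log² n)` levels. -/
theorem inNC2_of_table {Inst : Type} {encode : Inst → List Bool} {valid : Inst → Prop}
    {solution : Inst → List Bool → Prop} (size outputs : ℕ → ℕ) (out : ℕ → ℕ → ℕ)
    (T : ℕ → ℕ → ℕ × ℕ × ℕ × ℕ) (hsize : Ar fun n _ => size n) (houtputs : Ar fun n _ => outputs n)
    (hout : Ar out) (hT : ArT T)
    (hlev : ∃ c, ∀ n, ∃ lev : ℕ → ℕ, ∀ g < size n, lev g ≤ c * Nat.log 2 n ^ 2 + c ∧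
      (3 ≤ (T n g).1 → ((T n g).2.1 < size n → lev (T n g).2.1 < lev g) ∧
        ((T n g).2.2.1 < size n → lev (T n g).2.2.1 < lev g) ∧
        ((T n g).2.2.2 < size n → lev (T n g).2.2.2 < lev g)))
    (hsol : ∀ I, valid I → ∀ V, TabVal (encode I) (size (encode I).length) (T (encode I).length) V →
      solution I ((List.range (outputs (encode I).length)).map fun o =>
        V (out (encode I).length o))) :
    InNC2 encode valid solution := by
  obtain ⟨c, hc⟩ := hlev
  have hsz : Ar fun n _ => 8 * (size n + 1) := (Ar.const 8).mul (hsize.add (.const 1))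
  obtain ⟨s, hs⟩ : PolyBdd id fun n => 8 * (size n + 1) := by
    obtain ⟨s, hs⟩ := hsz.polyBdd
    exact ⟨s, fun n => by simpa using hs (n, 0)⟩
  have hrow : ArT fun n G => expandRow n (size n) (G / 8) (T n (G / 8)) (G % 8) := by
    have h8 : Ar fun _ G => G / 8 := Ar.snd.div (.const 8)
    refine Ar.expandRow hsize h8 (.mod .snd (.const 8)) ?_
    have comp : ∀ {f : ℕ → ℕ → ℕ}, Ar f → Ar fun n G => f n (G / 8) := by
      intro f hf
      induction hf with
      | fst => exact .fst
      | snd => exact h8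
      | const c => exact .const c
      | add _ _ h1 h2 => exact h1.add h2
      | sub _ _ h1 h2 => exact h1.sub h2
      | mul _ _ h1 h2 => exact h1.mul h2
      | div _ _ h1 h2 => exact h1.div h2
    exact ⟨comp hT.1, comp hT.2.1, comp hT.2.2.1, comp hT.2.2.2⟩
  have hdepth : ∀ n, (tableCircuit n (size n) (T n) (outputs n) (out n)).DepthLE
      (8 * (c * Nat.log 2 n ^ 2 + c) + 8) := fun n => by
    obtain ⟨lev, hl⟩ := hc n
    exact tableCircuit_depthLE hl
  refine ⟨fun n => tableCircuit n (size n) (T n) (outputs n) (out n), 8 * c + 8 + s,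
    ⟨hsz.logSpaceComputable, houtputs.logSpaceComputable, ?_, ?_, ?_, ?_⟩, fun n => ⟨rfl,
      tableCircuit_inRange, (hs n).trans (poly_mono (by omega) _), ?_⟩, fun I hI => ?_⟩
  · exact (Ar.ite (.lt hout hsize) (.add (.mul (.const 8) hout) (.const 7))
      (.add (.mul (.const 8) hsize) (.const 7))).logSpaceComputable
  · simp only [tableCircuit, Gate.code_ofCode]
    exact (Ar.ite (.lt hrow.1 (.const 4)) hrow.1 (.const 4)).logSpaceComputable
  · simp only [tableCircuit, Gate.code_ofCode]
    exact (Ar.ite (.eq hrow.1 (.const 1)) (.ite (.eq hrow.2.1 (.const 0)) (.const 0) (.const 1))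
      hrow.2.1).logSpaceComputable
  · simp only [tableCircuit, Gate.code_ofCode]
    exact (Ar.ite (.lt hrow.1 (.const 3)) (.const 0) hrow.2.2.1).logSpaceComputable
  · obtain ⟨L, hL⟩ := hdepth n
    refine ⟨L, fun g hg => ⟨(hL g hg).1.trans ?_, (hL g hg).2⟩⟩
    have : 8 * c * Nat.log 2 n ^ 2 ≤ (8 * c + 8 + s) * Nat.log 2 n ^ 2 :=
      Nat.mul_le_mul_right _ (by omega)
    rw [mul_add, ← mul_assoc]
    omega
  · obtain ⟨v, hv⟩ := Circuit.exists_isValuation (tableCircuit_inRange) (hdepth _) (encode I)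
    obtain ⟨V, hV, hVv⟩ := tableCircuit_isValuation rfl hv
    refine ⟨_, ⟨v, hv, rfl⟩, ?_⟩
    have := hsol I hI V hV
    simpa only [tableCircuit, hVv] using this

end ITSHAP

namespace ITSHAP

/-! ## Tables for systems of sums of products -/

/-- A system of equations that defines the `w`-bit words `X a`, `a < A`: either `leaf a ≠ 0` and
the bits of `X a` are given (code `0` is `false`, code `1` is `true`, code `p + 2` is the input
bit `p`), or `X a = ∑ k < K, X (left a k) * X (right a k)`. Words outside the range are zero.
The result is the quotient of the words `num` (with negative `neg`) and `den`. -/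
structure SumProd where
  A : ℕ
  K : ℕ
  w : ℕ
  leaf : ℕ → ℕ
  bit : ℕ → ℕ → ℕ
  left : ℕ → ℕ → ℕ
  right : ℕ → ℕ → ℕ
  num : ℕ
  neg : ℕ
  den : ℕ

namespace SumProd

/-- Uniformity of a family of systems. -/
structure Uniform (S : ℕ → SumProd) : Prop where
  A : Ar fun n _ => (S n).A
  K : Ar fun n _ => (S n).K
  w : Ar fun n _ => (S n).w
  num : Ar fun n _ => (S n).num
  neg : Ar fun n _ => (S n).neg
  den : Ar fun n _ => (S n).den
  leaf : ∀ {a : ℕ → ℕ → ℕ}, Ar a → Ar fun n g => (S n).leaf (a n g)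
  bit : ∀ {a i : ℕ → ℕ → ℕ}, Ar a → Ar i → Ar fun n g => (S n).bit (a n g) (i n g)
  left : ∀ {a k : ℕ → ℕ → ℕ}, Ar a → Ar k → Ar fun n g => (S n).left (a n g) (k n g)
  right : ∀ {a k : ℕ → ℕ → ℕ}, Ar a → Ar k → Ar fun n g => (S n).right (a n g) (k n g)

variable (S : SumProd)

/-- The number of partial products in a sum of products. -/
def m : ℕ := 4 * S.K * S.w

/-- The base for the addresses of the table rows. -/
def base : ℕ := S.A + 2 * S.m + S.w + 9

/-- Addresses of table rows. Words are sums of two rows (`h = 0, 1`) of bits; the address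
`(0, a, q, i, h)` belongs to bit `i` of the partial sum at node `q` of a binary tree of
carry-save adders, `(1, a, q, i, h)` to the intermediate sums, `(2, a, s, i, h)` to the carry out of
position `i` after `s` positions when the carry in is `h`, `(3, a, 0, i, 0)` to the binary digits
of `X a`, and `(4, 0, 0, i, 0)` to the digits of the absolute value of the numerator. -/
def adr (k a q i h : ℕ) : ℕ := nd S.base k a q i h 0

/-- The row of a constant `false`. -/
def rowF : ℕ × ℕ × ℕ × ℕ := (0, 0, 0, 0)

/-- The row for a leaf bit. -/
def rowBit (c : ℕ) : ℕ × ℕ × ℕ × ℕ :=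
  if c = 0 then (0, 0, 0, 0) else if c = 1 then (1, 0, 0, 0) else (2, c - 2, 0, 0)

/-- The rows for words. -/
def rowW (a q i h : ℕ) : ℕ × ℕ × ℕ × ℕ :=
  if ¬ (a < S.A ∧ i < S.w ∧ 0 < q) then rowF
  else if ¬ S.leaf a = 0 then if h = 0 then rowBit (S.bit a i) else rowF
  else if q < S.m then
    if h = 0 then (3, S.adr 1 a q i 0, S.adr 1 a q i 1, S.adr 0 a (2 * q + 1) i 1)
    else if i = 0 then rowF
    else (4, S.adr 1 a q (i - 1) 0, S.adr 1 a q (i - 1) 1, S.adr 0 a (2 * q + 1) (i - 1) 1)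
  else if h = 0 ∧ (q - S.m) / 2 / 2 / S.w < S.K ∧ (q - S.m) / 2 / 2 % S.w ≤ i then
    (4, S.adr 0 (S.left a ((q - S.m) / 2 / 2 / S.w)) 1 (i - (q - S.m) / 2 / 2 % S.w)
        ((q - S.m) % 2),
      S.adr 0 (S.right a ((q - S.m) / 2 / 2 / S.w)) 1 ((q - S.m) / 2 / 2 % S.w)
        ((q - S.m) / 2 % 2), S.base ^ 6)
  else rowF

/-- The rows for intermediate sums. -/
def rowC (a q i h : ℕ) : ℕ × ℕ × ℕ × ℕ :=
  if ¬ (a < S.A ∧ 0 < q ∧ q < S.m) then rowF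
  else if h = 0 then (3, S.adr 0 a (2 * q) i 0, S.adr 0 a (2 * q) i 1, S.adr 0 a (2 * q + 1) i 0)
  else if i = 0 then rowF
  else (4, S.adr 0 a (2 * q) (i - 1) 0, S.adr 0 a (2 * q) (i - 1) 1,
    S.adr 0 a (2 * q + 1) (i - 1) 0)

/-- The rows for carries. -/
def rowY (a s i h : ℕ) : ℕ × ℕ × ℕ × ℕ :=
  if s = 0 then (h, 0, 0, 0)
  else if s = 1 then (4, S.adr 0 a 1 i 0, S.adr 0 a 1 i 1, S.adr 2 a 0 i h)
  else (4, S.adr 2 a (s - s / 2) i 0, S.adr 2 a (s - s / 2) i 1,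
    S.adr 2 a (s / 2) (i - (s - s / 2)) h)

/-- All rows. -/
def row (k a q i h : ℕ) : ℕ × ℕ × ℕ × ℕ :=
  if ¬ h < 2 then rowF
  else if k = 0 then S.rowW a q i h
  else if k = 1 then S.rowC a q i h
  else if k = 2 then S.rowY a q i h
  else if k = 3 then (3, S.adr 0 a 1 i 0, S.adr 0 a 1 i 1, S.adr 2 a i (i - 1) 0)
  else if k = 4 then (5, S.adr 3 S.num 0 (S.w - 1) 0, S.adr 3 S.neg 0 i 0, S.adr 3 S.num 0 i 0)
  else rowF

/-- The table of a system. -/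
def table (g : ℕ) : ℕ × ℕ × ℕ × ℕ :=
  S.row (dg S.base g 0) (dg S.base g 1) (dg S.base g 2) (dg S.base g 3) (dg S.base g 4)

/-- The rows that are output: sign, absolute value of the numerator, denominator. -/
def out (o : ℕ) : ℕ :=
  if o = 0 then S.adr 3 S.num 0 (S.w - 1) 0
  else if o < S.w + 1 then S.adr 4 0 0 (o - 1) 0
  else S.adr 3 S.den 0 (o - (S.w + 1)) 0

variable {S}

section

variable {F : ℕ → SumProd}

theorem Uniform.m (u : Uniform F) : Ar fun n _ => (F n).m := ((Ar.const 4).mul u.K).mul u.w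

theorem Uniform.base (u : Uniform F) : Ar fun n _ => (F n).base :=
  ((u.A.add ((Ar.const 2).mul u.m)).add u.w).add (.const 9)

theorem Uniform.adr (u : Uniform F) {k a q i h : ℕ → ℕ → ℕ} (hk : Ar k) (ha : Ar a) (hq : Ar q)
    (hi : Ar i) (hh : Ar h) :
    Ar fun n g => (F n).adr (k n g) (a n g) (q n g) (i n g) (h n g) :=
  Ar.nd u.base hk ha hq hi hh (.const 0)

theorem Uniform.table (u : Uniform F) : ArT fun n g => (F n).table g := by
  have c := Ar.const
  have d : ∀ k, Ar fun n g => dg (F n).base g k := fun k => Ar.dg u.base .snd k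
  obtain ⟨d0, d1, d2, d3, d4⟩ :=
    (⟨d 0, d 1, d 2, d 3, d 4⟩ : _ ∧ _ ∧ _ ∧ _ ∧ _)
  have hF : ArT fun _ _ => rowF := .mk (c 0) (c 0) (c 0) (c 0)
  have b := u.bit d1 d3
  have d31 := d3.sub (c 1)
  have q2 := (c 2).mul d2
  have q21 := q2.add (c 1)
  have r := d2.sub u.m
  have r22 := (r.div (c 2)).div (c 2)
  have hj := r22.mod u.w
  have hk := r22.div u.w
  have s2 := d2.div (c 2)
  have s1 := d2.sub s2
  have hW : ArT fun n g => (F n).rowW (dg (F n).base g 1) (dg (F n).base g 2)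
      (dg (F n).base g 3) (dg (F n).base g 4) := by
    refine .ite (.not (.and (.lt d1 u.A) (.and (.lt d3 u.w) (.lt (c 0) d2)))) hF
      (.ite (.not (.eq (u.leaf d1) (c 0))) (.ite (.eq d4 (c 0)) (.ite (.eq b (c 0)) hF
      (.ite (.eq b (c 1)) (.mk (c 1) (c 0) (c 0) (c 0))
        (.mk (c 2) (b.sub (c 2)) (c 0) (c 0)))) hF) (.ite (.lt d2 u.m) ?_ ?_))
    · exact .ite (.eq d4 (c 0)) (.mk (c 3) (u.adr (c 1) d1 d2 d3 (c 0))
        (u.adr (c 1) d1 d2 d3 (c 1)) (u.adr (c 0) d1 q21 d3 (c 1)))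
        (.ite (.eq d3 (c 0)) hF (.mk (c 4) (u.adr (c 1) d1 d2 d31 (c 0))
          (u.adr (c 1) d1 d2 d31 (c 1)) (u.adr (c 0) d1 q21 d31 (c 1))))
    · exact .ite (.and (.eq d4 (c 0)) (.and (.lt hk u.K) (.le hj d3)))
        (.mk (c 4) (u.adr (c 0) (u.left d1 hk) (c 1) (d3.sub hj) (r.mod (c 2)))
          (u.adr (c 0) (u.right d1 hk) (c 1) hj ((r.div (c 2)).mod (c 2))) (u.base.pow 6)) hF
  have hC : ArT fun n g => (F n).rowC (dg (F n).base g 1) (dg (F n).base g 2)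
      (dg (F n).base g 3) (dg (F n).base g 4) :=
    .ite (.not (.and (.lt d1 u.A) (.and (.lt (c 0) d2) (.lt d2 u.m)))) hF
      (.ite (.eq d4 (c 0)) (.mk (c 3) (u.adr (c 0) d1 q2 d3 (c 0)) (u.adr (c 0) d1 q2 d3 (c 1))
        (u.adr (c 0) d1 q21 d3 (c 0))) (.ite (.eq d3 (c 0)) hF
        (.mk (c 4) (u.adr (c 0) d1 q2 d31 (c 0)) (u.adr (c 0) d1 q2 d31 (c 1))
        (u.adr (c 0) d1 q21 d31 (c 0)))))
  have hY : ArT fun n g => (F n).rowY (dg (F n).base g 1) (dg (F n).base g 2)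
      (dg (F n).base g 3) (dg (F n).base g 4) :=
    .ite (.eq d2 (c 0)) (.mk d4 (c 0) (c 0) (c 0)) (.ite (.eq d2 (c 1))
      (.mk (c 4) (u.adr (c 0) d1 (c 1) d3 (c 0)) (u.adr (c 0) d1 (c 1) d3 (c 1))
        (u.adr (c 2) d1 (c 0) d3 d4))
      (.mk (c 4) (u.adr (c 2) d1 s1 d3 (c 0)) (u.adr (c 2) d1 s1 d3 (c 1))
        (u.adr (c 2) d1 s2 (d3.sub s1) d4)))
  exact .ite (.not (.lt d4 (c 2))) hF (.ite (.eq d0 (c 0)) hW (.ite (.eq d0 (c 1)) hC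
    (.ite (.eq d0 (c 2)) hY (.ite (.eq d0 (c 3))
      (.mk (c 3) (u.adr (c 0) d1 (c 1) d3 (c 0)) (u.adr (c 0) d1 (c 1) d3 (c 1))
        (u.adr (c 2) d1 d3 d31 (c 0)))
      (.ite (.eq d0 (c 4)) (.mk (c 5) (u.adr (c 3) u.num (c 0) (u.w.sub (c 1)) (c 0))
        (u.adr (c 3) u.neg (c 0) d3 (c 0)) (u.adr (c 3) u.num (c 0) d3 (c 0))) hF)))))

theorem Uniform.out (u : Uniform F) : Ar fun n o => (F n).out o :=
  .ite (.eq .snd (.const 0)) (u.adr (.const 3) u.num (.const 0) (u.w.sub (.const 1)) (.const 0))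
    (.ite (.lt .snd (u.w.add (.const 1)))
      (u.adr (.const 4) (.const 0) (.const 0) (.sub .snd (.const 1)) (.const 0))
      (u.adr (.const 3) u.den (.const 0) (.sub .snd (u.w.add (.const 1))) (.const 0)))

end

/-! ### Levels -/

/-- The level of the row with the given digits, if the words of the system have levels `lv`
bounded by `M`. -/
def lvRow (S : SumProd) (lv : ℕ → ℕ) (M k a q : ℕ) : ℕ :=
  if k = 0 then
    (if a < S.A then (lv a + 1) * (2 * Nat.log 2 (2 * S.m) + 2) else 0) +
      (2 * (Nat.log 2 (2 * S.m) - Nat.log 2 q) + 1)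
  else if k = 1 then
    (if a < S.A then (lv a + 1) * (2 * Nat.log 2 (2 * S.m) + 2) else 0) +
      2 * (Nat.log 2 (2 * S.m) - Nat.log 2 q)
  else if k = 2 then (M + 2) * (2 * Nat.log 2 (2 * S.m) + 2) + Nat.clog 2 q + min q 1
  else if k = 3 then (M + 2) * (2 * Nat.log 2 (2 * S.m) + 2) + Nat.clog 2 S.base + 2
  else if k = 4 then (M + 2) * (2 * Nat.log 2 (2 * S.m) + 2) + Nat.clog 2 S.base + 3
  else 0

theorem log_two_mul {q : ℕ} (hq : 0 < q) : Nat.log 2 (2 * q) = Nat.log 2 q + 1 := by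
  rw [mul_comm, Nat.log_mul_base (by omega) (by omega)]

theorem log_two_mul_add_one {q : ℕ} (hq : 0 < q) :
    Nat.log 2 (2 * q + 1) = Nat.log 2 q + 1 := by
  rw [Nat.log_of_one_lt_of_le (by omega) (by omega)]
  congr 2
  omega

theorem clog_halves {s : ℕ} (hs : 2 ≤ s) :
    Nat.clog 2 (s - s / 2) < Nat.clog 2 s ∧ Nat.clog 2 (s / 2) < Nat.clog 2 s := by
  have h : Nat.clog 2 s = Nat.clog 2 (s - s / 2) + 1 := by
    rw [Nat.clog_of_one_lt (by omega) hs]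
    congr 2
    omega
  have := Nat.clog_mono_right 2 (show s / 2 ≤ s - s / 2 by omega)
  omega

theorem table_levels (S : SumProd) (lv : ℕ → ℕ) (M : ℕ) (hM : ∀ a < S.A, lv a ≤ M)
    (hlv : ∀ a < S.A, S.leaf a = 0 → ∀ k < S.K,
      (S.left a k < S.A → lv (S.left a k) < lv a) ∧
      (S.right a k < S.A → lv (S.right a k) < lv a)) :
    ∃ lev : ℕ → ℕ, ∀ g < S.base ^ 6,
      lev g ≤ (M + 2) * (2 * Nat.log 2 (2 * S.m) + 2) + Nat.clog 2 S.base + 3 ∧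
      (3 ≤ (S.table g).1 →
        ((S.table g).2.1 < S.base ^ 6 → lev (S.table g).2.1 < lev g) ∧
        ((S.table g).2.2.1 < S.base ^ 6 → lev (S.table g).2.2.1 < lev g) ∧
        ((S.table g).2.2.2 < S.base ^ 6 → lev (S.table g).2.2.2 < lev g)) := by
  set Λ := Nat.log 2 (2 * S.m) with hΛ
  have hadr : ∀ k a q i h l, (a < S.base → q < S.base → i < S.base → lvRow S lv M k a q < l) →
      (S.adr k a q i h < S.base ^ 6 → lvRow S lv M (dg S.base (S.adr k a q i h) 0)
        (dg S.base (S.adr k a q i h) 1) (dg S.base (S.adr k a q i h) 2) < l) := by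
    intro k a q i h l hl hlt
    have hd := lt_of_nd_lt hlt
    obtain ⟨h0, h1, h2, -, -⟩ := dg_nd hd
    unfold adr
    rw [h0, h1, h2]
    exact hl hd.2.1 hd.2.2.1 hd.2.2.2.1
  have hbase : ∀ a, (if a < S.A then (lv a + 1) * (2 * Λ + 2) else 0) ≤
      (M + 1) * (2 * Λ + 2) := by
    intro a
    split_ifs with ha
    · exact Nat.mul_le_mul_right _ (by have := hM a ha; omega)
    · omega
  have hM2 : (M + 2) * (2 * Λ + 2) = (M + 1) * (2 * Λ + 2) + (2 * Λ + 2) := by ring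
  refine ⟨fun g => lvRow S lv M (dg S.base g 0) (dg S.base g 1) (dg S.base g 2),
    fun g hg => ⟨?_, ?_⟩⟩
  · beta_reduce
    have h2 := Nat.clog_mono_right 2 (dg_lt hg 2).le
    generalize dg S.base g 0 = k, dg S.base g 1 = a, dg S.base g 2 = q at *
    have := hbase a
    unfold lvRow
    rw [← hΛ]
    generalize (if a < S.A then (lv a + 1) * (2 * Λ + 2) else 0) = z at *
    split_ifs <;> omega
  · have hi := dg_lt hg 3
    have hq := dg_lt hg 2
    unfold table
    beta_reduce
    generalize dg S.base g 0 = k, dg S.base g 1 = a, dg S.base g 2 = q, dg S.base g 3 = i,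
      dg S.base g 4 = h at *
    have hout : ∀ l, S.base ^ 6 < S.base ^ 6 → lvRow S lv M (dg S.base (S.base ^ 6) 0)
      (dg S.base (S.base ^ 6) 1) (dg S.base (S.base ^ 6) 2) < l := fun l h => by omega
    unfold row
    by_cases hh : h < 2
    swap
    · simp [hh, rowF]
    rw [if_neg (not_not.2 hh)]
    by_cases k0 : k = 0
    · subst k0
      rw [if_pos rfl]
      unfold rowW
      by_cases h1 : a < S.A ∧ i < S.w ∧ 0 < q
      swap
      · simp only [h1, not_false_eq_true, if_true, rowF]; omega
      rw [if_neg (not_not.2 h1)]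
      obtain ⟨ha, -, hq0⟩ := h1
      by_cases hl : S.leaf a = 0
      swap
      · rw [if_pos hl]
        unfold rowBit rowF
        split_ifs <;> intro hc <;> simp at hc
      rw [if_neg (not_not.2 hl)]
      by_cases hm : q < S.m
      · have e1 := log_two_mul_add_one hq0
        have e2 := Nat.log_mono_right (b := 2) (show 2 * q ≤ 2 * S.m by omega)
        rw [log_two_mul hq0, ← hΛ] at e2
        have k1 : lvRow S lv M 1 a q < lvRow S lv M 0 a q := by
          simp only [lvRow, ← hΛ, if_pos, one_ne_zero, if_false]; omega
        have k2 : lvRow S lv M 0 a (2 * q + 1) < lvRow S lv M 0 a q := by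
          simp only [lvRow, ← hΛ, if_pos, e1]; omega
        rw [if_pos hm]
        split_ifs
        · exact fun _ => ⟨hadr _ _ _ _ _ _ fun _ _ _ => k1, hadr _ _ _ _ _ _ fun _ _ _ => k1,
            hadr _ _ _ _ _ _ fun _ _ _ => k2⟩
        · intro hc; simp [rowF] at hc
        · exact fun _ => ⟨hadr _ _ _ _ _ _ fun _ _ _ => k1, hadr _ _ _ _ _ _ fun _ _ _ => k1,
            hadr _ _ _ _ _ _ fun _ _ _ => k2⟩
      · rw [if_neg hm]
        split_ifs with hc
        · have key : ∀ b, (b < S.A → lv b < lv a) →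
              lvRow S lv M 0 b 1 < lvRow S lv M 0 a q := by
            intro b hb
            simp only [lvRow, ← hΛ, if_pos, if_pos ha, Nat.log_one_right]
            split_ifs with hbA
            · have : (lv b + 1 + 1) * (2 * Λ + 2) ≤ (lv a + 1) * (2 * Λ + 2) :=
                Nat.mul_le_mul_right _ (by have := hb hbA; omega)
              have : (lv b + 1 + 1) * (2 * Λ + 2) = (lv b + 1) * (2 * Λ + 2) + (2 * Λ + 2) := by
                ring
              omega
            · have : 1 * (2 * Λ + 2) ≤ (lv a + 1) * (2 * Λ + 2) :=
                Nat.mul_le_mul_right _ (by omega)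
              omega
          obtain ⟨hl1, hl2⟩ := hlv a ha hl _ hc.2.1
          exact fun _ => ⟨hadr _ _ _ _ _ _ fun _ _ _ => key _ hl1,
            hadr _ _ _ _ _ _ fun _ _ _ => key _ hl2, hout _⟩
        · intro hc; simp [rowF] at hc
    rw [if_neg k0]
    by_cases k1 : k = 1
    · subst k1
      rw [if_pos rfl]
      unfold rowC
      by_cases h1 : a < S.A ∧ 0 < q ∧ q < S.m
      swap
      · simp only [h1, not_false_eq_true, if_true, rowF]; omega
      rw [if_neg (not_not.2 h1)]
      obtain ⟨ha, hq0, hm⟩ := h1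
      have e1 := log_two_mul_add_one hq0
      have e3 := log_two_mul hq0
      have e2 := Nat.log_mono_right (b := 2) (show 2 * q ≤ 2 * S.m by omega)
      rw [e3, ← hΛ] at e2
      have k1 : lvRow S lv M 0 a (2 * q) < lvRow S lv M 1 a q := by
        simp only [lvRow, ← hΛ, if_pos, e3, one_ne_zero, if_false]; omega
      have k2 : lvRow S lv M 0 a (2 * q + 1) < lvRow S lv M 1 a q := by
        simp only [lvRow, ← hΛ, if_pos, e1, one_ne_zero, if_false]; omega
      split_ifs
      · exact fun _ => ⟨hadr _ _ _ _ _ _ fun _ _ _ => k1, hadr _ _ _ _ _ _ fun _ _ _ => k1,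
          hadr _ _ _ _ _ _ fun _ _ _ => k2⟩
      · intro hc; simp [rowF] at hc
      · exact fun _ => ⟨hadr _ _ _ _ _ _ fun _ _ _ => k1, hadr _ _ _ _ _ _ fun _ _ _ => k1,
          hadr _ _ _ _ _ _ fun _ _ _ => k2⟩
    rw [if_neg k1]
    have top : ∀ b, lvRow S lv M 0 b 1 < (M + 2) * (2 * Λ + 2) := by
      intro b
      simp only [lvRow, ← hΛ, if_pos, Nat.log_one_right]
      have := hbase b
      omega
    have lY : ∀ s, lvRow S lv M 2 a s = (M + 2) * (2 * Λ + 2) + Nat.clog 2 s + min s 1 := fun s => by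
      simp [lvRow, hΛ]
    by_cases k2 : k = 2
    · subst k2
      rw [if_pos rfl]
      unfold rowY
      split_ifs with s0 s1
      · intro hc
        simp only at hc
        omega
      · subst s1
        have k1 : lvRow S lv M 0 a 1 < lvRow S lv M 2 a 1 := by rw [lY]; have := top a; omega
        refine fun _ => ⟨hadr _ _ _ _ _ _ fun _ _ _ => k1, hadr _ _ _ _ _ _ fun _ _ _ => k1,
          hadr _ _ _ _ _ _ fun _ _ _ => ?_⟩
        rw [lY, lY]
        simp
      · obtain ⟨c1, c2⟩ := clog_halves (show 2 ≤ q by omega)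
        refine fun _ => ⟨hadr _ _ _ _ _ _ fun _ _ _ => ?_, hadr _ _ _ _ _ _ fun _ _ _ => ?_,
          hadr _ _ _ _ _ _ fun _ _ _ => ?_⟩ <;> rw [lY, lY] <;> omega
    rw [if_neg k2]
    by_cases k3 : k = 3
    · subst k3
      rw [if_pos rfl]
      have l3 : lvRow S lv M 3 a q = (M + 2) * (2 * Λ + 2) + Nat.clog 2 S.base + 2 := by
        simp [lvRow, hΛ]
      have := top a
      refine fun _ => ⟨hadr _ _ _ _ _ _ fun _ _ _ => ?_, hadr _ _ _ _ _ _ fun _ _ _ => ?_,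
        hadr _ _ _ _ _ _ fun _ hb _ => ?_⟩
      · omega
      · omega
      · have := Nat.clog_mono_right 2 hb.le
        rw [lY]; omega
    rw [if_neg k3]
    split_ifs with k4
    · subst k4
      have l3 : ∀ a q, lvRow S lv M 3 a q = (M + 2) * (2 * Λ + 2) + Nat.clog 2 S.base + 2 := by
        simp [lvRow, hΛ]
      have l4 : lvRow S lv M 4 a q = (M + 2) * (2 * Λ + 2) + Nat.clog 2 S.base + 3 := by
        simp [lvRow, hΛ]
      refine fun _ => ⟨hadr _ _ _ _ _ _ fun _ _ _ => ?_, hadr _ _ _ _ _ _ fun _ _ _ => ?_,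
        hadr _ _ _ _ _ _ fun _ hb _ => ?_⟩ <;> rw [l3, l4] <;> omega
    · intro hc; simp [rowF] at hc

end SumProd

end ITSHAP

namespace ITSHAP

open Finset

/-! ### Sums over trees and digits -/

/-- In a binary tree with node `q` above `2 q` and `2 q + 1`, the root carries the product of the
values at the leaves. -/
@[to_additive]
theorem prod_heap {M : Type*} [CommMonoid M] {m : ℕ} (hm : 0 < m) (f : ℕ → M)
    (h : ∀ q, 0 < q → q < m → f q = f (2 * q) * f (2 * q + 1)) :
    f 1 = ∏ r ∈ range m, f (m + r) := by
  suffices H : ∀ t, t < m → f 1 = ∏ r ∈ range (t + 1), f (t + 1 + r) by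
    have := H (m - 1) (by omega)
    rwa [Nat.sub_add_cancel hm] at this
  intro t
  induction t with
  | zero => intro; simp
  | succ t ih =>
    intro ht
    rw [ih (by omega), prod_range_succ', prod_range_succ _ (t + 1), prod_range_succ]
    have e1 : t + 1 + 0 = t + 1 := rfl
    rw [e1, h (t + 1) (by omega) (by omega), ← mul_assoc]
    congr 1
    · congr 1
      · exact prod_congr rfl fun r _ => by congr 1; omega
      · congr 1; omega
    · congr 1; omega

theorem sum_range_mul {M : Type*} [AddCommMonoid M] (a b : ℕ) (f : ℕ → ℕ → M) :
    ∑ r ∈ range (a * b), f (r % a) (r / a) = ∑ y ∈ range b, ∑ x ∈ range a, f x y := by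
  induction b with
  | zero => simp
  | succ b ih =>
    rw [mul_add_one, sum_range_add, ih, sum_range_succ]
    congr 1
    refine sum_congr rfl fun x hx => ?_
    have hx := mem_range.1 hx
    rw [Nat.mul_add_mod, Nat.mod_eq_of_lt hx, Nat.mul_add_div (by omega), Nat.div_eq_of_lt hx,
      add_zero]

/-! ### Binary addition -/

theorem sum_full_adder (w : ℕ) (x y z : ℕ → Bool) :
    ∑ i ∈ range w, 2 ^ i * ((x i).toNat + (y i).toNat + (z i).toNat) =
      ∑ i ∈ range w, 2 ^ i * (xor3 (x i) (y i) (z i)).toNat +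
      ∑ i ∈ range (w + 1), 2 ^ i *
        (if i = 0 then false else maj3 (x (i - 1)) (y (i - 1)) (z (i - 1))).toNat := by
  induction w with
  | zero => simp
  | succ w ih =>
    rw [sum_range_succ, ih, sum_range_succ (fun i => 2 ^ i * (xor3 (x i) (y i) (z i)).toNat) w,
      sum_range_succ _ (w + 1)]
    have : (x w).toNat + (y w).toNat + (z w).toNat =
        (xor3 (x w) (y w) (z w)).toNat + 2 * (maj3 (x w) (y w) (z w)).toNat := by
      cases x w <;> cases y w <;> cases z w <;> rfl
    rw [this, if_neg (Nat.succ_ne_zero w), Nat.add_sub_cancel, pow_succ]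
    ring

/-- The carry into position `i` in the addition of two binary numbers. -/
def carry (u v : ℕ → Bool) : ℕ → Bool
  | 0 => false
  | i + 1 => maj3 (u i) (v i) (carry u v i)

theorem sum_ripple (w : ℕ) (u v : ℕ → Bool) :
    ∑ i ∈ range w, 2 ^ i * (xor3 (u i) (v i) (carry u v i)).toNat +
      2 ^ w * (carry u v w).toNat =
    ∑ i ∈ range w, 2 ^ i * ((u i).toNat + (v i).toNat) := by
  induction w with
  | zero => simp [carry]
  | succ w ih =>
    rw [sum_range_succ, sum_range_succ, ← ih, carry]
    have : (u w).toNat + (v w).toNat + (carry u v w).toNat =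
        (xor3 (u w) (v w) (carry u v w)).toNat +
          2 * (maj3 (u w) (v w) (carry u v w)).toNat := by
      cases u w <;> cases v w <;> cases carry u v w <;> rfl
    generalize (xor3 (u w) (v w) (carry u v w)).toNat = A at *
    generalize (maj3 (u w) (v w) (carry u v w)).toNat = B at *
    have e : 2 ^ w * ((u w).toNat + (v w).toNat) + 2 ^ w * (carry u v w).toNat =
      2 ^ w * (A + 2 * B) := by rw [← mul_add, this]
    rw [pow_succ]
    linarith

theorem sum_bits_lt (w : ℕ) (f : ℕ → Bool) : ∑ i ∈ range w, 2 ^ i * (f i).toNat < 2 ^ w := by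
  induction w with
  | zero => simp
  | succ w ih =>
    rw [sum_range_succ, pow_succ]
    cases f w <;> simp <;> omega

theorem ofBinary_map (w : ℕ) (f : ℕ → Bool) :
    ofBinary ((List.range w).map f) = ∑ i ∈ range w, 2 ^ i * (f i).toNat := by
  induction w generalizing f with
  | zero => simp [ofBinary]
  | succ w ih =>
    rw [List.range_succ_eq_map, List.map_cons, List.map_map, ofBinary, ih, sum_range_succ',
      mul_sum]
    simp only [Function.comp, Nat.succ_eq_add_one, pow_succ]
    rw [add_comm]
    congr 1
    · exact sum_congr rfl fun i _ => by ring
    · simp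

theorem two_pow_eq_zero (w : ℕ) : (2 : ZMod (2 ^ w)) ^ w = 0 := by
  have := ZMod.natCast_self (2 ^ w)
  exact_mod_cast this

theorem sum_shift (w j : ℕ) (hj : j < w) (u : ℕ → ZMod (2 ^ w)) :
    ∑ i ∈ range w, 2 ^ i * (if j ≤ i then u (i - j) else 0) =
      2 ^ j * ∑ i ∈ range w, 2 ^ i * u i := by
  have h1 : w = j + (w - j) := by omega
  have h2 : ∑ i ∈ range w, 2 ^ i * u i = ∑ i ∈ range ((w - j) + j), 2 ^ i * u i := by
    rw [Nat.sub_add_cancel hj.le]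
  rw [h2, sum_range_add, mul_add, mul_sum, mul_sum]
  have h3 : ∑ x ∈ range j, (2 : ZMod (2 ^ w)) ^ j * (2 ^ (w - j + x) * u (w - j + x)) = 0 := by
    refine sum_eq_zero fun i _ => ?_
    rw [← mul_assoc, ← pow_add, show j + (w - j + i) = w + i by omega, pow_add, two_pow_eq_zero]
    ring
  rw [h3, add_zero]
  have h4 : ∀ f : ℕ → ZMod (2 ^ w), ∑ i ∈ range w, f i = ∑ i ∈ range (j + (w - j)), f i :=
    fun f => by rw [← h1]
  rw [h4, sum_range_add]
  have h5 : ∑ x ∈ range j, (2 : ZMod (2 ^ w)) ^ x * (if j ≤ x then u (x - j) else 0) = 0 := by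
    refine sum_eq_zero fun i hi => ?_
    rw [if_neg (by have := mem_range.1 hi; omega), mul_zero]
  rw [h5, zero_add]
  refine sum_congr rfl fun i _ => ?_
  rw [if_pos (by omega), Nat.add_sub_cancel_left, pow_add, mul_assoc]

namespace SumProd

variable {S : SumProd} {x : List Bool} {V : ℕ → Bool}

/-- The value of a leaf bit. -/
def bitVal (x : List Bool) (c : ℕ) : Bool :=
  if c = 0 then false else if c = 1 then true else x.getD (c - 2) false

/-- `X` solves the system. -/
structure Solves (S : SumProd) (x : List Bool) (X : ℕ → ZMod (2 ^ S.w)) : Prop where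
  leaf : ∀ a < S.A, S.leaf a ≠ 0 →
    X a = ∑ i ∈ range S.w, 2 ^ i * ((bitVal x (S.bit a i)).toNat : ZMod (2 ^ S.w))
  sum : ∀ a < S.A, S.leaf a = 0 → X a = ∑ k ∈ range S.K, X (S.left a k) * X (S.right a k)
  zero : ∀ a, S.A ≤ a → X a = 0

theorem V_adr (hV : TabVal x (S.base ^ 6) S.table V) {k a q i h : ℕ} (hk : k < 5)
    (ha : a < S.base) (hq : q < S.base) (hi : i < S.base) (hh : h < 2) :
    V (S.adr k a q i h) = rowVal x V (S.row k a q i h) := by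
  have hB : 9 ≤ S.base := Nat.le_add_left _ _
  have box : k < S.base ∧ a < S.base ∧ q < S.base ∧ i < S.base ∧ h < S.base ∧ 0 < S.base :=
    ⟨by omega, ha, hq, hi, by omega, by omega⟩
  obtain ⟨h0, h1, h2, h3, h4, -⟩ := dg_nd box
  unfold adr
  rw [hV, if_pos (nd_of_lt box), table]
  rw [h0, h1, h2, h3, h4]

theorem V_adr_of_le (hV : TabVal x (S.base ^ 6) S.table V) {k a q i h : ℕ}
    (ha : S.base ≤ a) : V (S.adr k a q i h) = false := by
  rw [hV, if_neg]
  intro hlt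
  have := (lt_of_nd_lt hlt).2.1
  omega

/-- The word at a node of an adder tree. -/
def word (S : SumProd) (V : ℕ → Bool) (a q : ℕ) : ZMod (2 ^ S.w) :=
  ∑ i ∈ range S.w, 2 ^ i *
    (((V (S.adr 0 a q i 0)).toNat : ZMod (2 ^ S.w)) + ((V (S.adr 0 a q i 1)).toNat))

theorem lt_base_of_lt_A {a : ℕ} (ha : a < S.A) : a < S.base := by
  unfold base; omega

theorem lt_base_of_lt_w {i : ℕ} (hi : i < S.w) : i < S.base := by
  unfold base; omega

theorem word_leaf (hV : TabVal x (S.base ^ 6) S.table V) {a : ℕ} (ha : a < S.A)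
    (hl : S.leaf a ≠ 0) :
    S.word V a 1 = ∑ i ∈ range S.w, 2 ^ i * ((bitVal x (S.bit a i)).toNat : ZMod (2 ^ S.w)) := by
  refine sum_congr rfl fun i hi => ?_
  have hi := mem_range.1 hi
  have hB : 9 ≤ S.base := Nat.le_add_left _ _
  rw [V_adr hV (by omega) (lt_base_of_lt_A ha) (by omega) (lt_base_of_lt_w hi) (by omega),
    V_adr hV (by omega) (lt_base_of_lt_A ha) (by omega) (lt_base_of_lt_w hi) (by omega)]
  have h0 : S.row 0 a 1 i 0 = rowBit (S.bit a i) := by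
    simp [row, rowW, ha, hi, hl]
  have h1 : S.row 0 a 1 i 1 = rowF := by
    simp [row, rowW, ha, hi, hl]
  rw [h0, h1]
  have e1 : rowVal x V rowF = false := by simp [rowVal, rowF]
  have e0 : rowVal x V (rowBit (S.bit a i)) = bitVal x (S.bit a i) := by
    unfold rowVal rowBit bitVal
    split_ifs <;> simp_all
  simp [e0, e1]

theorem word_of_le (hV : TabVal x (S.base ^ 6) S.table V) {a : ℕ} (ha : S.A ≤ a) :
    S.word V a 1 = 0 := by
  refine sum_eq_zero fun i hi => ?_
  have hi := mem_range.1 hi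
  have hB : 9 ≤ S.base := Nat.le_add_left _ _
  have : ∀ h < 2, V (S.adr 0 a 1 i h) = false := by
    intro h hh
    rcases Nat.lt_or_ge a S.base with h1 | h1
    · rw [V_adr hV (by omega) h1 (by omega) (lt_base_of_lt_w hi) hh]
      have : ¬ a < S.A := by omega
      simp [row, rowW, this, hh, rowVal, rowF]
    · exact V_adr_of_le hV h1
  simp [this]

theorem sum_full_adder_zmod (w : ℕ) (x y z : ℕ → Bool) :
    ∑ i ∈ range w, (2 : ZMod (2 ^ w)) ^ i *
      (((x i).toNat : ZMod (2 ^ w)) + ((y i).toNat : ZMod (2 ^ w)) + ((z i).toNat)) =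
      ∑ i ∈ range w, 2 ^ i * (((xor3 (x i) (y i) (z i)).toNat : ZMod (2 ^ w)) +
        ((if i = 0 then false else maj3 (x (i - 1)) (y (i - 1)) (z (i - 1))).toNat)) := by
  have h := congrArg (Nat.cast (R := ZMod (2 ^ w))) (sum_full_adder w x y z)
  rw [sum_range_succ _ w] at h
  push_cast at h
  rw [two_pow_eq_zero, zero_mul, add_zero, ← sum_add_distrib] at h
  rw [h]
  exact sum_congr rfl fun i _ => by rw [mul_add]

theorem word_node (hV : TabVal x (S.base ^ 6) S.table V) {a q : ℕ} (ha : a < S.A)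
    (hl : S.leaf a = 0) (hq : 0 < q) (hqm : q < S.m) :
    S.word V a q = S.word V a (2 * q) + S.word V a (2 * q + 1) := by
  have hB : 9 + 2 * S.m ≤ S.base := by unfold base; omega
  have haB := lt_base_of_lt_A ha
  have r1 : ∀ i < S.w, V (S.adr 1 a q i 0) = xor3 (V (S.adr 0 a (2 * q) i 0))
      (V (S.adr 0 a (2 * q) i 1)) (V (S.adr 0 a (2 * q + 1) i 0)) := by
    intro i hi
    rw [V_adr hV (by omega) haB (by omega) (lt_base_of_lt_w hi) (by omega)]
    simp [row, rowC, ha, hq, hqm, rowVal]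
  have r2 : ∀ i < S.w, V (S.adr 1 a q i 1) = if i = 0 then false else
      maj3 (V (S.adr 0 a (2 * q) (i - 1) 0)) (V (S.adr 0 a (2 * q) (i - 1) 1))
        (V (S.adr 0 a (2 * q + 1) (i - 1) 0)) := by
    intro i hi
    rw [V_adr hV (by omega) haB (by omega) (lt_base_of_lt_w hi) (by omega)]
    by_cases h0 : i = 0 <;> simp [row, rowC, ha, hq, hqm, rowVal, rowF, h0]
  have r3 : ∀ i < S.w, V (S.adr 0 a q i 0) = xor3 (V (S.adr 1 a q i 0))
      (V (S.adr 1 a q i 1)) (V (S.adr 0 a (2 * q + 1) i 1)) := by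
    intro i hi
    rw [V_adr hV (by omega) haB (by omega) (lt_base_of_lt_w hi) (by omega)]
    simp [row, rowW, ha, hq, hqm, rowVal, hi, hl]
  have r4 : ∀ i < S.w, V (S.adr 0 a q i 1) = if i = 0 then false else
      maj3 (V (S.adr 1 a q (i - 1) 0)) (V (S.adr 1 a q (i - 1) 1))
        (V (S.adr 0 a (2 * q + 1) (i - 1) 1)) := by
    intro i hi
    rw [V_adr hV (by omega) haB (by omega) (lt_base_of_lt_w hi) (by omega)]
    by_cases h0 : i = 0 <;> simp [row, rowW, ha, hq, hqm, rowVal, rowF, h0, hl, hi]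
  have A := sum_full_adder_zmod S.w (fun i => V (S.adr 0 a (2 * q) i 0))
    (fun i => V (S.adr 0 a (2 * q) i 1)) (fun i => V (S.adr 0 a (2 * q + 1) i 0))
  have B := sum_full_adder_zmod S.w (fun i => V (S.adr 1 a q i 0))
    (fun i => V (S.adr 1 a q i 1)) (fun i => V (S.adr 0 a (2 * q + 1) i 1))
  have A' : ∑ i ∈ range S.w, (2 : ZMod (2 ^ S.w)) ^ i *
      (((V (S.adr 1 a q i 0)).toNat : ZMod (2 ^ S.w)) + (V (S.adr 1 a q i 1)).toNat) = _ :=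
    (sum_congr rfl fun i hi => by
      rw [r1 i (mem_range.1 hi), r2 i (mem_range.1 hi)]).trans A.symm
  have B' : S.word V a q = _ :=
    (sum_congr rfl fun i hi => by
      rw [r3 i (mem_range.1 hi), r4 i (mem_range.1 hi)]).trans B.symm
  rw [B']
  simp only [mul_add, sum_add_distrib] at A' ⊢
  rw [A']
  simp only [word, mul_add, sum_add_distrib]
  ring

theorem word_product (hV : TabVal x (S.base ^ 6) S.table V) {a r : ℕ} (ha : a < S.A)
    (hl : S.leaf a = 0) (hr : r < S.m) (hk : r / 2 / 2 / S.w < S.K) (hw : 0 < S.w) :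
    S.word V a (S.m + r) = (∑ i ∈ range S.w, 2 ^ i *
        ((V (S.adr 0 (S.left a (r / 2 / 2 / S.w)) 1 i (r % 2))).toNat : ZMod (2 ^ S.w))) *
      (2 ^ (r / 2 / 2 % S.w) *
        ((V (S.adr 0 (S.right a (r / 2 / 2 / S.w)) 1 (r / 2 / 2 % S.w) (r / 2 % 2))).toNat :
          ZMod (2 ^ S.w))) := by
  have hB : 9 + 2 * S.m ≤ S.base := by unfold base; omega
  have haB := lt_base_of_lt_A ha
  set j := r / 2 / 2 % S.w with hj
  have hjw : j < S.w := Nat.mod_lt _ hw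
  have hout : V (S.base ^ 6) = false := by rw [hV, if_neg (lt_irrefl _)]
  have r0 : ∀ i < S.w, V (S.adr 0 a (S.m + r) i 0) =
      if j ≤ i then (V (S.adr 0 (S.left a (r / 2 / 2 / S.w)) 1 (i - j) (r % 2)) &&
        V (S.adr 0 (S.right a (r / 2 / 2 / S.w)) 1 j (r / 2 % 2))) else false := by
    intro i hi
    rw [V_adr hV (by omega) haB (by omega) (lt_base_of_lt_w hi) (by omega)]
    have hm : ¬ S.m + r < S.m := by omega
    have hq : 0 < S.m + r := by
      rcases Nat.eq_zero_or_pos S.m with h | h <;> omega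
    have hsub : S.m + r - S.m = r := by omega
    by_cases hji : j ≤ i <;>
      simp [row, rowW, ha, hi, hl, hq, hsub, hk, ← hj, hji, rowVal, rowF, maj3, hout]
  have r1 : ∀ i < S.w, V (S.adr 0 a (S.m + r) i 1) = false := by
    intro i hi
    rw [V_adr hV (by omega) haB (by omega) (lt_base_of_lt_w hi) (by omega)]
    have hq : 0 < S.m + r := by
      rcases Nat.eq_zero_or_pos S.m with h | h <;> omega
    simp [row, rowW, ha, hi, hl, hq, rowVal, rowF]
  have := sum_shift S.w j hjw fun i =>
    ((V (S.adr 0 (S.left a (r / 2 / 2 / S.w)) 1 i (r % 2))).toNat : ZMod (2 ^ S.w)) *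
      ((V (S.adr 0 (S.right a (r / 2 / 2 / S.w)) 1 j (r / 2 % 2))).toNat : ZMod (2 ^ S.w))
  rw [word, sum_congr rfl (g := fun i => 2 ^ i * if j ≤ i then
    ((V (S.adr 0 (S.left a (r / 2 / 2 / S.w)) 1 (i - j) (r % 2))).toNat : ZMod (2 ^ S.w)) *
      ((V (S.adr 0 (S.right a (r / 2 / 2 / S.w)) 1 j (r / 2 % 2))).toNat : ZMod (2 ^ S.w)) else 0),
    this]
  · simp only [← mul_assoc]
    rw [← sum_mul]
    ring
  · intro i hi
    rw [r0 i (mem_range.1 hi), r1 i (mem_range.1 hi)]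
    by_cases hji : j ≤ i
    · simp only [if_pos hji]
      cases V (S.adr 0 (S.left a (r / 2 / 2 / S.w)) 1 (i - j) (r % 2)) <;>
        cases V (S.adr 0 (S.right a (r / 2 / 2 / S.w)) 1 j (r / 2 % 2)) <;> simp
    · simp [hji]

theorem word_sum (hV : TabVal x (S.base ^ 6) S.table V) {a : ℕ} (ha : a < S.A)
    (hl : S.leaf a = 0) (hw : 0 < S.w) (hK : 0 < S.K) :
    S.word V a 1 = ∑ k ∈ range S.K, S.word V (S.left a k) 1 * S.word V (S.right a k) 1 := by
  have hm : 0 < S.m := Nat.mul_pos (Nat.mul_pos (by omega) hK) hw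
  rw [sum_heap hm (S.word V a) fun q hq hqm => word_node hV ha hl hq hqm]
  have hm' : S.m = 2 * (2 * (S.w * S.K)) := by unfold m; ring
  let f : ℕ → ℕ → ℕ → ℕ → ZMod (2 ^ S.w) := fun h h' j k =>
    (∑ i ∈ range S.w, 2 ^ i * ((V (S.adr 0 (S.left a k) 1 i h)).toNat : ZMod (2 ^ S.w))) *
      (2 ^ j * ((V (S.adr 0 (S.right a k) 1 j h')).toNat : ZMod (2 ^ S.w)))
  have e : ∑ r ∈ range S.m, S.word V a (S.m + r) =
      ∑ r ∈ range (2 * (2 * (S.w * S.K))), f (r % 2) (r / 2 % 2) (r / 2 / 2 % S.w)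
        (r / 2 / 2 / S.w) := by
    rw [← hm']
    refine sum_congr rfl fun r hr => word_product hV ha hl (mem_range.1 hr) ?_ hw
    have := mem_range.1 hr
    rw [Nat.div_lt_iff_lt_mul hw, mul_comm]
    omega
  rw [e, sum_range_mul 2 (2 * (S.w * S.K)) fun h r => f h (r % 2) (r / 2 % S.w) (r / 2 / S.w),
    sum_range_mul 2 (S.w * S.K) fun h' r => ∑ h ∈ range 2, f h h' (r % S.w) (r / S.w),
    sum_range_mul S.w S.K fun j k => ∑ h' ∈ range 2, ∑ h ∈ range 2, f h h' j k]
  refine sum_congr rfl fun k _ => ?_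
  simp only [f, word, sum_range_succ _ 1, sum_range_one, mul_add, sum_add_distrib, add_mul,
    mul_sum]

theorem solves_word (hV : TabVal x (S.base ^ 6) S.table V) (hw : 0 < S.w) (hK : 0 < S.K) :
    S.Solves x fun a => S.word V a 1 :=
  ⟨fun _ ha hl => word_leaf hV ha hl, fun _ ha hl => word_sum hV ha hl hw hK,
    fun _ ha => word_of_le hV ha⟩

theorem V_carry (hV : TabVal x (S.base ^ 6) S.table V) {a : ℕ} (ha : a < S.A) (s : ℕ) :
    ∀ i < S.w, s ≤ i + 1 →
      (V (S.adr 2 a s i 0) = true → V (S.adr 2 a s i 1) = true) ∧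
      V (S.adr 2 a s i (carry (fun i => V (S.adr 0 a 1 i 0)) (fun i => V (S.adr 0 a 1 i 1))
        (i + 1 - s)).toNat) =
        carry (fun i => V (S.adr 0 a 1 i 0)) (fun i => V (S.adr 0 a 1 i 1)) (i + 1) := by
  have hB : 9 + S.w ≤ S.base := by unfold base; omega
  have haB := lt_base_of_lt_A ha
  set u : ℕ → Bool := fun i => V (S.adr 0 a 1 i 0) with hu
  set v : ℕ → Bool := fun i => V (S.adr 0 a 1 i 1) with hv
  have const : ∀ i < S.w, ∀ b : Bool, V (S.adr 2 a 0 i b.toNat) = b := by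
    intro i hi b
    rw [V_adr hV (by omega) haB (by omega) (lt_base_of_lt_w hi) (by cases b <;> simp)]
    cases b <;> simp [row, rowY, rowVal]
  have one : ∀ i < S.w, ∀ b : Bool, V (S.adr 2 a 1 i b.toNat) = maj3 (u i) (v i) b := by
    intro i hi b
    rw [V_adr hV (by omega) haB (by omega) (lt_base_of_lt_w hi) (by cases b <;> simp)]
    have h0 := const i hi b
    have : b.toNat < 2 := by cases b <;> simp
    simp [row, rowY, rowVal, this, h0, hu, hv]
  induction s using Nat.strong_induction_on with
  | _ s ih =>
    intro i hi hs
    obtain rfl | rfl | h2 : s = 0 ∨ s = 1 ∨ 2 ≤ s := by omega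
    · refine ⟨fun h => ?_, const i hi _⟩
      exact const i hi true
    · refine ⟨fun h => ?_, ?_⟩
      · have h0 := one i hi false
        have h1 := one i hi true
        simp only [Bool.toNat_false, Bool.toNat_true] at h0 h1
        rw [h0] at h
        rw [h1]
        revert h
        cases u i <;> cases v i <;> simp [maj3]
      · rw [one i hi, Nat.add_sub_cancel]
        rfl
    · have step : ∀ b : Bool, V (S.adr 2 a s i b.toNat) = maj3 (V (S.adr 2 a (s - s / 2) i 0))
          (V (S.adr 2 a (s - s / 2) i 1)) (V (S.adr 2 a (s / 2) (i - (s - s / 2)) b.toNat)) := by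
        intro b
        have hb : b.toNat < 2 := by cases b <;> simp
        rw [V_adr hV (by omega) haB (by omega) (lt_base_of_lt_w hi) hb]
        have n0 : s ≠ 0 := by omega
        have n1 : s ≠ 1 := by omega
        simp [row, rowY, rowVal, hb, n0, n1]
      obtain ⟨m1, c1⟩ := ih (s - s / 2) (by omega) i hi (by omega)
      obtain ⟨m2, c2⟩ := ih (s / 2) (by omega) (i - (s - s / 2)) (by omega) (by omega)
      rw [show i - (s - s / 2) + 1 - s / 2 = i + 1 - s by omega,
        show i - (s - s / 2) + 1 = i + 1 - (s - s / 2) by omega] at c2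
      constructor
      · have s0 := step false
        have s1 := step true
        simp only [Bool.toNat_false, Bool.toNat_true] at s0 s1
        rw [s0, s1]
        revert m1 m2
        cases V (S.adr 2 a (s - s / 2) i 0) <;> cases V (S.adr 2 a (s - s / 2) i 1) <;>
          cases V (S.adr 2 a (s / 2) (i - (s - s / 2)) 0) <;> simp [maj3]
      · have sel : ∀ y0 y1 b : Bool, (y0 = true → y1 = true) →
            maj3 y0 y1 b = if b then y1 else y0 := by decide
        rw [step, c2, sel _ _ _ m1, ← c1]
        cases carry u v (i + 1 - (s - s / 2)) <;> rfl

/-- The natural number below `2 ^ w` that represents a word. -/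
def digits (S : SumProd) (V : ℕ → Bool) (a : ℕ) : ℕ :=
  ∑ i ∈ range S.w, 2 ^ i * (V (S.adr 3 a 0 i 0)).toNat

theorem digits_lt (S : SumProd) (V : ℕ → Bool) (a : ℕ) : S.digits V a < 2 ^ S.w :=
  sum_bits_lt _ _

theorem digits_cast (hV : TabVal x (S.base ^ 6) S.table V) {a : ℕ} (ha : a < S.A) :
    (S.digits V a : ZMod (2 ^ S.w)) = S.word V a 1 := by
  have hB : 9 + S.w ≤ S.base := by unfold base; omega
  have haB := lt_base_of_lt_A ha
  have h := congrArg (Nat.cast (R := ZMod (2 ^ S.w)))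
    (sum_ripple S.w (fun i => V (S.adr 0 a 1 i 0)) (fun i => V (S.adr 0 a 1 i 1)))
  push_cast at h
  rw [two_pow_eq_zero, zero_mul, add_zero] at h
  rw [word, ← h, digits]
  push_cast
  refine sum_congr rfl fun i hi => ?_
  have hi := mem_range.1 hi
  rw [V_adr hV (by omega) haB (by omega) (lt_base_of_lt_w hi) (by omega)]
  have : V (S.adr 2 a i (i - 1) 0) =
      carry (fun i => V (S.adr 0 a 1 i 0)) (fun i => V (S.adr 0 a 1 i 1)) i := by
    rcases i with _ | i
    · rw [V_adr hV (by omega) haB (by omega) (by omega) (by omega)]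
      simp [row, rowY, rowVal, carry]
    · have := (V_carry hV ha (i + 1) i (by omega) le_rfl).2
      simpa [carry] using this
  simp [row, rowVal, this]

theorem isRatCode_out (hV : TabVal x (S.base ^ 6) S.table V) (hw : 0 < S.w)
    (hnum : S.num < S.A) (hneg : S.neg < S.A) (hden : S.den < S.A) {N : ℤ} {d : ℕ}
    (h1 : S.word V S.num 1 = (N : ZMod (2 ^ S.w))) (h2 : S.word V S.neg 1 = -(N : ZMod (2 ^ S.w)))
    (h3 : S.word V S.den 1 = (d : ZMod (2 ^ S.w))) (hN : |N| < 2 ^ (S.w - 1)) (hd0 : d ≠ 0)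
    (hd : d < 2 ^ S.w) :
    IsRatCode ((List.range (2 * S.w + 1)).map fun o => V (S.out o)) ((N : ℚ) / d) := by
  have hB : 9 + S.w ≤ S.base := by unfold base; omega
  have huniq : ∀ (r : ℕ) (z : ℤ), r < 2 ^ S.w → 0 ≤ z → z < 2 ^ S.w →
      (r : ZMod (2 ^ S.w)) = (z : ZMod (2 ^ S.w)) → (r : ℤ) = z := by
    intro r z hr hz0 hz h
    have h' : ((r : ℤ) : ZMod (2 ^ S.w)) = (z : ZMod (2 ^ S.w)) := by exact_mod_cast h
    rw [ZMod.intCast_eq_intCast_iff] at h'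
    have h'' : (r : ℤ) % ((2 ^ S.w : ℕ) : ℤ) = z % ((2 ^ S.w : ℕ) : ℤ) := h'
    rwa [Int.emod_eq_of_lt (by omega) (by exact_mod_cast hr),
      Int.emod_eq_of_lt hz0 (by exact_mod_cast hz)] at h''
  have hden' : S.digits V S.den = d := by
    have := huniq (S.digits V S.den) d (digits_lt _ _ _) (by omega) (by exact_mod_cast hd)
      (by rw [digits_cast hV hden, h3]; simp)
    exact_mod_cast this
  have hpow : (2 : ℤ) ^ S.w = 2 * 2 ^ (S.w - 1) := by
    rw [← pow_succ', Nat.sub_add_cancel hw]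
  have htop : S.digits V S.num = ∑ i ∈ range (S.w - 1), 2 ^ i * (V (S.adr 3 S.num 0 i 0)).toNat +
      2 ^ (S.w - 1) * (V (S.adr 3 S.num 0 (S.w - 1) 0)).toNat := by
    rw [digits]
    conv_lhs => rw [← Nat.sub_add_cancel hw]
    rw [sum_range_succ]
  have hlow := sum_bits_lt (S.w - 1) fun i => V (S.adr 3 S.num 0 i 0)
  have hlow' : (∑ i ∈ range (S.w - 1), 2 ^ i * (V (S.adr 3 S.num 0 i 0)).toNat : ℕ) <
    (2 : ℤ) ^ (S.w - 1) := by exact_mod_cast hlow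
  obtain ⟨hN1, hN2⟩ := abs_lt.1 hN
  have hsgn : V (S.adr 3 S.num 0 (S.w - 1) 0) = decide (N < 0) := by
    rcases lt_or_ge N 0 with hneg' | hpos
    · have := huniq (S.digits V S.num) (N + 2 ^ S.w) (digits_lt _ _ _) (by linarith)
        (by linarith) (by
          rw [digits_cast hV hnum, h1]; push_cast; rw [two_pow_eq_zero, add_zero])
      rw [htop] at this
      push_cast at this
      rcases hb : V (S.adr 3 S.num 0 (S.w - 1) 0)
      · rw [hb] at this
        simp only [Bool.toNat_false, Nat.cast_zero, mul_zero, add_zero] at this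
        push_cast at hlow'
        linarith
      · simp [hneg']
    · have := huniq (S.digits V S.num) N (digits_lt _ _ _) hpos (by linarith)
        (by rw [digits_cast hV hnum, h1])
      rw [htop] at this
      push_cast at this
      rcases hb : V (S.adr 3 S.num 0 (S.w - 1) 0)
      · simp [hpos]
      · rw [hb] at this
        simp only [Bool.toNat_true, Nat.cast_one, mul_one] at this
        have h0 : (0 : ℤ) ≤ ∑ i ∈ range (S.w - 1), 2 ^ i *
            ((V (S.adr 3 S.num 0 i 0)).toNat : ℤ) := by positivity
        linarith
  have hout : ∀ i < S.w, V (S.adr 4 0 0 i 0) =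
      V (S.adr 3 (if N < 0 then S.neg else S.num) 0 i 0) := by
    intro i hi
    rw [V_adr hV (by omega) (by omega) (by omega) (lt_base_of_lt_w hi) (by omega)]
    by_cases hc : N < 0 <;> simp [row, rowVal, hsgn, hc]
  refine ⟨V (S.adr 3 S.num 0 (S.w - 1) 0), (List.range S.w).map fun i => V (S.adr 4 0 0 i 0),
    (List.range S.w).map fun i => V (S.adr 3 S.den 0 i 0), ?_, by simp, ?_, ?_⟩
  · rw [two_mul, List.range_succ_eq_map, List.map_cons, List.range_add, List.map_map,
      List.map_append, List.map_map]
    congr 1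
    congr 1
    · refine List.map_congr_left fun i hi => ?_
      have := List.mem_range.1 hi
      simp [out, this]
    · refine List.map_congr_left fun i hi => ?_
      simp [out, show S.w + i + 1 - (S.w + 1) = i by omega]
  · rw [ofBinary_map]
    change S.digits V S.den ≠ 0
    omega
  · rw [ofBinary_map, ofBinary_map]
    change _ = _ / ((S.digits V S.den : ℕ) : ℚ)
    rw [hden', hsgn, sum_congr rfl fun i hi => by rw [hout i (mem_range.1 hi)]]
    change _ = (_ * ((S.digits V (if N < 0 then S.neg else S.num) : ℕ) : ℚ)) / _
    congr 1
    by_cases hc : N < 0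
    · have := huniq (S.digits V S.neg) (-N) (digits_lt _ _ _) (by linarith) (by linarith)
        (by rw [digits_cast hV hneg, h2]; push_cast; rfl)
      have h' : ((S.digits V S.neg : ℤ) : ℚ) = ((-N : ℤ) : ℚ) := by rw [this]
      push_cast at h'
      simp [hc, h']
    · have := huniq (S.digits V S.num) N (digits_lt _ _ _) (by linarith) (by linarith)
        (by rw [digits_cast hV hnum, h1])
      have h' : ((S.digits V S.num : ℤ) : ℚ) = ((N : ℤ) : ℚ) := by rw [this]
      push_cast at h'
      simp [hc, h']

end SumProd

/-! ### Logarithmic bounds -/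

theorem PolyBdd.log {f : ℕ → ℕ} (hf : PolyBdd id f) :
    ∃ c, ∀ n, Nat.log 2 (f n) ≤ c * Nat.log 2 n + c := by
  obtain ⟨a, c, h⟩ := PolyBdd.iff_pow.1 hf
  refine ⟨a + c, fun n => ?_⟩
  have h1 : n + 1 ≤ 2 ^ (Nat.log 2 n + 1) := Nat.lt_pow_succ_log_self (by omega) n
  have h2 : f n ≤ 2 ^ (a + (Nat.log 2 n + 1) * c) := by
    rw [pow_add, pow_mul]
    exact (h n).trans (Nat.mul_le_mul (Nat.lt_two_pow_self).le (Nat.pow_le_pow_left h1 c))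
  calc Nat.log 2 (f n) ≤ Nat.log 2 (2 ^ (a + (Nat.log 2 n + 1) * c)) := Nat.log_mono_right h2
    _ = a + (Nat.log 2 n + 1) * c := Nat.log_pow (by omega) _
    _ ≤ _ := by nlinarith [Nat.zero_le (a * Nat.log 2 n)]

theorem clog_le_log (s : ℕ) : Nat.clog 2 s ≤ Nat.log 2 s + 1 :=
  Nat.clog_le_of_le_pow (Nat.lt_pow_succ_log_self (by omega) s).le

theorem Ar.polyBdd_left {f : ℕ → ℕ} (hf : Ar fun n _ => f n) : PolyBdd id f := by
  obtain ⟨c, h⟩ := hf.polyBdd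
  exact ⟨c, fun n => by simpa using h (n, 0)⟩

/-- A problem is in NC² if the answer is the quotient of two words that are defined by a uniform
system of sums of products with `O(log n)` levels. -/
theorem inNC2_of_sumProd {Inst : Type} {encode : Inst → List Bool} {valid : Inst → Prop}
    {answer : Inst → ℚ} (S : ℕ → SumProd) (hS : SumProd.Uniform S)
    (hw : ∀ n, 0 < (S n).w) (hK : ∀ n, 0 < (S n).K) (hnum : ∀ n, (S n).num < (S n).A)
    (hneg : ∀ n, (S n).neg < (S n).A) (hden : ∀ n, (S n).den < (S n).A)
    (hlev : ∃ c, ∀ n, ∃ lv : ℕ → ℕ, (∀ a < (S n).A, lv a ≤ c * Nat.log 2 n + c) ∧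
      ∀ a < (S n).A, (S n).leaf a = 0 → ∀ k < (S n).K,
        ((S n).left a k < (S n).A → lv ((S n).left a k) < lv a) ∧
        ((S n).right a k < (S n).A → lv ((S n).right a k) < lv a))
    (hsol : ∀ I, valid I → ∀ X, (S (encode I).length).Solves (encode I) X →
      ∃ (N : ℤ) (d : ℕ), X (S (encode I).length).num = N ∧ X (S (encode I).length).neg = -N ∧
        X (S (encode I).length).den = d ∧ |N| < 2 ^ ((S (encode I).length).w - 1) ∧ d ≠ 0 ∧
        d < 2 ^ (S (encode I).length).w ∧ answer I = N / d) :
    InNC2 encode valid fun I y => IsRatCode y (answer I) := by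
  refine inNC2_of_table (fun n => (S n).base ^ 6) (fun n => 2 * (S n).w + 1) (fun n => (S n).out)
    (fun n => (S n).table) (hS.base.pow 6) (((Ar.const 2).mul hS.w).add (.const 1)) hS.out
    hS.table ?_ ?_
  · obtain ⟨c, hc⟩ := hlev
    obtain ⟨e, he⟩ := (((Ar.const 2).mul hS.m).polyBdd_left).log
    obtain ⟨e', he'⟩ := hS.base.polyBdd_left.log
    refine ⟨20 * (c + 2) * (e + 1) + e' + 4, fun n => ?_⟩
    obtain ⟨lv, h1, h2⟩ := hc n
    obtain ⟨lev, h⟩ := SumProd.table_levels (S n) lv _ h1 h2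
    refine ⟨lev, fun g hg => ⟨(h g hg).1.trans ?_, (h g hg).2⟩⟩
    have hm := he n
    have hb := (clog_le_log (S n).base).trans (Nat.add_le_add_right (he' n) 1)
    generalize Nat.log 2 (2 * (S n).m) = μ at *
    generalize Nat.clog 2 (S n).base = β at *
    generalize Nat.log 2 n = l at *
    have hl : l ≤ l ^ 2 := by nlinarith [sq_nonneg l, Nat.zero_le l, Nat.le_self_pow two_ne_zero l]
    have e1 : c * l + c + 2 ≤ (c + 2) * (l + 1) := by nlinarith
    have e2 : 2 * μ + 2 ≤ 2 * (e + 1) * (l + 1) := by nlinarith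
    have e3 : (c * l + c + 2) * (2 * μ + 2) ≤ (c + 2) * (l + 1) * (2 * (e + 1) * (l + 1)) :=
      Nat.mul_le_mul e1 e2
    have e4 : (c + 2) * (l + 1) * (2 * (e + 1) * (l + 1)) =
        2 * ((c + 2) * (e + 1)) * ((l + 1) * (l + 1)) := by ring
    have e5 : (l + 1) * (l + 1) ≤ 3 * l ^ 2 + 1 := by nlinarith
    have e6 := Nat.mul_le_mul_left (2 * ((c + 2) * (e + 1))) e5
    have e7 : e' * l ≤ e' * l ^ 2 := Nat.mul_le_mul_left _ hl
    nlinarith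
  · intro I hI V hV
    obtain ⟨N, d, h1, h2, h3, h4, h5, h6, h7⟩ :=
      hsol I hI _ (SumProd.solves_word hV (hw _) (hK _))
    rw [h7]
    exact SumProd.isRatCode_out hV (hw _) (hnum _) (hneg _) (hden _) h1 h2 h3 h4 h5 h6

end ITSHAP

namespace ITSHAP

/-! ## The system of equations for an entry of the IT-SHAP tensor -/

/-- The size parameters at the beginning of the code of an instance. -/
structure Par where
  D : ℕ
  k : ℕ
  N : ℕ
  R : ℕ
  b : ℕ

/-- The candidates for the size parameters of an instance whose code has length `n`. -/
def par (n t : ℕ) : Par where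
  D := t % (n + 1)
  k := t / (n + 1) % (n + 1)
  N := t / (n + 1) ^ 2 % (n + 1)
  R := t / (n + 1) ^ 3 % (n + 1)
  b := t / (n + 1) ^ 4 % (n + 1)

namespace Par

variable (P : Par)

/-- The length of the size parameters. -/
def hd : ℕ := P.D + P.k + P.N + P.R + P.b + 5

/-- The positions where the unary codes of the size parameters end. -/
def IsEnd (p : ℕ) : Prop :=
  p = P.D ∨ p = P.D + 1 + P.k ∨ p = P.D + 1 + P.k + 1 + P.N ∨
    p = P.D + 1 + P.k + 1 + P.N + 1 + P.R ∨ p = P.D + 1 + P.k + 1 + P.N + 1 + P.R + 1 + P.b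

instance (p : ℕ) : Decidable (P.IsEnd p) := by unfold IsEnd; infer_instance

/-- The number of encoded core entries in the model tensor train. -/
def block : ℕ := P.D * P.N * P.R * P.R

/-- The number of all encoded core entries. -/
def entries : ℕ := P.block + P.block + P.D * 2 * P.R * P.R

/-- The number of a core entry of the model tensor train. -/
def entM (j i u v : ℕ) : ℕ := ((j * P.N + i) * P.R + u) * P.R + v

/-- The number of a core entry of the distribution tensor train. -/
def entP (j i u v : ℕ) : ℕ := P.block + P.entM j i u v

/-- The number of a core entry of the tensor train of the MWCT. -/
def entW (j i u v : ℕ) : ℕ := P.block + P.block + (((j * 2 + i) * P.R + u) * P.R + v)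

/-- The position of a core entry. -/
def ent (e : ℕ) : ℕ := P.hd + e * (2 * P.b + 1)

/-- The position of the code of the requested interaction set. -/
def posS : ℕ := P.ent P.entries

/-- The position of the code of the explained input. -/
def posX : ℕ := P.posS + P.R

/-- The position of the code of the requested output. -/
def posY : ℕ := P.posX + P.D * P.N

end Par

namespace Prog

/-- The base for the numbers of words. -/
def B (n : ℕ) : ℕ := (n + 2) ^ 5

/-- The code of a bit of a leaf: constants `1` and `-1`, sign, numerator and denominator of a
core entry, a single bit. -/
def bitCode (P : Par) (tag e i : ℕ) : ℕ :=
  if tag = 1 then if i = 0 then 1 else 0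
  else if tag = 2 then 1
  else if tag = 3 then if i = 0 then 1 else P.ent e + 2
  else if tag = 4 then if i < P.b then P.ent e + 1 + i + 2 else 0
  else if tag = 5 then if i < P.b then P.ent e + 1 + P.b + i + 2 else 0
  else if tag = 6 then if i = 0 then e + 2 else 0
  else 0

/-- The factors of the `k`-th product in the definition of the word with the given digits, where
`t` is the number of a candidate for the size parameters:
* `7`: at node `q` of a tree, product of all denominators, the `e`-th one replaced by its fraction's
  numerator;
* `8`: slice of a model core at the explained input;
* `9`: contraction of a distribution core with a model core;
* `10`: product of the transfer matrices `a, …, a + l - 1`;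
* `11`, `12`: selection of the requested output and of the requested interaction set;
* `13`: power of the common denominator;
* `14`, `15`: comparison of the size parameters with the candidate;
* `16`, `17`: numerator, denominator and negative numerator of the result. -/
def factors (n tag t a b c d k : ℕ) : ℕ × ℕ × ℕ × ℕ :=
  if tag = 7 then
    if k = 0 ∧ 0 < b then
      if b < (par n t).entries then (nd (B n) 7 t a (2 * b) 0 0, nd (B n) 7 t a (2 * b + 1) 0 0, 0, 0)
      else if b - (par n t).entries = a then (nd (B n) 3 t a 0 0 0, nd (B n) 4 t a 0 0 0, 0, 0)
      else (nd (B n) 5 t (b - (par n t).entries) 0 0 0, nd (B n) 1 0 0 0 0 0, 0, 0)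
    else (B n ^ 6, B n ^ 6, 0, 0)
  else if tag = 8 then
    if k < (par n t).N then (nd (B n) 6 t ((par n t).posX + (a * (par n t).N + k)) 0 0 0,
      nd (B n) 7 t ((par n t).entM a k b c) 1 0 0, 0, 0)
    else (B n ^ 6, B n ^ 6, 0, 0)
  else if tag = 9 then
    if k < (par n t).N then
      (nd (B n) 7 t ((par n t).entP a k (c / (par n t).R % (par n t).R)
        (d / (par n t).R % (par n t).R)) 1 0 0,
      if b = 0 then nd (B n) 8 t a (c % (par n t).R) (d % (par n t).R) 0
      else nd (B n) 7 t ((par n t).entM a k (c % (par n t).R) (d % (par n t).R)) 1 0 0, 0, 0)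
    else (B n ^ 6, B n ^ 6, 0, 0)
  else if tag = 10 then
    if b < 2 then
      if k < 2 then (nd (B n) 7 t ((par n t).entW a k (c / (par n t).R / (par n t).R)
        (d / (par n t).R / (par n t).R)) 1 0 0, nd (B n) 9 t a k c d, 0, 0)
      else (B n ^ 6, B n ^ 6, 0, 0)
    else if k < (par n t).R * ((par n t).R * (par n t).R) then
      (nd (B n) 10 t a (b / 2) c k, nd (B n) 10 t (a + b / 2) (b - b / 2) k d, 0, 0)
    else (B n ^ 6, B n ^ 6, 0, 0)
  else if tag = 11 then
    if k < (par n t).R then (nd (B n) 6 t ((par n t).posY + k) 0 0 0,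
      nd (B n) 10 t 0 (par n t).D ((par n t).R * ((par n t).R * a)) k, 0, 0)
    else (B n ^ 6, B n ^ 6, 0, 0)
  else if tag = 12 then
    if k < (par n t).R then
      (nd (B n) 6 t ((par n t).posS + k) 0 0 0, nd (B n) 11 t k 0 0 0, 0, 0)
    else (B n ^ 6, B n ^ 6, 0, 0)
  else if tag = 13 then
    if k = 0 then
      if a < 2 then (nd (B n) 7 t (par n t).entries 1 0 0, nd (B n) 1 0 0 0 0 0, 0, 0)
      else (nd (B n) 13 t (a / 2) 0 0 0, nd (B n) 13 t (a - a / 2) 0 0 0, 0, 0)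
    else (B n ^ 6, B n ^ 6, 0, 0)
  else if tag = 14 then
    if (par n t).IsEnd a then
      if k = 0 then (nd (B n) 1 0 0 0 0 0, nd (B n) 1 0 0 0 0 0, 0, 0)
      else if k = 1 then (nd (B n) 2 0 0 0 0 0, nd (B n) 6 t a 0 0 0, 0, 0)
      else (B n ^ 6, B n ^ 6, 0, 0)
    else if k = 0 then (nd (B n) 6 t a 0 0 0, nd (B n) 1 0 0 0 0 0, 0, 0)
    else (B n ^ 6, B n ^ 6, 0, 0)
  else if tag = 15 then
    if k = 0 ∧ 0 < a then
      if a < (par n t).hd then (nd (B n) 15 t (2 * a) 0 0 0, nd (B n) 15 t (2 * a + 1) 0 0 0, 0, 0)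
      else (nd (B n) 14 t (a - (par n t).hd) 0 0 0, nd (B n) 1 0 0 0 0 0, 0, 0)
    else (B n ^ 6, B n ^ 6, 0, 0)
  else if tag = 16 then
    if k < (n + 1) ^ 5 then (nd (B n) 15 k 1 0 0 0,
      if a = 0 then nd (B n) 12 k 0 0 0 0 else nd (B n) 13 k (3 * (par n k).D) 0 0 0, 0, 0)
    else (B n ^ 6, B n ^ 6, 0, 0)
  else if tag = 17 then
    if k = 0 then (nd (B n) 2 0 0 0 0 0, nd (B n) 16 0 0 0 0 0, 0, 0)
    else (B n ^ 6, B n ^ 6, 0, 0)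
  else (B n ^ 6, B n ^ 6, 0, 0)

/-- The factors as a function of the number of the word. -/
def factorsAt (n g k : ℕ) : ℕ × ℕ × ℕ × ℕ :=
  factors n (dg (B n) g 0) (dg (B n) g 1) (dg (B n) g 2) (dg (B n) g 3) (dg (B n) g 4)
    (dg (B n) g 5) k

/-- The system of equations for instances with codes of length `n`. -/
def sys (n : ℕ) : SumProd where
  A := B n ^ 6
  K := B n
  w := B n
  leaf g := if dg (B n) g 0 < 7 then 1 else 0
  bit g i := bitCode (par n (dg (B n) g 1)) (dg (B n) g 0) (dg (B n) g 2) i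
  left g k := (factorsAt n g k).1
  right g k := (factorsAt n g k).2.1
  num := nd (B n) 16 0 0 0 0 0
  neg := nd (B n) 17 0 0 0 0 0
  den := nd (B n) 16 0 1 0 0 0

section

variable {t e i : ℕ → ℕ → ℕ}

theorem ar_B : Ar fun n _ => B n := (Ar.fst.add (.const 2)).pow 5

theorem ar_D (ht : Ar t) : Ar fun n g => (par n (t n g)).D := ht.mod (Ar.fst.add (.const 1))

theorem ar_k (ht : Ar t) : Ar fun n g => (par n (t n g)).k :=
  (ht.div (Ar.fst.add (.const 1))).mod (Ar.fst.add (.const 1))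

theorem ar_N (ht : Ar t) : Ar fun n g => (par n (t n g)).N :=
  (ht.div ((Ar.fst.add (.const 1)).pow 2)).mod (Ar.fst.add (.const 1))

theorem ar_R (ht : Ar t) : Ar fun n g => (par n (t n g)).R :=
  (ht.div ((Ar.fst.add (.const 1)).pow 3)).mod (Ar.fst.add (.const 1))

theorem ar_b (ht : Ar t) : Ar fun n g => (par n (t n g)).b :=
  (ht.div ((Ar.fst.add (.const 1)).pow 4)).mod (Ar.fst.add (.const 1))

theorem ar_hd (ht : Ar t) : Ar fun n g => (par n (t n g)).hd :=
  ((((ar_D ht).add (ar_k ht)).add (ar_N ht)).add (ar_R ht)).add (ar_b ht) |>.add (.const 5)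

theorem ar_block (ht : Ar t) : Ar fun n g => (par n (t n g)).block :=
  (((ar_D ht).mul (ar_N ht)).mul (ar_R ht)).mul (ar_R ht)

theorem ar_entries (ht : Ar t) : Ar fun n g => (par n (t n g)).entries :=
  ((ar_block ht).add (ar_block ht)).add
    ((((ar_D ht).mul (.const 2)).mul (ar_R ht)).mul (ar_R ht))

theorem ar_ent (ht : Ar t) (he : Ar e) : Ar fun n g => (par n (t n g)).ent (e n g) :=
  (ar_hd ht).add (he.mul (((Ar.const 2).mul (ar_b ht)).add (.const 1)))

theorem ar_posS (ht : Ar t) : Ar fun n g => (par n (t n g)).posS := ar_ent ht (ar_entries ht)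

theorem ar_posX (ht : Ar t) : Ar fun n g => (par n (t n g)).posX := (ar_posS ht).add (ar_R ht)

theorem ar_posY (ht : Ar t) : Ar fun n g => (par n (t n g)).posY :=
  (ar_posX ht).add ((ar_D ht).mul (ar_N ht))

theorem arP_isEnd (ht : Ar t) (he : Ar e) : ArP fun n g => (par n (t n g)).IsEnd (e n g) := by
  have c := Ar.const
  have e1 := ((ar_D ht).add (c 1)).add (ar_k ht)
  have e2 := (e1.add (c 1)).add (ar_N ht)
  have e3 := (e2.add (c 1)).add (ar_R ht)
  exact .or (.eq he (ar_D ht)) (.or (.eq he e1) (.or (.eq he e2) (.or (.eq he e3)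
    (.eq he ((e3.add (c 1)).add (ar_b ht))))))

theorem ar_bitCode {tag : ℕ → ℕ → ℕ} (ht : Ar t) (htag : Ar tag) (he : Ar e) (hi : Ar i) :
    Ar fun n g => bitCode (par n (t n g)) (tag n g) (e n g) (i n g) := by
  have c := Ar.const
  have h : ∀ k, ArP fun n g => tag n g = k := fun k => .eq htag (c k)
  have i0 : ArP fun n g => i n g = 0 := .eq hi (c 0)
  have ib := ArP.lt hi (ar_b ht)
  have hent := ar_ent ht he
  exact .ite (h 1) (.ite i0 (c 1) (c 0)) (.ite (h 2) (c 1) (.ite (h 3)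
    (.ite i0 (c 1) (hent.add (c 2))) (.ite (h 4)
    (.ite ib (((hent.add (c 1)).add hi).add (c 2)) (c 0)) (.ite (h 5)
    (.ite ib ((((hent.add (c 1)).add (ar_b ht)).add hi).add (c 2)) (c 0))
    (.ite (h 6) (.ite i0 (he.add (c 2)) (c 0)) (c 0))))))

theorem arT_factors {tag a b d₁ d₂ k : ℕ → ℕ → ℕ} (htag : Ar tag) (ht : Ar t) (ha : Ar a)
    (hb : Ar b) (hc : Ar d₁) (hd : Ar d₂) (hk : Ar k) :
    ArT fun n g => factors n (tag n g) (t n g) (a n g) (b n g) (d₁ n g) (d₂ n g) (k n g) := by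
  have c := Ar.const
  have h : ∀ k, ArP fun n g => tag n g = k := fun k => .eq htag (c k)
  have pair : ∀ {l r : ℕ → ℕ → ℕ}, Ar l → Ar r → ArT fun n g => (l n g, r n g, 0, 0) :=
    fun hl hr => .mk hl hr (c 0) (c 0)
  have z : ArT fun n _ => (B n ^ 6, B n ^ 6, 0, 0) := pair (ar_B.pow 6) (ar_B.pow 6)
  have node : ∀ (s : ℕ) {t a b c d : ℕ → ℕ → ℕ}, Ar t → Ar a → Ar b → Ar c → Ar d →
      Ar fun n g => nd (B n) s (t n g) (a n g) (b n g) (c n g) (d n g) :=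
    fun s _ _ _ _ _ ht ha hb hc hd => Ar.nd ar_B (c s) ht ha hb hc hd
  have one : Ar fun n _ => nd (B n) 1 0 0 0 0 0 := node 1 (c 0) (c 0) (c 0) (c 0) (c 0)
  have E := ar_entries ht
  have N := ar_N ht
  have R := ar_R ht
  have k0 : ArP fun n g => k n g = 0 := .eq hk (c 0)
  have entM : ∀ {u v : ℕ → ℕ → ℕ}, Ar u → Ar v →
      Ar fun n g => (par n (t n g)).entM (a n g) (k n g) (u n g) (v n g) := fun hu hv =>
    ((((ha.mul N).add hk).mul R).add hu).mul R |>.add hv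
  have kN := ArP.lt hk N
  have kR := ArP.lt hk R
  have qc := (hc.div R).mod R
  have qd := (hd.div R).mod R
  refine .ite (h 7) (.ite (.and k0 (.lt (c 0) hb)) (.ite (.lt hb E)
    (pair (node 7 ht ha ((c 2).mul hb) (c 0) (c 0))
      (node 7 ht ha (((c 2).mul hb).add (c 1)) (c 0) (c 0)))
    (.ite (.eq (hb.sub E) ha)
      (pair (node 3 ht ha (c 0) (c 0) (c 0)) (node 4 ht ha (c 0) (c 0) (c 0)))
      (pair (node 5 ht (hb.sub E) (c 0) (c 0) (c 0)) one))) z) ?_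
  refine .ite (h 8) (.ite kN (pair
    (node 6 ht ((ar_posX ht).add ((ha.mul N).add hk)) (c 0) (c 0) (c 0))
    (node 7 ht (entM hb hc) (c 1) (c 0) (c 0))) z) ?_
  refine .ite (h 9) (.ite kN (pair
    (node 7 ht ((ar_block ht).add (entM qc qd)) (c 1) (c 0) (c 0))
    (.ite (.eq hb (c 0)) (node 8 ht ha (hc.mod R) (hd.mod R) (c 0))
      (node 7 ht (entM (hc.mod R) (hd.mod R)) (c 1) (c 0) (c 0)))) z) ?_
  refine .ite (h 10) (.ite (.lt hb (c 2)) (.ite (.lt hk (c 2)) (pair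
    (node 7 ht (((ar_block ht).add (ar_block ht)).add
      (((((ha.mul (c 2)).add hk).mul R).add ((hc.div R).div R)).mul R |>.add
        ((hd.div R).div R))) (c 1) (c 0) (c 0))
    (node 9 ht ha hk hc hd)) z) (.ite (.lt hk (R.mul (R.mul R)))
    (pair (node 10 ht ha (hb.div (c 2)) hc hk)
      (node 10 ht (ha.add (hb.div (c 2))) (hb.sub (hb.div (c 2))) hk hd)) z)) ?_
  refine .ite (h 11) (.ite kR (pair (node 6 ht ((ar_posY ht).add hk) (c 0) (c 0) (c 0))
    (node 10 ht (c 0) (ar_D ht) (R.mul (R.mul ha)) hk)) z) ?_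
  refine .ite (h 12) (.ite kR (pair (node 6 ht ((ar_posS ht).add hk) (c 0) (c 0) (c 0))
    (node 11 ht hk (c 0) (c 0) (c 0))) z) ?_
  refine .ite (h 13) (.ite k0 (.ite (.lt ha (c 2)) (pair (node 7 ht E (c 1) (c 0) (c 0)) one)
    (pair (node 13 ht (ha.div (c 2)) (c 0) (c 0) (c 0))
      (node 13 ht (ha.sub (ha.div (c 2))) (c 0) (c 0) (c 0)))) z) ?_
  refine .ite (h 14) (.ite (arP_isEnd ht ha) (.ite k0 (pair one one) (.ite (.eq hk (c 1))
    (pair (node 2 (c 0) (c 0) (c 0) (c 0) (c 0)) (node 6 ht ha (c 0) (c 0) (c 0))) z))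
    (.ite k0 (pair (node 6 ht ha (c 0) (c 0) (c 0)) one) z)) ?_
  refine .ite (h 15) (.ite (.and k0 (.lt (c 0) ha)) (.ite (.lt ha (ar_hd ht))
    (pair (node 15 ht ((c 2).mul ha) (c 0) (c 0) (c 0))
      (node 15 ht (((c 2).mul ha).add (c 1)) (c 0) (c 0) (c 0)))
    (pair (node 14 ht (ha.sub (ar_hd ht)) (c 0) (c 0) (c 0)) one)) z) ?_
  refine .ite (h 16) (.ite (.lt hk ((Ar.fst.add (c 1)).pow 5))
    (pair (node 15 hk (c 1) (c 0) (c 0) (c 0)) (.ite (.eq ha (c 0))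
      (node 12 hk (c 0) (c 0) (c 0) (c 0))
      (node 13 hk ((c 3).mul (ar_D hk)) (c 0) (c 0) (c 0)))) z) ?_
  exact .ite (h 17) (.ite k0 (pair (node 2 (c 0) (c 0) (c 0) (c 0) (c 0))
    (node 16 (c 0) (c 0) (c 0) (c 0) (c 0))) z) z

end

theorem uniform_sys : SumProd.Uniform sys where
  A := ar_B.pow 6
  K := ar_B
  w := ar_B
  num := Ar.nd ar_B (.const _) (.const _) (.const _) (.const _) (.const _) (.const _)
  neg := Ar.nd ar_B (.const _) (.const _) (.const _) (.const _) (.const _) (.const _)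
  den := Ar.nd ar_B (.const _) (.const _) (.const _) (.const _) (.const _) (.const _)
  leaf ha := .ite (.lt (Ar.dg ar_B ha 0) (.const 7)) (.const 1) (.const 0)
  bit ha hi := ar_bitCode (Ar.dg ar_B ha 1) (Ar.dg ar_B ha 0) (Ar.dg ar_B ha 2) hi
  left ha hk := (arT_factors (Ar.dg ar_B ha 0) (Ar.dg ar_B ha 1) (Ar.dg ar_B ha 2)
    (Ar.dg ar_B ha 3) (Ar.dg ar_B ha 4) (Ar.dg ar_B ha 5) hk).1
  right ha hk := (arT_factors (Ar.dg ar_B ha 0) (Ar.dg ar_B ha 1) (Ar.dg ar_B ha 2)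
    (Ar.dg ar_B ha 3) (Ar.dg ar_B ha 4) (Ar.dg ar_B ha 5) hk).2.1

/-- The levels of the words. -/
def lvl (n tag a b : ℕ) : ℕ :=
  if tag = 7 then 1 + (Nat.log 2 (B n) - Nat.log 2 b)
  else if tag = 8 then Nat.log 2 (B n) + 2
  else if tag = 9 then Nat.log 2 (B n) + 3
  else if tag = 10 then Nat.log 2 (B n) + 4 + Nat.clog 2 b
  else if tag = 11 then 2 * Nat.log 2 (B n) + 6
  else if tag = 12 then 2 * Nat.log 2 (B n) + 7
  else if tag = 13 then Nat.log 2 (B n) + 2 + Nat.clog 2 a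
  else if tag = 14 then 1
  else if tag = 15 then 2 + (Nat.log 2 (B n) - Nat.log 2 a)
  else if tag = 16 then 2 * Nat.log 2 (B n) + 8
  else if tag = 17 then 2 * Nat.log 2 (B n) + 9
  else 0

theorem clog_lt_of_lt {n l : ℕ} (h : l < B n) : Nat.clog 2 l ≤ Nat.log 2 (B n) + 1 :=
  (Nat.clog_mono_right 2 h.le).trans (clog_le_log _)

theorem ite_le_of_le {p : Prop} [Decidable p] {x y z : ℕ} (hx : x ≤ z) (hy : y ≤ z) :
    (if p then x else y) ≤ z := by
  split_ifs <;> assumption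

theorem lvl_le (n tag : ℕ) {a b : ℕ} (ha : Nat.clog 2 a ≤ Nat.log 2 (B n) + 1)
    (hb : Nat.clog 2 b ≤ Nat.log 2 (B n) + 1) : lvl n tag a b ≤ 2 * Nat.log 2 (B n) + 9 := by
  unfold lvl
  generalize Nat.log 2 (B n) = x at *
  repeat' apply ite_le_of_le
  all_goals omega

theorem factors_levels (n tag t a b c d k : ℕ) (Q : ℕ → Prop) (hz : Q (B n ^ 6))
    (hQ : ∀ tag' t' a' b' c' d', (a' < B n → b' < B n → lvl n tag' a' b' < lvl n tag a b) →
      Q (nd (B n) tag' t' a' b' c' d')) :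
    7 ≤ tag → Q (factors n tag t a b c d k).1 ∧ Q (factors n tag t a b c d k).2.1 := by
  intro htag
  have hz2 : Q ((B n ^ 6, B n ^ 6, 0, 0) : ℕ × ℕ × ℕ × ℕ).1 ∧
      Q ((B n ^ 6, B n ^ 6, 0, 0) : ℕ × ℕ × ℕ × ℕ).2.1 := ⟨hz, hz⟩
  unfold factors
  by_cases h7 : tag = 7
  · subst h7
    rw [if_pos rfl]
    split_ifs with h1 h2 h3
    · have e1 := SumProd.log_two_mul h1.2
      have e2 := SumProd.log_two_mul_add_one h1.2
      refine ⟨hQ _ _ _ _ _ _ fun _ hb => ?_, hQ _ _ _ _ _ _ fun _ hb => ?_⟩ <;>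
      · have := Nat.log_mono_right (b := 2) hb.le
        simp only [lvl, if_true]
        omega
    · dsimp only
      exact ⟨hQ _ _ _ _ _ _ fun _ _ => by simp [lvl], hQ _ _ _ _ _ _ fun _ _ => by simp [lvl]⟩
    · dsimp only
      exact ⟨hQ _ _ _ _ _ _ fun _ _ => by simp [lvl], hQ _ _ _ _ _ _ fun _ _ => by simp [lvl]⟩
    · exact hz2
  rw [if_neg h7]
  by_cases h8 : tag = 8
  · subst h8
    rw [if_pos rfl]
    split_ifs
    · dsimp only
      exact ⟨hQ _ _ _ _ _ _ fun _ _ => by simp [lvl],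
        hQ _ _ _ _ _ _ fun _ _ => by simp [lvl]; omega⟩
    · exact hz2
  rw [if_neg h8]
  by_cases h9 : tag = 9
  · subst h9
    rw [if_pos rfl]
    by_cases hk : k < (par n t).N
    · rw [if_pos hk]
      refine ⟨hQ _ _ _ _ _ _ fun _ _ => by simp [lvl]; omega, ?_⟩
      dsimp only
      split_ifs
      · exact hQ _ _ _ _ _ _ fun _ _ => by simp [lvl]
      · exact hQ _ _ _ _ _ _ fun _ _ => by simp [lvl]; omega
    · rw [if_neg hk]
      exact hz2
  rw [if_neg h9]
  by_cases h10 : tag = 10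
  · subst h10
    rw [if_pos rfl]
    split_ifs
    · dsimp only
      exact ⟨hQ _ _ _ _ _ _ fun _ _ => by simp [lvl]; omega,
        hQ _ _ _ _ _ _ fun _ _ => by simp [lvl]; omega⟩
    · exact hz2
    · obtain ⟨e1, e2⟩ := SumProd.clog_halves (show 2 ≤ b by omega)
      dsimp only
      exact ⟨hQ _ _ _ _ _ _ fun _ _ => by simp [lvl]; omega,
        hQ _ _ _ _ _ _ fun _ _ => by simp [lvl]; omega⟩
    · exact hz2
  rw [if_neg h10]
  by_cases h11 : tag = 11
  · subst h11
    rw [if_pos rfl]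
    split_ifs
    · dsimp only
      exact ⟨hQ _ _ _ _ _ _ fun _ _ => by simp [lvl],
        hQ _ _ _ _ _ _ fun _ hb => by have := clog_lt_of_lt hb; simp [lvl]; omega⟩
    · exact hz2
  rw [if_neg h11]
  by_cases h12 : tag = 12
  · subst h12
    rw [if_pos rfl]
    split_ifs
    · dsimp only
      exact ⟨hQ _ _ _ _ _ _ fun _ _ => by simp [lvl], hQ _ _ _ _ _ _ fun _ _ => by simp [lvl]⟩
    · exact hz2
  rw [if_neg h12]
  by_cases h13 : tag = 13
  · subst h13
    rw [if_pos rfl]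
    split_ifs
    · dsimp only
      exact ⟨hQ _ _ _ _ _ _ fun _ _ => by simp [lvl]; omega,
        hQ _ _ _ _ _ _ fun _ _ => by simp [lvl]⟩
    · obtain ⟨e1, e2⟩ := SumProd.clog_halves (show 2 ≤ a by omega)
      dsimp only
      exact ⟨hQ _ _ _ _ _ _ fun _ _ => by simp [lvl]; omega,
        hQ _ _ _ _ _ _ fun _ _ => by simp [lvl]; omega⟩
    · exact hz2
  rw [if_neg h13]
  by_cases h14 : tag = 14
  · subst h14
    rw [if_pos rfl]
    split_ifs <;>
    first
    | exact hz2
    | (dsimp only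
       exact ⟨hQ _ _ _ _ _ _ fun _ _ => by simp [lvl], hQ _ _ _ _ _ _ fun _ _ => by simp [lvl]⟩)
  rw [if_neg h14]
  by_cases h15 : tag = 15
  · subst h15
    rw [if_pos rfl]
    split_ifs with h1 h2
    · have e1 := SumProd.log_two_mul h1.2
      have e2 := SumProd.log_two_mul_add_one h1.2
      refine ⟨hQ _ _ _ _ _ _ fun ha _ => ?_, hQ _ _ _ _ _ _ fun ha _ => ?_⟩ <;>
      · have := Nat.log_mono_right (b := 2) ha.le
        simp [lvl]
        omega
    · dsimp only
      exact ⟨hQ _ _ _ _ _ _ fun _ _ => by simp [lvl]; omega,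
        hQ _ _ _ _ _ _ fun _ _ => by simp [lvl]⟩
    · exact hz2
  rw [if_neg h15]
  by_cases h16 : tag = 16
  · subst h16
    rw [if_pos rfl]
    by_cases hk : k < (n + 1) ^ 5
    · rw [if_pos hk]
      refine ⟨hQ _ _ _ _ _ _ fun _ _ => by simp [lvl]; omega, ?_⟩
      dsimp only
      split_ifs
      · exact hQ _ _ _ _ _ _ fun _ _ => by simp [lvl]
      · exact hQ _ _ _ _ _ _ fun ha _ => by have := clog_lt_of_lt ha; simp [lvl]; omega
    · rw [if_neg hk]
      exact hz2
  rw [if_neg h16]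
  by_cases h17 : tag = 17
  · subst h17
    rw [if_pos rfl]
    split_ifs
    · dsimp only
      exact ⟨hQ _ _ _ _ _ _ fun _ _ => by simp [lvl], hQ _ _ _ _ _ _ fun _ _ => by simp [lvl]⟩
    · exact hz2
  rw [if_neg h17]
  exact hz2

theorem sys_levels : ∃ c, ∀ n, ∃ lv : ℕ → ℕ, (∀ a < (sys n).A, lv a ≤ c * Nat.log 2 n + c) ∧
    ∀ a < (sys n).A, (sys n).leaf a = 0 → ∀ k < (sys n).K,
      ((sys n).left a k < (sys n).A → lv ((sys n).left a k) < lv a) ∧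
      ((sys n).right a k < (sys n).A → lv ((sys n).right a k) < lv a) := by
  obtain ⟨c, hc⟩ := ar_B.polyBdd_left.log
  refine ⟨2 * c + 9, fun n => ⟨fun g => lvl n (dg (B n) g 0) (dg (B n) g 2) (dg (B n) g 3),
    fun g hg => ?_, fun g hg hl k hk => ?_⟩⟩
  · have h2 := clog_lt_of_lt (dg_lt hg 2)
    have h3 := clog_lt_of_lt (dg_lt hg 3)
    have := hc n
    have : 2 * Nat.log 2 (B n) + 9 ≤ (2 * c + 9) * Nat.log 2 n + (2 * c + 9) := by nlinarith
    refine le_trans ?_ this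
    exact lvl_le n _ h2 h3
  · have htag : 7 ≤ dg (B n) g 0 := by
      by_contra hc
      have hl' : (if dg (B n) g 0 < 7 then 1 else 0) = 0 := hl
      rw [if_pos (by omega)] at hl'
      omega
    refine factors_levels n _ _ _ _ _ _ k (fun l => l < (sys n).A →
      lvl n (dg (B n) l 0) (dg (B n) l 2) (dg (B n) l 3) <
        lvl n (dg (B n) g 0) (dg (B n) g 2) (dg (B n) g 3)) (fun h => absurd h (lt_irrefl _))
      (fun tag' t' a' b' c' d' h hlt => ?_) htag
    have hd := lt_of_nd_lt hlt
    obtain ⟨h0, -, h2, h3, -, -⟩ := dg_nd hd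
    rw [h0, h2, h3]
    exact h hd.2.2.1 hd.2.2.2.1

end Prog

end ITSHAP

namespace ITSHAP

open Finset

/-! ### Products of matrices indexed by natural numbers -/

/-- The entry `(s, s')` of the product of the `m × m` matrices `A a, …, A (a + l - 1)`. -/
def chain {R : Type*} [CommRing R] (A : ℕ → ℕ → ℕ → R) (m : ℕ) : ℕ → ℕ → ℕ → ℕ → R
  | _, 0, s, s' => if s = s' then 1 else 0
  | a, l + 1, s, s' => ∑ u ∈ range m, A a s u * chain A m (a + 1) l u s'

section chain

variable {R : Type*} [CommRing R] {A : ℕ → ℕ → ℕ → R} {m : ℕ}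

theorem chain_one {a s s' : ℕ} (hs' : s' < m) : chain A m a 1 s s' = A a s s' := by
  simp [chain, hs']

theorem chain_add (l₂ : ℕ) : ∀ (l₁ a s s' : ℕ), s < m →
    chain A m a (l₁ + l₂) s s' = ∑ u ∈ range m, chain A m a l₁ s u * chain A m (a + l₁) l₂ u s' := by
  intro l₁
  induction l₁ with
  | zero => intro a s s' hs; simp [chain, hs]
  | succ l ih =>
    intro a s s' hs
    rw [show l + 1 + l₂ = (l + l₂) + 1 by omega, chain]
    simp only [chain, sum_mul]
    rw [sum_comm]
    refine sum_congr rfl fun u hu => ?_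
    rw [ih (a + 1) u s' (mem_range.1 hu), mul_sum]
    refine sum_congr rfl fun v _ => ?_
    rw [mul_assoc, show a + 1 + l = a + (l + 1) by omega]

theorem chain_congr {A' : ℕ → ℕ → ℕ → R} {D : ℕ}
    (h : ∀ a < D, ∀ s < m, ∀ s' < m, A a s s' = A' a s s') :
    ∀ (l a s s' : ℕ), s < m → a + l ≤ D → chain A m a l s s' = chain A' m a l s s' := by
  intro l
  induction l with
  | zero => intros; rfl
  | succ l ih =>
    intro a s s' hs ha
    simp only [chain]
    refine sum_congr rfl fun u hu => ?_
    rw [h a (by omega) s hs u (mem_range.1 hu), ih _ _ _ (mem_range.1 hu) (by omega)]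

theorem chain_smul (c : R) : ∀ (l a s s' : ℕ),
    chain (fun a s s' => c * A a s s') m a l s s' = c ^ l * chain A m a l s s' := by
  intro l
  induction l with
  | zero => intros; simp [chain]
  | succ l ih =>
    intro a s s'
    simp only [chain, ih, mul_sum, pow_succ]
    exact sum_congr rfl fun u _ => by ring

theorem map_chain {R' : Type*} [CommRing R'] (f : R →+* R') : ∀ (l a s s' : ℕ),
    f (chain A m a l s s') = chain (fun a s s' => f (A a s s')) m a l s s' := by
  intro l
  induction l with
  | zero => intro a s s'; simp only [chain]; split_ifs <;> simp
  | succ l ih => intro a s s'; simp only [chain, map_sum, map_mul, ih]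

theorem abs_chain_le {A : ℕ → ℕ → ℕ → ℤ} {D : ℕ} {C : ℤ} (hC : 0 ≤ C)
    (h : ∀ a < D, ∀ s < m, ∀ s' < m, |A a s s'| ≤ C) :
    ∀ (l a s s' : ℕ), s < m → a + l ≤ D → |chain A m a l s s'| ≤ (m * C) ^ l := by
  intro l
  induction l with
  | zero => intro a s s' _ _; simp only [chain]; split_ifs <;> simp
  | succ l ih =>
    intro a s s' hs ha
    simp only [chain]
    refine (abs_sum_le_sum_abs _ _).trans ?_
    refine (sum_le_sum (g := fun _ => C * (m * C) ^ l) fun u hu => ?_).trans ?_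
    · rw [abs_mul]
      exact mul_le_mul (h a (by omega) s hs u (mem_range.1 hu))
        (ih _ _ _ (mem_range.1 hu) (by omega)) (abs_nonneg _) hC
    · rw [sum_const, card_range, nsmul_eq_mul, pow_succ]
      exact le_of_eq (by ring)

end chain

/-! ### The integers that the system of equations describes -/

namespace Par

variable (P : Par) (x : List Bool)

/-- A bit of the input as an integer. -/
def bitAt (x : List Bool) (p : ℕ) : ℤ := (x.getD p false).toNat

/-- The encoded sign of a core entry. -/
def sgnAt (e : ℕ) : ℤ := if x.getD (P.ent e) false then -1 else 1

/-- The encoded numerator of a core entry. -/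
def numAt (e : ℕ) : ℕ := ∑ i ∈ range P.b, 2 ^ i * (x.getD (P.ent e + 1 + i) false).toNat

/-- The encoded denominator of a core entry. -/
def denAt (e : ℕ) : ℕ := ∑ i ∈ range P.b, 2 ^ i * (x.getD (P.ent e + 1 + P.b + i) false).toNat

/-- The core entry `e`, multiplied by the common denominator of all entries; the common
denominator itself if there is no such entry. -/
def scaled (e : ℕ) : ℤ :=
  ∏ r ∈ range P.entries, if r = e then P.sgnAt x e * P.numAt x e else (P.denAt x r : ℤ)

/-- The common denominator of all core entries. -/
def common : ℕ := ∏ r ∈ range P.entries, P.denAt x r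

/-- The entries of the model core at the explained input. -/
def slice (j u v : ℕ) : ℤ :=
  ∑ i ∈ range P.N, bitAt x (P.posX + (j * P.N + i)) * P.scaled x (P.entM j i u v)

/-- The entries of the cores of the Value Tensor. -/
def value (j τ s s' : ℕ) : ℤ :=
  ∑ i ∈ range P.N, P.scaled x (P.entP j i (s / P.R % P.R) (s' / P.R % P.R)) *
    if τ = 0 then P.slice x j (s % P.R) (s' % P.R)
    else P.scaled x (P.entM j i (s % P.R) (s' % P.R))

/-- The entries of the transfer matrices. -/
def transfer (j s s' : ℕ) : ℤ :=
  ∑ τ ∈ range 2, P.scaled x (P.entW j τ (s / P.R / P.R) (s' / P.R / P.R)) * P.value x j τ s s'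

/-- The numerator of the result. -/
def result : ℤ :=
  ∑ w ∈ range P.R, bitAt x (P.posS + w) * ∑ y ∈ range P.R, bitAt x (P.posY + y) *
    chain (P.transfer x) (P.R * (P.R * P.R)) 0 P.D (P.R * (P.R * w)) y

/-- The word starts with the unary codes of the size parameters. -/
def Matches : Prop := ∀ p < P.hd, x.getD p false = !decide (P.IsEnd p)

theorem entM_lt {j i u v : ℕ} (hj : j < P.D) (hi : i < P.N) (hu : u < P.R) (hv : v < P.R) :
    P.entM j i u v < P.block := by
  have step : ∀ {a b c d : ℕ}, a < b → c < d → a * d + c < b * d := fun {a b c d} h1 h2 => by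
    calc a * d + c < (a + 1) * d := by rw [add_mul]; omega
      _ ≤ b * d := Nat.mul_le_mul_right _ h1
  exact step (step (step hj hi) hu) hv

theorem entM_lt_entries {j i u v : ℕ} (hj : j < P.D) (hi : i < P.N) (hu : u < P.R)
    (hv : v < P.R) : P.entM j i u v < P.entries := by
  have := P.entM_lt hj hi hu hv
  unfold entries; omega

theorem entP_lt_entries {j i u v : ℕ} (hj : j < P.D) (hi : i < P.N) (hu : u < P.R)
    (hv : v < P.R) : P.entP j i u v < P.entries := by
  have := P.entM_lt hj hi hu hv
  unfold entries entP; omega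

theorem entW_lt_entries {j i u v : ℕ} (hj : j < P.D) (hi : i < 2) (hu : u < P.R)
    (hv : v < P.R) : P.entW j i u v < P.entries := by
  have := Par.entM_lt { P with N := 2 } hj hi hu hv
  unfold entM block at this
  unfold entries entW
  simp only at this
  omega

end Par

namespace Prog

variable {n : ℕ} {x : List Bool} {X : ℕ → ZMod (2 ^ (sys n).w)}

theorem X_zero (hX : (sys n).Solves x X) : X (B n ^ 6) = 0 := hX.zero _ le_rfl

theorem X_sum (hX : (sys n).Solves x X) {tag t a b c d : ℕ} (htag : 7 ≤ tag)
    (box : tag < B n ∧ t < B n ∧ a < B n ∧ b < B n ∧ c < B n ∧ d < B n) :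
    X (nd (B n) tag t a b c d) = ∑ k ∈ range (B n),
      X (factors n tag t a b c d k).1 * X (factors n tag t a b c d k).2.1 := by
  obtain ⟨h0, h1, h2, h3, h4, h5⟩ := dg_nd box
  have hl : (sys n).leaf (nd (B n) tag t a b c d) = 0 := by
    change (if dg (B n) (nd (B n) tag t a b c d) 0 < 7 then 1 else 0) = 0
    rw [h0, if_neg (by omega)]
  have := hX.sum _ (nd_of_lt box) hl
  rw [this]
  change ∑ k ∈ range (B n), X (factorsAt n _ k).1 * X (factorsAt n _ k).2.1 = _
  unfold factorsAt
  rw [h0, h1, h2, h3, h4, h5]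

theorem X_leaf (hX : (sys n).Solves x X) {tag t a b c d : ℕ} (htag : tag < 7)
    (box : tag < B n ∧ t < B n ∧ a < B n ∧ b < B n ∧ c < B n ∧ d < B n) :
    X (nd (B n) tag t a b c d) = ∑ i ∈ range (B n), 2 ^ i *
      ((SumProd.bitVal x (bitCode (par n t) tag a i)).toNat : ZMod (2 ^ (sys n).w)) := by
  obtain ⟨h0, h1, h2, -, -, -⟩ := dg_nd box
  have hl : (sys n).leaf (nd (B n) tag t a b c d) ≠ 0 := by
    change (if dg (B n) (nd (B n) tag t a b c d) 0 < 7 then 1 else 0) ≠ 0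
    rw [h0, if_pos htag]
    omega
  have := hX.leaf _ (nd_of_lt box) hl
  rw [this]
  change ∑ i ∈ range (B n), 2 ^ i * ((SumProd.bitVal x (bitCode (par n (dg (B n) _ 1))
    (dg (B n) _ 0) (dg (B n) _ 2) i)).toNat : ZMod (2 ^ (sys n).w)) = _
  rw [h0, h1, h2]

/-- A word that is a sum of `m` products. -/
theorem X_range (hX : (sys n).Solves x X) {tag t a b c d : ℕ} (htag : 7 ≤ tag)
    (box : tag < B n ∧ t < B n ∧ a < B n ∧ b < B n ∧ c < B n ∧ d < B n) (m : ℕ) (hm : m ≤ B n)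
    (l r : ℕ → ℕ) (h : ∀ k, factors n tag t a b c d k =
      if k < m then (l k, r k, 0, 0) else (B n ^ 6, B n ^ 6, 0, 0)) :
    X (nd (B n) tag t a b c d) = ∑ k ∈ range m, X (l k) * X (r k) := by
  rw [X_sum hX htag box, ← sum_subset (range_subset_range.2 hm)]
  · refine sum_congr rfl fun k hk => ?_
    rw [h, if_pos (mem_range.1 hk)]
  · intro k _ hk
    rw [h, if_neg (fun hc => hk (mem_range.2 hc))]
    simp [X_zero hX]

/-- A word that is a single product. -/
theorem X_mul (hX : (sys n).Solves x X) {tag t a b c d : ℕ} (htag : 7 ≤ tag)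
    (box : tag < B n ∧ t < B n ∧ a < B n ∧ b < B n ∧ c < B n ∧ d < B n) (l r : ℕ)
    (h : ∀ k, factors n tag t a b c d k = if k = 0 then (l, r, 0, 0) else (B n ^ 6, B n ^ 6, 0, 0)) :
    X (nd (B n) tag t a b c d) = X l * X r := by
  rw [X_range hX htag box 1 (by omega) (fun _ => l) (fun _ => r), sum_range_one]
  intro k
  rw [h]
  simp only [Nat.lt_one_iff]

theorem B_large (n : ℕ) : 32 ≤ B n ∧ 16 * n + 32 ≤ B n ∧ (n + 1) ^ 5 < B n := by
  have h1 : (n + 1) ^ 5 < (n + 2) ^ 5 := Nat.pow_lt_pow_left (by omega) (by omega)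
  have h2 : 2 ^ 4 * (n + 2) ≤ (n + 2) ^ 4 * (n + 2) :=
    Nat.mul_le_mul_right _ (Nat.pow_le_pow_left (by omega) _)
  have h3 : (n + 2) ^ 4 * (n + 2) = (n + 2) ^ 5 := by ring
  unfold B
  omega

theorem X_one (hX : (sys n).Solves x X) : X (nd (B n) 1 0 0 0 0 0) = 1 := by
  obtain ⟨h, -, -⟩ := B_large n
  rw [X_leaf hX (by omega) ⟨by omega, by omega, by omega, by omega, by omega, by omega⟩,
    sum_eq_single_of_mem 0 (mem_range.2 (by omega))]
  · simp [bitCode, SumProd.bitVal]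
  · intro i _ hi
    simp [bitCode, SumProd.bitVal, hi]

theorem sum_two_pow (w : ℕ) (R : Type*) [CommRing R] :
    ∑ i ∈ range w, (2 : R) ^ i = 2 ^ w - 1 := by
  induction w with
  | zero => simp
  | succ w ih => rw [sum_range_succ, ih, pow_succ]; ring

theorem X_neg_one (hX : (sys n).Solves x X) : X (nd (B n) 2 0 0 0 0 0) = -1 := by
  obtain ⟨h, -, -⟩ := B_large n
  rw [X_leaf hX (by omega) ⟨by omega, by omega, by omega, by omega, by omega, by omega⟩]
  have e : ∀ i ∈ range (B n), (2 : ZMod (2 ^ (sys n).w)) ^ i *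
      ((SumProd.bitVal x (bitCode (par n 0) 2 0 i)).toNat : ZMod (2 ^ (sys n).w)) = 2 ^ i := by
    intro i _
    simp [bitCode, SumProd.bitVal]
  have h0 : (2 : ZMod (2 ^ (sys n).w)) ^ (B n) = 0 := two_pow_eq_zero (sys n).w
  rw [sum_congr rfl e, sum_two_pow, h0, zero_sub]

theorem bitVal_add_two (x : List Bool) (p : ℕ) :
    SumProd.bitVal x (p + 2) = x.getD p false := by
  simp [SumProd.bitVal]

theorem X_bit (hX : (sys n).Solves x X) {t p : ℕ} (ht : t < B n) (hp : p < B n) :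
    X (nd (B n) 6 t p 0 0 0) = (Par.bitAt x p : ℤ) := by
  obtain ⟨h, -, -⟩ := B_large n
  rw [X_leaf hX (by omega) ⟨by omega, by omega, by omega, by omega, by omega, by omega⟩,
    sum_eq_single_of_mem 0 (mem_range.2 (by omega))]
  · simp [bitCode, bitVal_add_two, Par.bitAt]
  · intro i _ hi
    simp [bitCode, SumProd.bitVal, hi]

theorem X_sgn (hX : (sys n).Solves x X) {t e : ℕ} (ht : t < B n) (he : e < B n) :
    X (nd (B n) 3 t e 0 0 0) = ((par n t).sgnAt x e : ℤ) := by
  obtain ⟨h, -, -⟩ := B_large n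
  rw [X_leaf hX (by omega) ⟨by omega, by omega, by omega, by omega, by omega, by omega⟩]
  have e1 : ∀ i ∈ range (B n), (2 : ZMod (2 ^ (sys n).w)) ^ i *
      ((SumProd.bitVal x (bitCode (par n t) 3 e i)).toNat : ZMod (2 ^ (sys n).w)) =
      (if i = 0 then 1 else
        2 ^ i * ((x.getD ((par n t).ent e) false).toNat : ZMod (2 ^ (sys n).w)) :
          ZMod (2 ^ (sys n).w)) := by
    intro i _
    by_cases hi : i = 0
    · simp [bitCode, hi, SumProd.bitVal]
    · simp only [bitCode, hi]
      simp [bitVal_add_two]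
  rw [sum_congr rfl e1]
  unfold Par.sgnAt
  rcases hb : x.getD ((par n t).ent e) false
  · simp [show 0 < B n by omega]
  · have h0 : (2 : ZMod (2 ^ (sys n).w)) ^ (B n) = 0 := two_pow_eq_zero (sys n).w
    have : ∀ i ∈ range (B n), (if i = 0 then 1 else (2 : ZMod (2 ^ (sys n).w)) ^ i *
        ((true.toNat : ℕ) : ZMod (2 ^ (sys n).w))) = 2 ^ i := by
      intro i _
      by_cases hi : i = 0 <;> simp [hi]
    rw [sum_congr rfl this, sum_two_pow, h0]
    simp

theorem sum_digits {R : Type*} [CommRing R] {b w : ℕ} (hb : b ≤ w) (f : ℕ → Bool) :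
    ∑ i ∈ range w, (2 : R) ^ i * (((if i < b then f i else false).toNat : ℕ) : R) =
      ((∑ i ∈ range b, 2 ^ i * (f i).toNat : ℕ) : R) := by
  rw [← sum_subset (range_subset_range.2 hb)]
  · push_cast
    exact sum_congr rfl fun i hi => by rw [if_pos (mem_range.1 hi)]
  · intro i _ hi
    rw [if_neg (fun hc => hi (mem_range.2 hc))]
    simp

theorem par_le (n t : ℕ) : (par n t).D ≤ n ∧ (par n t).k ≤ n ∧ (par n t).N ≤ n ∧
    (par n t).R ≤ n ∧ (par n t).b ≤ n := by
  have : ∀ m, m % (n + 1) ≤ n := fun m => Nat.le_of_lt_succ (Nat.mod_lt _ (by omega))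
  exact ⟨this _, this _, this _, this _, this _⟩

theorem X_num (hX : (sys n).Solves x X) {t e : ℕ} (ht : t < B n) (he : e < B n) :
    X (nd (B n) 4 t e 0 0 0) = ((par n t).numAt x e : ℕ) := by
  obtain ⟨h, h', -⟩ := B_large n
  obtain ⟨-, -, -, -, hb⟩ := par_le n t
  rw [X_leaf hX (by omega) ⟨by omega, by omega, by omega, by omega, by omega, by omega⟩,
    Par.numAt, ← sum_digits (show (par n t).b ≤ B n by omega)]
  refine sum_congr rfl fun i _ => ?_
  by_cases hi : i < (par n t).b
  · simp only [bitCode, hi]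
    simp [bitVal_add_two]
  · simp [bitCode, hi, SumProd.bitVal]

theorem X_den (hX : (sys n).Solves x X) {t e : ℕ} (ht : t < B n) (he : e < B n) :
    X (nd (B n) 5 t e 0 0 0) = ((par n t).denAt x e : ℕ) := by
  obtain ⟨h, h', -⟩ := B_large n
  obtain ⟨-, -, -, -, hb⟩ := par_le n t
  rw [X_leaf hX (by omega) ⟨by omega, by omega, by omega, by omega, by omega, by omega⟩,
    Par.denAt, ← sum_digits (show (par n t).b ≤ B n by omega)]
  refine sum_congr rfl fun i _ => ?_
  by_cases hi : i < (par n t).b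
  · simp only [bitCode, hi]
    simp [bitVal_add_two]
  · simp [bitCode, hi, SumProd.bitVal]

theorem X_scaled (hX : (sys n).Solves x X) {t e : ℕ} (ht : t < B n)
    (hE : 0 < (par n t).entries) (hEn : (par n t).entries ≤ n) (he : e ≤ (par n t).entries) :
    X (nd (B n) 7 t e 1 0 0) = ((par n t).scaled x e : ℤ) := by
  obtain ⟨h, h', -⟩ := B_large n
  rw [prod_heap hE (fun q => X (nd (B n) 7 t e q 0 0)), Par.scaled]
  · push_cast
    refine prod_congr rfl fun r hr => ?_
    have hr := mem_range.1 hr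
    by_cases hre : r = e
    · subst hre
      rw [if_pos rfl, X_mul hX (by omega)
        ⟨by omega, by omega, by omega, by omega, by omega, by omega⟩
        (nd (B n) 3 t r 0 0 0) (nd (B n) 4 t r 0 0 0), X_sgn hX ht (by omega),
        X_num hX ht (by omega)]
      intro k
      simp [factors, show 0 < (par n t).entries + r by omega]
    · rw [if_neg hre, X_mul hX (by omega)
        ⟨by omega, by omega, by omega, by omega, by omega, by omega⟩
        (nd (B n) 5 t r 0 0 0) (nd (B n) 1 0 0 0 0 0), X_one hX, X_den hX ht (by omega), mul_one]
      intro k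
      simp [factors, hre, show 0 < (par n t).entries + r by omega]
  · intro q hq hqE
    refine X_mul hX (by omega) ⟨by omega, by omega, by omega, by omega, by omega, by omega⟩ _ _
      fun k => ?_
    simp [factors, hq, hqE]

theorem scaled_entries (P : Par) (x : List Bool) : P.scaled x P.entries = (P.common x : ℤ) := by
  unfold Par.scaled Par.common
  push_cast
  exact prod_congr rfl fun r hr => if_neg (by have := mem_range.1 hr; omega)

end Prog

end ITSHAP

namespace ITSHAP

open Finset

namespace Prog

variable {n : ℕ} {x : List Bool} {X : ℕ → ZMod (2 ^ (sys n).w)}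

/-- The code of an instance with these size parameters has length at most `n`. -/
structure Fits (P : Par) (n : ℕ) : Prop where
  D : P.D ≤ n
  N : P.N ≤ n
  R : P.R ≤ n
  entries_pos : 0 < P.entries
  pos : P.posY + P.R ≤ n

variable {P : Par}

theorem Fits.entries_le (h : Fits P n) : P.entries ≤ n := by
  have := h.pos
  unfold Par.posY Par.posX Par.posS Par.ent at this
  have : P.entries * 1 ≤ P.entries * (2 * P.b + 1) := Nat.mul_le_mul_left _ (by omega)
  omega

theorem Fits.cube (h : Fits P n) : P.R * (P.R * P.R) < B n := by
  obtain ⟨-, -, h3⟩ := B_large n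
  refine lt_of_le_of_lt ?_ h3
  calc P.R * (P.R * P.R) ≤ (n + 1) * ((n + 1) * (n + 1)) := by
        have := h.R; gcongr <;> omega
    _ = (n + 1) ^ 3 := by ring
    _ ≤ (n + 1) ^ 5 := Nat.pow_le_pow_right (by omega) (by omega)

theorem triple_lt {R s : ℕ} (hs : s < R * (R * R)) :
    0 < R ∧ s % R < R ∧ s / R % R < R ∧ s / R / R < R := by
  have hR : 0 < R := by
    rcases Nat.eq_zero_or_pos R with rfl | h
    · simp at hs
    · exact h
  refine ⟨hR, Nat.mod_lt _ hR, Nat.mod_lt _ hR, ?_⟩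
  rw [Nat.div_lt_iff_lt_mul hR, Nat.div_lt_iff_lt_mul hR]
  linarith

theorem X_slice (hX : (sys n).Solves x X) {t j u v : ℕ} (ht : t < B n) (hf : Fits (par n t) n)
    (hj : j < (par n t).D) (hu : u < (par n t).R) (hv : v < (par n t).R) :
    X (nd (B n) 8 t j u v 0) = ((par n t).slice x j u v : ℤ) := by
  obtain ⟨h, h', -⟩ := B_large n
  have := hf.D
  have := hf.R
  have := hf.N
  rw [X_range hX (by omega) ⟨by omega, by omega, by omega, by omega, by omega, by omega⟩
    (par n t).N (by omega)
    (fun k => nd (B n) 6 t ((par n t).posX + (j * (par n t).N + k)) 0 0 0)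
    (fun k => nd (B n) 7 t ((par n t).entM j k u v) 1 0 0) fun k => by simp [factors], Par.slice]
  push_cast
  refine sum_congr rfl fun i hi => ?_
  have hi := mem_range.1 hi
  have e1 := (par n t).entM_lt_entries hj hi hu hv
  have e2 : j * (par n t).N + i < (par n t).D * (par n t).N :=
    calc j * (par n t).N + i < (j + 1) * (par n t).N := by rw [add_mul]; omega
      _ ≤ _ := Nat.mul_le_mul_right _ hj
  have e3 := hf.pos
  unfold Par.posY at e3
  rw [X_bit hX ht (by omega), X_scaled hX ht hf.entries_pos hf.entries_le e1.le]

theorem X_value (hX : (sys n).Solves x X) {t j τ s s' : ℕ} (ht : t < B n)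
    (hf : Fits (par n t) n) (hj : j < (par n t).D) (hτ : τ < 2)
    (hs : s < (par n t).R * ((par n t).R * (par n t).R))
    (hs' : s' < (par n t).R * ((par n t).R * (par n t).R)) :
    X (nd (B n) 9 t j τ s s') = ((par n t).value x j τ s s' : ℤ) := by
  obtain ⟨h, h', -⟩ := B_large n
  have := hf.D
  have := hf.cube
  have := hf.N
  obtain ⟨-, h1, h2, h3⟩ := triple_lt hs
  obtain ⟨-, h1', h2', h3'⟩ := triple_lt hs'
  rw [X_range hX (by omega) ⟨by omega, by omega, by omega, by omega, by omega, by omega⟩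
    (par n t).N (by omega)
    (fun k => nd (B n) 7 t ((par n t).entP j k (s / (par n t).R % (par n t).R)
        (s' / (par n t).R % (par n t).R)) 1 0 0)
    (fun k => if τ = 0 then nd (B n) 8 t j (s % (par n t).R) (s' % (par n t).R) 0
      else nd (B n) 7 t ((par n t).entM j k (s % (par n t).R) (s' % (par n t).R)) 1 0 0)
    fun k => by simp [factors], Par.value]
  push_cast
  refine sum_congr rfl fun i hi => ?_
  have hi := mem_range.1 hi
  rw [X_scaled hX ht hf.entries_pos hf.entries_le
    ((par n t).entP_lt_entries hj hi h2 h2').le]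
  by_cases h0 : τ = 0
  · simp only [if_pos h0]
    rw [X_slice hX ht hf hj h1 h1']
  · simp only [if_neg h0]
    rw [X_scaled hX ht hf.entries_pos hf.entries_le
      ((par n t).entM_lt_entries hj hi h1 h1').le]

theorem X_chain (hX : (sys n).Solves x X) {t : ℕ} (ht : t < B n) (hf : Fits (par n t) n)
    (l : ℕ) : ∀ a s s', 0 < l → a + l ≤ (par n t).D →
    s < (par n t).R * ((par n t).R * (par n t).R) →
    s' < (par n t).R * ((par n t).R * (par n t).R) →
    X (nd (B n) 10 t a l s s') = (chain ((par n t).transfer x)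
      ((par n t).R * ((par n t).R * (par n t).R)) a l s s' : ℤ) := by
  obtain ⟨h, h', -⟩ := B_large n
  have := hf.D
  have := hf.cube
  induction l using Nat.strong_induction_on with
  | _ l ih =>
    intro a s s' hl hal hs hs'
    have box : 10 < B n ∧ t < B n ∧ a < B n ∧ l < B n ∧ s < B n ∧ s' < B n :=
      ⟨by omega, by omega, by omega, by omega, by omega, by omega⟩
    rcases Nat.lt_or_ge l 2 with h2 | h2
    · obtain rfl : l = 1 := by omega
      obtain ⟨-, h1, h2, h3⟩ := triple_lt hs
      obtain ⟨-, h1', h2', h3'⟩ := triple_lt hs'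
      rw [X_range hX (by omega) box 2 (by omega)
        (fun k => nd (B n) 7 t ((par n t).entW a k (s / (par n t).R / (par n t).R)
          (s' / (par n t).R / (par n t).R)) 1 0 0) (fun k => nd (B n) 9 t a k s s')
        fun k => by simp [factors], chain_one hs', Par.transfer]
      push_cast
      refine sum_congr rfl fun i hi => ?_
      have hi := mem_range.1 hi
      rw [X_scaled hX ht hf.entries_pos hf.entries_le
        ((par n t).entW_lt_entries (by omega) hi h3 h3').le,
        X_value hX ht hf (by omega) hi hs hs']
    · rw [X_range hX (by omega) box ((par n t).R * ((par n t).R * (par n t).R)) (by omega)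
        (fun k => nd (B n) 10 t a (l / 2) s k)
        (fun k => nd (B n) 10 t (a + l / 2) (l - l / 2) k s')
        fun k => by simp [factors, show ¬ l < 2 by omega]]
      conv_rhs => rw [show l = l / 2 + (l - l / 2) by omega]
      rw [chain_add _ _ _ _ _ hs]
      push_cast
      refine sum_congr rfl fun u hu => ?_
      have hu := mem_range.1 hu
      rw [ih (l / 2) (by omega) a s u (by omega) (by omega) hs hu,
        ih (l - l / 2) (by omega) (a + l / 2) u s' (by omega) (by omega) hu hs']

theorem X_result (hX : (sys n).Solves x X) {t : ℕ} (ht : t < B n) (hf : Fits (par n t) n)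
    (hD : 0 < (par n t).D) : X (nd (B n) 12 t 0 0 0 0) = ((par n t).result x : ℤ) := by
  obtain ⟨h, h', -⟩ := B_large n
  have hR := hf.R
  have hc := hf.cube
  have hpos := hf.pos
  have hpos' := hpos
  unfold Par.posY Par.posX at hpos'
  rw [X_range hX (by omega) ⟨by omega, by omega, by omega, by omega, by omega, by omega⟩
    (par n t).R (by omega) (fun k => nd (B n) 6 t ((par n t).posS + k) 0 0 0)
    (fun k => nd (B n) 11 t k 0 0 0) fun k => by simp [factors], Par.result]
  push_cast
  refine sum_congr rfl fun w hw => ?_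
  have hw := mem_range.1 hw
  rw [X_bit hX ht (by omega), X_range hX (by omega)
    ⟨by omega, by omega, by omega, by omega, by omega, by omega⟩ (par n t).R (by omega)
    (fun k => nd (B n) 6 t ((par n t).posY + k) 0 0 0)
    (fun k => nd (B n) 10 t 0 (par n t).D ((par n t).R * ((par n t).R * w)) k)
    fun k => by simp [factors]]
  congr 1
  refine sum_congr rfl fun y hy => ?_
  have hy := mem_range.1 hy
  have h1 : (par n t).R * ((par n t).R * w) < (par n t).R * ((par n t).R * (par n t).R) := by
    gcongr <;> omega
  have h2 : y < (par n t).R * ((par n t).R * (par n t).R) :=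
    lt_of_lt_of_le hy (Nat.le_mul_of_pos_right _ (Nat.mul_pos (by omega) (by omega)))
  rw [X_bit hX ht (by omega), X_chain hX ht hf _ _ _ _ hD (by omega) h1 h2]

theorem X_common (hX : (sys n).Solves x X) {t : ℕ} (ht : t < B n) (hf : Fits (par n t) n)
    (l : ℕ) : 0 < l → l < B n → X (nd (B n) 13 t l 0 0 0) = ((par n t).common x ^ l : ℕ) := by
  obtain ⟨h, h', -⟩ := B_large n
  have hE := hf.entries_le
  induction l using Nat.strong_induction_on with
  | _ l ih =>
    intro hl hlB
    have box : 13 < B n ∧ t < B n ∧ l < B n ∧ 0 < B n ∧ 0 < B n ∧ 0 < B n :=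
      ⟨by omega, by omega, by omega, by omega, by omega, by omega⟩
    rcases Nat.lt_or_ge l 2 with h2 | h2
    · obtain rfl : l = 1 := by omega
      rw [X_mul hX (by omega) box (nd (B n) 7 t (par n t).entries 1 0 0) (nd (B n) 1 0 0 0 0 0)
        fun k => by simp [factors], X_one hX, X_scaled hX ht hf.entries_pos hE le_rfl,
        scaled_entries]
      simp
    · rw [X_mul hX (by omega) box (nd (B n) 13 t (l / 2) 0 0 0)
        (nd (B n) 13 t (l - l / 2) 0 0 0) fun k => by simp [factors, show ¬ l < 2 by omega],
        ih _ (by omega) (by omega) (by omega), ih _ (by omega) (by omega) (by omega),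
        ← Nat.cast_mul, ← pow_add, show l / 2 + (l - l / 2) = l by omega]

theorem hd_le (n t : ℕ) : (par n t).hd ≤ 5 * n + 5 := by
  obtain ⟨h1, h2, h3, h4, h5⟩ := par_le n t
  unfold Par.hd
  omega

open Classical in
theorem X_match (hX : (sys n).Solves x X) {t : ℕ} (ht : t < B n) :
    X (nd (B n) 15 t 1 0 0 0) = if (par n t).Matches x then 1 else 0 := by
  obtain ⟨h, h', -⟩ := B_large n
  have hhd := hd_le n t
  have hpos : 0 < (par n t).hd := by unfold Par.hd; omega
  have e : X (nd (B n) 15 t 1 0 0 0) = ∏ p ∈ range (par n t).hd,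
      (if x.getD p false = !decide ((par n t).IsEnd p) then 1 else 0 : ZMod (2 ^ (sys n).w)) := by
    rw [prod_heap hpos (fun q => X (nd (B n) 15 t q 0 0 0))]
    · refine prod_congr rfl fun p hp => ?_
      have hp := mem_range.1 hp
      rw [X_mul hX (by omega) ⟨by omega, by omega, by omega, by omega, by omega, by omega⟩
        (nd (B n) 14 t p 0 0 0) (nd (B n) 1 0 0 0 0 0) fun k => by
          simp [factors, show 0 < (par n t).hd + p by omega], X_one hX, mul_one]
      have box : 14 < B n ∧ t < B n ∧ p < B n ∧ 0 < B n ∧ 0 < B n ∧ 0 < B n :=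
        ⟨by omega, by omega, by omega, by omega, by omega, by omega⟩
      by_cases hend : (par n t).IsEnd p
      · rw [X_range hX (by omega) box 2 (by omega)
          (fun k => if k = 0 then nd (B n) 1 0 0 0 0 0 else nd (B n) 2 0 0 0 0 0)
          (fun k => if k = 0 then nd (B n) 1 0 0 0 0 0 else nd (B n) 6 t p 0 0 0)
          fun k => ?_, sum_range_succ, sum_range_one]
        · simp only [if_true, one_ne_zero, if_false]
          rw [X_one hX, X_neg_one hX, X_bit hX ht (by omega)]
          unfold Par.bitAt
          cases x.getD p false <;> simp [hend]
        · rcases k with _ | _ | k <;> simp [factors, hend]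
      · rw [X_mul hX (by omega) box (nd (B n) 6 t p 0 0 0) (nd (B n) 1 0 0 0 0 0) fun k => by
          simp [factors, hend], X_one hX, X_bit hX ht (by omega)]
        unfold Par.bitAt
        cases x.getD p false <;> simp [hend]
    · intro q hq hqE
      refine X_mul hX (by omega) ⟨by omega, by omega, by omega, by omega, by omega, by omega⟩ _ _
        fun k => ?_
      simp [factors, hq, hqE]
  rw [e]
  split_ifs with hm
  · exact prod_eq_one fun p hp => if_pos (hm p (mem_range.1 hp))
  · unfold Par.Matches at hm
    push Not at hm
    obtain ⟨p, hp, hne⟩ := hm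
    exact prod_eq_zero (mem_range.2 hp) (if_neg hne)

theorem unary_unique {f : ℕ → Bool} {o a b : ℕ} (ha : ∀ p < a, f (o + p) = true)
    (ha' : f (o + a) = false) (hb : ∀ p < b, f (o + p) = true) (hb' : f (o + b) = false) :
    a = b := by
  rcases lt_trichotomy a b with h | h | h
  · rw [hb a h] at ha'; cases ha'
  · exact h
  · rw [ha b h] at hb'; cases hb'

theorem matches_unary {P : Par} (h : P.Matches x) :
    ((∀ p < P.D, x.getD (0 + p) false = true) ∧ x.getD (0 + P.D) false = false) ∧
    ((∀ p < P.k, x.getD (P.D + 1 + p) false = true) ∧ x.getD (P.D + 1 + P.k) false = false) ∧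
    ((∀ p < P.N, x.getD (P.D + 1 + P.k + 1 + p) false = true) ∧
      x.getD (P.D + 1 + P.k + 1 + P.N) false = false) ∧
    ((∀ p < P.R, x.getD (P.D + 1 + P.k + 1 + P.N + 1 + p) false = true) ∧
      x.getD (P.D + 1 + P.k + 1 + P.N + 1 + P.R) false = false) ∧
    ((∀ p < P.b, x.getD (P.D + 1 + P.k + 1 + P.N + 1 + P.R + 1 + p) false = true) ∧
      x.getD (P.D + 1 + P.k + 1 + P.N + 1 + P.R + 1 + P.b) false = false) := by
  have ht : ∀ p, p < P.hd → ¬ P.IsEnd p → x.getD p false = true := fun p hp hc => by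
    rw [h p hp]; simp [hc]
  have hf : ∀ p, P.IsEnd p → p < P.hd → x.getD p false = false := fun p hc hp => by
    rw [h p hp]; simp [hc]
  unfold Par.IsEnd Par.hd at *
  refine ⟨⟨fun p hp => ht _ ?_ ?_, hf _ ?_ ?_⟩, ⟨fun p hp => ht _ ?_ ?_, hf _ ?_ ?_⟩,
    ⟨fun p hp => ht _ ?_ ?_, hf _ ?_ ?_⟩, ⟨fun p hp => ht _ ?_ ?_, hf _ ?_ ?_⟩,
    ⟨fun p hp => ht _ ?_ ?_, hf _ ?_ ?_⟩⟩ <;> omega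

theorem matches_unique {P Q : Par} (hP : P.Matches x) (hQ : Q.Matches x) : P = Q := by
  obtain ⟨⟨a1, b1⟩, ⟨a2, b2⟩, ⟨a3, b3⟩, ⟨a4, b4⟩, ⟨a5, b5⟩⟩ := matches_unary hP
  obtain ⟨⟨c1, d1⟩, ⟨c2, d2⟩, ⟨c3, d3⟩, ⟨c4, d4⟩, ⟨c5, d5⟩⟩ := matches_unary hQ
  obtain ⟨D, k, N, R, b⟩ := P
  obtain ⟨D', k', N', R', b'⟩ := Q
  simp only at *
  obtain rfl := unary_unique (f := fun p => x.getD p false) a1 b1 c1 d1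
  obtain rfl := unary_unique (f := fun p => x.getD p false) a2 b2 c2 d2
  obtain rfl := unary_unique (f := fun p => x.getD p false) a3 b3 c3 d3
  obtain rfl := unary_unique (f := fun p => x.getD p false) a4 b4 c4 d4
  obtain rfl := unary_unique (f := fun p => x.getD p false) a5 b5 c5 d5
  rfl

/-- The number of a candidate for the size parameters. -/
def candidate (n : ℕ) (P : Par) : ℕ :=
  P.D + (n + 1) * (P.k + (n + 1) * (P.N + (n + 1) * (P.R + (n + 1) * P.b)))

theorem candidate_par {n t : ℕ} (ht : t < (n + 1) ^ 5) : candidate n (par n t) = t := by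
  have h4 : t / (n + 1) ^ 4 % (n + 1) = t / (n + 1) ^ 4 := by
    apply Nat.mod_eq_of_lt
    rw [Nat.div_lt_iff_lt_mul (by positivity), ← pow_succ']
    exact ht
  have e : ∀ i, t / (n + 1) ^ i % (n + 1) + (n + 1) * (t / (n + 1) ^ (i + 1)) =
      t / (n + 1) ^ i := by
    intro i
    rw [pow_succ, ← Nat.div_div_eq_div_mul]
    exact Nat.mod_add_div _ _
  have e0 := e 0
  have e1 := e 1
  have e2 := e 2
  have e3 := e 3
  simp only [pow_zero, Nat.div_one, zero_add, pow_one, Nat.reduceAdd] at e0 e1 e2 e3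
  unfold candidate par
  simp only
  rw [h4, e3, e2, e1, e0]

theorem par_candidate {n : ℕ} {P : Par} (hD : P.D ≤ n) (hk : P.k ≤ n) (hN : P.N ≤ n)
    (hR : P.R ≤ n) (hb : P.b ≤ n) :
    par n (candidate n P) = P ∧ candidate n P < (n + 1) ^ 5 := by
  have hM : ∀ a b, a ≤ n → (a + (n + 1) * b) % (n + 1) = a := fun a b ha => by
    rw [Nat.add_mul_mod_self_left, Nat.mod_eq_of_lt (by omega)]
  have hDv : ∀ a b, a ≤ n → (a + (n + 1) * b) / (n + 1) = b := fun a b ha => by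
    rw [Nat.add_mul_div_left _ _ (by omega), Nat.div_eq_of_lt (by omega), zero_add]
  have step : ∀ a b k, a ≤ n → b < (n + 1) ^ k → a + (n + 1) * b < (n + 1) ^ (k + 1) := by
    intro a b k ha hb
    calc a + (n + 1) * b < (n + 1) + (n + 1) * b := by omega
      _ = (n + 1) * (b + 1) := by ring
      _ ≤ (n + 1) * (n + 1) ^ k := Nat.mul_le_mul_left _ hb
      _ = (n + 1) ^ (k + 1) := by ring
  constructor
  · obtain ⟨D, k, N, R, b⟩ := P
    have p2 : (n + 1) ^ 2 = (n + 1) * (n + 1) := by ring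
    have p3 : (n + 1) ^ 3 = (n + 1) * ((n + 1) * (n + 1)) := by ring
    have p4 : (n + 1) ^ 4 = (n + 1) * ((n + 1) * ((n + 1) * (n + 1))) := by ring
    simp only [par, candidate, Par.mk.injEq] at *
    rw [p2, p3, p4]
    simp only [← Nat.div_div_eq_div_mul]
    rw [hM _ _ hD, hDv _ _ hD, hM _ _ hk, hDv _ _ hk, hM _ _ hN, hDv _ _ hN, hM _ _ hR,
      hDv _ _ hR, Nat.mod_eq_of_lt (by omega)]
    simp
  · exact step _ _ 4 hD (step _ _ 3 hk (step _ _ 2 hN (step _ _ 1 hR (by simpa using by omega))))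

/-- The words that hold the result. -/
theorem X_final (hX : (sys n).Solves x X) {P : Par} (hf : Fits P n) (hk : P.k ≤ n) (hb : P.b ≤ n)
    (hD : 0 < P.D) (hm : P.Matches x) :
    X (sys n).num = (P.result x : ℤ) ∧ X (sys n).neg = -((P.result x : ℤ) : ZMod _) ∧
      X (sys n).den = (P.common x ^ (3 * P.D) : ℕ) := by
  obtain ⟨h, h', h5⟩ := B_large n
  obtain ⟨hpar, hcand⟩ := par_candidate hf.D hk hf.N hf.R hb
  have hfD := hf.D
  have hsel : ∀ y : ℕ → ZMod (2 ^ (sys n).w),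
      ∑ t ∈ range ((n + 1) ^ 5), X (nd (B n) 15 t 1 0 0 0) * y t = y (candidate n P) := by
    intro y
    rw [sum_eq_single_of_mem (candidate n P) (mem_range.2 hcand)]
    · rw [X_match hX (by omega), hpar, if_pos hm, one_mul]
    · intro t ht hne
      have ht := mem_range.1 ht
      rw [X_match hX (by omega), if_neg, zero_mul]
      intro hm'
      apply hne
      rw [← candidate_par ht, matches_unique hm' hm]
  have hnum : X (sys n).num = (P.result x : ℤ) := by
    change X (nd (B n) 16 0 0 0 0 0) = _
    rw [X_range hX (by omega) ⟨by omega, by omega, by omega, by omega, by omega, by omega⟩ _ h5.le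
      (fun k => nd (B n) 15 k 1 0 0 0) (fun k => nd (B n) 12 k 0 0 0 0)
      fun k => by simp [factors], hsel fun t => X (nd (B n) 12 t 0 0 0 0),
      X_result hX (by omega) (by rwa [hpar]) (by rwa [hpar]), hpar]
  refine ⟨hnum, ?_, ?_⟩
  · change X (nd (B n) 17 0 0 0 0 0) = _
    rw [X_mul hX (by omega) ⟨by omega, by omega, by omega, by omega, by omega, by omega⟩
      (nd (B n) 2 0 0 0 0 0) (nd (B n) 16 0 0 0 0 0) fun k => by simp [factors], X_neg_one hX]
    change -1 * X (sys n).num = _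
    rw [hnum, neg_one_mul]
  · change X (nd (B n) 16 0 1 0 0 0) = _
    rw [X_range hX (by omega) ⟨by omega, by omega, by omega, by omega, by omega, by omega⟩ _ h5.le
      (fun k => nd (B n) 15 k 1 0 0 0) (fun k => nd (B n) 13 k (3 * (par n k).D) 0 0 0)
      fun k => by simp [factors], hsel fun t => X (nd (B n) 13 t (3 * (par n t).D) 0 0 0),
      X_common hX (by omega) (by rwa [hpar]) _ (by rw [hpar]; omega) (by rw [hpar]; omega), hpar]

end Prog

end ITSHAP

namespace ITSHAP

open Finset

/-! ### Positions in the code of an instance -/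

theorem getD_append_add {A B : List Bool} {o : ℕ} (h : A.length = o) (p : ℕ) :
    (A ++ B).getD (o + p) false = B.getD p false := by
  subst h
  simp [List.getD, List.getElem?_append_right]

theorem getD_append_lt {A B : List Bool} {p : ℕ} (h : p < A.length) :
    (A ++ B).getD p false = A.getD p false := by
  simp [List.getD, List.getElem?_append_left h]

theorem length_flatMap_range {a L : ℕ} {f : ℕ → List Bool} (h : ∀ j < a, (f j).length = L) :
    ((List.range a).flatMap f).length = a * L := by
  induction a with
  | zero => simp
  | succ a ih =>
    rw [List.range_succ, List.flatMap_append, List.length_append,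
      ih fun j hj => h j (by omega), List.flatMap_singleton, h a (by omega), add_mul, one_mul]

theorem getD_flatMap_range {a L : ℕ} {f : ℕ → List Bool} (h : ∀ j < a, (f j).length = L)
    {j r : ℕ} (hj : j < a) (hr : r < L) :
    ((List.range a).flatMap f).getD (j * L + r) false = (f j).getD r false := by
  induction a with
  | zero => omega
  | succ a ih =>
    have hlen := length_flatMap_range (a := a) fun j hj => h j (Nat.lt_succ_of_lt hj)
    rw [List.range_succ, List.flatMap_append, List.flatMap_singleton]
    rcases Nat.lt_or_ge j a with h1 | h1
    · rw [getD_append_lt, ih (fun j hj => h j (by omega)) h1]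
      rw [hlen]
      calc j * L + r < (j + 1) * L := by rw [add_mul]; omega
        _ ≤ _ := Nat.mul_le_mul_right _ h1
    · obtain rfl : j = a := by omega
      exact getD_append_add hlen r

theorem flatMap_finRange {D : ℕ} (f : Fin D → List Bool) :
    (List.finRange D).flatMap f =
      (List.range D).flatMap fun j => if h : j < D then f ⟨j, h⟩ else [] := by
  rw [← List.map_coe_finRange_eq_range, List.flatMap_map]
  simp

theorem length_unary (a : ℕ) : (unary a).length = a + 1 := by simp [unary]

theorem getD_unary {a p : ℕ} (hp : p < a + 1) : (unary a).getD p false = !decide (p = a) := by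
  unfold unary
  rcases Nat.lt_or_ge p a with h | h
  · rw [getD_append_lt (by simpa using h)]
    simp [List.getD, h, h.ne]
  · obtain rfl : p = a := by omega
    simp

theorem length_oneHot (w i : ℕ) : (oneHot w i).length = w := by simp [oneHot]

theorem getD_oneHot {w i p : ℕ} (hp : p < w) : (oneHot w i).getD p false = decide (p = i) := by
  simp [oneHot, List.getD, hp]

theorem length_binary (w v : ℕ) : (binary w v).length = w := by simp [binary]

theorem getD_binary {w v p : ℕ} (hp : p < w) : (binary w v).getD p false = v.testBit p := by
  simp [binary, List.getD, hp]

theorem length_encodeRat (b : ℕ) (q : ℚ) : (encodeRat b q).length = 2 * b + 1 := by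
  simp [encodeRat, length_binary]; omega

theorem getD_encodeRat (b : ℕ) (q : ℚ) :
    (encodeRat b q).getD 0 false = decide (q < 0) ∧
    (∀ i < b, (encodeRat b q).getD (1 + i) false = q.num.natAbs.testBit i) ∧
    ∀ i < b, (encodeRat b q).getD (1 + b + i) false = q.den.testBit i := by
  have e : encodeRat b q = [decide (q < 0)] ++ (binary b q.num.natAbs ++ binary b q.den) := rfl
  refine ⟨by simp [encodeRat], fun i hi => ?_, fun i hi => ?_⟩
  · rw [e, getD_append_add (by simp), getD_append_lt (by simpa [length_binary]), getD_binary hi]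
  · rw [e, add_assoc, getD_append_add (by simp), getD_append_add (length_binary _ _),
      getD_binary hi]

theorem sum_testBit (b v : ℕ) : ∑ i ∈ range b, 2 ^ i * (v.testBit i).toNat = v % 2 ^ b := by
  induction b with
  | zero => simp [Nat.mod_one]
  | succ b ih => rw [sum_range_succ, ih, Nat.mod_pow_succ, Nat.toNat_testBit]

namespace TT

variable {D : ℕ} {n : Fin D → ℕ} {a b : ℕ} (t : TT (fun j => Fin (n j)) a b ℚ)

theorem length_encode (N R w : ℕ) : (t.encode N R w).length = D * N * R * R * (2 * w + 1) := by
  rw [encode, length_flatMap_range (L := N * (R * (R * (2 * w + 1))))]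
  · ring
  intro j _
  rw [length_flatMap_range (L := R * (R * (2 * w + 1)))]
  intro i _
  rw [length_flatMap_range (L := R * (2 * w + 1))]
  intro u _
  rw [length_flatMap_range]
  exact fun v _ => length_encodeRat _ _

theorem getD_encode {N R w j i u v r : ℕ} (hj : j < D) (hi : i < N) (hu : u < R) (hv : v < R)
    (hr : r < 2 * w + 1) :
    (t.encode N R w).getD ((((j * N + i) * R + u) * R + v) * (2 * w + 1) + r) false =
      (encodeRat w (t.entry j i u v)).getD r false := by
  have l4 : ∀ j i u v, (encodeRat w (t.entry j i u v)).length = 2 * w + 1 :=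
    fun _ _ _ _ => length_encodeRat _ _
  have l3 : ∀ j i u, ((List.range R).flatMap fun v => encodeRat w (t.entry j i u v)).length =
    R * (2 * w + 1) := fun j i u => length_flatMap_range fun v _ => l4 j i u v
  have l2 : ∀ j i, ((List.range R).flatMap fun u => (List.range R).flatMap fun v =>
    encodeRat w (t.entry j i u v)).length = R * (R * (2 * w + 1)) :=
    fun j i => length_flatMap_range fun u _ => l3 j i u
  have l1 : ∀ j, ((List.range N).flatMap fun i => (List.range R).flatMap fun u =>
    (List.range R).flatMap fun v => encodeRat w (t.entry j i u v)).length =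
      N * (R * (R * (2 * w + 1))) := fun j => length_flatMap_range fun i _ => l2 j i
  have step : ∀ {a b c d : ℕ}, a < b → c < d → a * d + c < b * d := fun {a b c d} h1 h2 => by
    calc a * d + c < (a + 1) * d := by rw [add_mul]; omega
      _ ≤ b * d := Nat.mul_le_mul_right _ h1
  have e : (((j * N + i) * R + u) * R + v) * (2 * w + 1) + r = j * (N * (R * (R * (2 * w + 1)))) +
      (i * (R * (R * (2 * w + 1))) + (u * (R * (2 * w + 1)) + (v * (2 * w + 1) + r))) := by ring
  rw [encode, e, getD_flatMap_range (fun j _ => l1 j) hj (step hi (step hu (step hv hr))),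
    getD_flatMap_range (fun i _ => l2 j i) hi (step hu (step hv hr)),
    getD_flatMap_range (fun u _ => l3 j i u) hu (step hv hr),
    getD_flatMap_range (fun v _ => l4 j i u v) hv hr]

theorem entry_lt {w : ℕ} (hw : 1 ≤ w) (ht : t.bits ≤ w) (j i u v : ℕ) :
    (t.entry j i u v).num.natAbs < 2 ^ w ∧ (t.entry j i u v).den < 2 ^ w := by
  have h0 : (0 : ℚ).num.natAbs < 2 ^ w ∧ (0 : ℚ).den < 2 ^ w := by
    have : 2 ^ 1 ≤ 2 ^ w := Nat.pow_le_pow_right (by omega) hw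
    simp only [Rat.num_ofNat, Rat.den_ofNat, Int.natAbs_zero]
    omega
  unfold entry
  split_ifs with hj h
  · have hb : ∀ (j : Fin D) (i : Fin (n j)) (u : Fin (t.d j.castSucc)) (v : Fin (t.d j.succ)),
        max (t.core j i u v).num.natAbs.size (t.core j i u v).den.size ≤ w := by
      intro j i u v
      refine le_trans ?_ ht
      refine le_trans ?_ (le_sup (f := fun j => univ.sup fun i => univ.sup fun u =>
        univ.sup fun v => max (t.core j i u v).num.natAbs.size (t.core j i u v).den.size)
        (mem_univ j))
      refine le_trans ?_ (le_sup (f := fun i => univ.sup fun u =>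
        univ.sup fun v => max (t.core j i u v).num.natAbs.size (t.core j i u v).den.size)
        (mem_univ i))
      refine le_trans ?_ (le_sup (f := fun u =>
        univ.sup fun v => max (t.core j i u v).num.natAbs.size (t.core j i u v).den.size)
        (mem_univ u))
      exact le_sup (f := fun v => max (t.core j i u v).num.natAbs.size
        (t.core j i u v).den.size) (mem_univ v)
    have := hb ⟨j, hj⟩ ⟨i, h.1⟩ ⟨u, h.2.1⟩ ⟨v, h.2.2⟩
    exact ⟨Nat.size_le.1 ((le_max_left _ _).trans this),
      Nat.size_le.1 ((le_max_right _ _).trans this)⟩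
  · exact h0
  · exact h0

end TT

namespace Instance

variable (I : Instance)

/-- The size parameters of an instance. -/
def toPar : Par := ⟨I.D, I.k, I.maxMode, I.maxBond, I.bits⟩

/-- The part of the code of an instance that contains the size parameters. -/
def header : List Bool :=
  unary I.D ++ (unary I.k ++ (unary I.maxMode ++ (unary I.maxBond ++ unary I.bits)))

theorem length_header : I.header.length = I.toPar.hd := by
  simp [header, length_unary, Par.hd, toPar]
  omega

/-- The part of the code of an instance that is not used in the computation. -/
def trailer : List Bool :=
  (List.finRange I.m).flatMap (fun a => (List.finRange I.D).map fun j => decide (j ∈ I.sets a)) ++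
  ((List.finRange I.D).flatMap (fun j => unary (I.N j)) ++
  (List.finRange (I.D + 1)).flatMap
    (fun j => unary (I.model.d j) ++ unary (I.dist.d j) ++ unary (I.weight.d j)))

/-- The code of the explained input. -/
def inputCode : List Bool := (List.finRange I.D).flatMap fun j => oneHot I.maxMode (I.x j)

theorem encode_eq : I.encode = I.header ++ (I.model.encode I.maxMode I.maxBond I.bits ++
    (I.dist.encode I.maxMode I.maxBond I.bits ++ (I.weight.encode 2 I.maxBond I.bits ++
    (oneHot I.maxBond I.s ++ (I.inputCode ++ (oneHot I.maxBond I.y ++ I.trailer)))))) := by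
  simp only [encode, header, trailer, inputCode, List.append_assoc]

theorem length_inputCode : I.inputCode.length = I.D * I.maxMode := by
  rw [inputCode, flatMap_finRange, length_flatMap_range]
  intro j hj
  rw [dif_pos hj, length_oneHot]

theorem getD_inputCode {j i : ℕ} (hj : j < I.D) (hi : i < I.maxMode) :
    I.inputCode.getD (j * I.maxMode + i) false = decide (i = I.x ⟨j, hj⟩) := by
  rw [inputCode, flatMap_finRange, getD_flatMap_range _ hj hi, dif_pos hj, getD_oneHot hi]
  intro j hj
  rw [dif_pos hj, length_oneHot]

theorem matches_encode : I.toPar.Matches I.encode := by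
  intro p hp
  have hl := I.length_header
  rw [encode_eq, getD_append_lt (by omega)]
  unfold Par.hd Par.IsEnd at *
  simp only [toPar] at *
  unfold header
  rcases Nat.lt_or_ge p (I.D + 1) with h | h
  · rw [getD_append_lt (by rwa [length_unary]), getD_unary h]
    congr 2
    exact propext ⟨fun h => by omega, fun h => by omega⟩
  obtain ⟨p, rfl⟩ := Nat.exists_eq_add_of_le h
  rw [getD_append_add (length_unary _)]
  rcases Nat.lt_or_ge p (I.k + 1) with h | h
  · rw [getD_append_lt (by rwa [length_unary]), getD_unary h]
    congr 2
    exact propext ⟨fun h => by omega, fun h => by omega⟩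
  obtain ⟨p, rfl⟩ := Nat.exists_eq_add_of_le h
  rw [getD_append_add (length_unary _)]
  rcases Nat.lt_or_ge p (I.maxMode + 1) with h | h
  · rw [getD_append_lt (by rwa [length_unary]), getD_unary h]
    congr 2
    exact propext ⟨fun h => by omega, fun h => by omega⟩
  obtain ⟨p, rfl⟩ := Nat.exists_eq_add_of_le h
  rw [getD_append_add (length_unary _)]
  rcases Nat.lt_or_ge p (I.maxBond + 1) with h | h
  · rw [getD_append_lt (by rwa [length_unary]), getD_unary h]
    congr 2
    exact propext ⟨fun h => by omega, fun h => by omega⟩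
  obtain ⟨p, rfl⟩ := Nat.exists_eq_add_of_le h
  rw [getD_append_add (length_unary _), getD_unary (by omega)]
  congr 2
  exact propext ⟨fun h => by omega, fun h => by omega⟩

theorem posS_eq : I.toPar.posS = I.toPar.hd + (I.D * I.maxMode * I.maxBond * I.maxBond *
    (2 * I.bits + 1) + (I.D * I.maxMode * I.maxBond * I.maxBond * (2 * I.bits + 1) +
      I.D * 2 * I.maxBond * I.maxBond * (2 * I.bits + 1))) := by
  simp only [Par.posS, Par.ent, Par.entries, Par.block, toPar]
  ring

theorem bitAt_posS {w : ℕ} (hw : w < I.maxBond) :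
    Par.bitAt I.encode (I.toPar.posS + w) = if w = I.s then 1 else 0 := by
  unfold Par.bitAt
  rw [posS_eq, encode_eq, add_assoc, add_assoc, add_assoc, getD_append_add I.length_header,
    getD_append_add (TT.length_encode _ _ _ _), getD_append_add (TT.length_encode _ _ _ _),
    getD_append_add (TT.length_encode _ _ _ _), getD_append_lt (by rwa [length_oneHot]),
    getD_oneHot hw]
  split_ifs with h <;> simp [h]

theorem bitAt_posX {j i : ℕ} (hj : j < I.D) (hi : i < I.maxMode) :
    Par.bitAt I.encode (I.toPar.posX + (j * I.toPar.N + i)) =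
      if i = I.x ⟨j, hj⟩ then 1 else 0 := by
  have e : I.toPar.posX + (j * I.toPar.N + i) =
      I.toPar.posS + (I.maxBond + (j * I.maxMode + i)) := by
    simp only [Par.posX, toPar]; ring
  unfold Par.bitAt
  rw [e, posS_eq, encode_eq, add_assoc, add_assoc, add_assoc, getD_append_add I.length_header,
    getD_append_add (TT.length_encode _ _ _ _), getD_append_add (TT.length_encode _ _ _ _),
    getD_append_add (TT.length_encode _ _ _ _), getD_append_add (length_oneHot _ _),
    getD_append_lt, getD_inputCode I hj hi]
  · split_ifs with h <;> simp [h]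
  · rw [length_inputCode]
    calc j * I.maxMode + i < (j + 1) * I.maxMode := by rw [add_mul]; omega
      _ ≤ _ := Nat.mul_le_mul_right _ hj

theorem bitAt_posY {y : ℕ} (hy : y < I.maxBond) :
    Par.bitAt I.encode (I.toPar.posY + y) = if y = I.y then 1 else 0 := by
  have e : I.toPar.posY + y = I.toPar.posS + (I.maxBond + (I.D * I.maxMode + y)) := by
    simp only [Par.posY, Par.posX, toPar]; ring
  unfold Par.bitAt
  rw [e, posS_eq, encode_eq, add_assoc, add_assoc, add_assoc, getD_append_add I.length_header,
    getD_append_add (TT.length_encode _ _ _ _), getD_append_add (TT.length_encode _ _ _ _),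
    getD_append_add (TT.length_encode _ _ _ _), getD_append_add (length_oneHot _ _),
    getD_append_add I.length_inputCode, getD_append_lt (by rwa [length_oneHot]), getD_oneHot hy]
  split_ifs with h <;> simp [h]

/-- The code of `q` is found at the position of entry `e`. -/
def HasEntry (e : ℕ) (q : ℚ) : Prop :=
  I.toPar.sgnAt I.encode e * I.toPar.numAt I.encode e = q.num ∧ I.toPar.denAt I.encode e = q.den

theorem hasEntry_of_getD {e : ℕ} {q : ℚ}
    (h : ∀ r < 2 * I.bits + 1, I.encode.getD (I.toPar.ent e + r) false =
      (encodeRat I.bits q).getD r false)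
    (hq : q.num.natAbs < 2 ^ I.bits ∧ q.den < 2 ^ I.bits) : I.HasEntry e q := by
  obtain ⟨h0, h1, h2⟩ := getD_encodeRat I.bits q
  have hb : I.toPar.b = I.bits := rfl
  have hnum : I.toPar.numAt I.encode e = q.num.natAbs := by
    rw [Par.numAt, hb, ← Nat.mod_eq_of_lt hq.1, ← sum_testBit]
    refine sum_congr rfl fun i hi => ?_
    have hi := mem_range.1 hi
    rw [add_assoc, h _ (by omega), h1 i hi]
  have hden : I.toPar.denAt I.encode e = q.den := by
    rw [Par.denAt, hb, ← Nat.mod_eq_of_lt hq.2, ← sum_testBit]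
    refine sum_congr rfl fun i hi => ?_
    have hi := mem_range.1 hi
    rw [show I.toPar.ent e + 1 + I.bits + i = I.toPar.ent e + (1 + I.bits + i) by ring,
      h _ (by omega), h2 i hi]
  refine ⟨?_, hden⟩
  rw [hnum, Par.sgnAt]
  have := h 0 (by omega)
  rw [add_zero, h0] at this
  rw [this]
  by_cases hneg : q < 0
  · have : q.num < 0 := Rat.num_neg.2 hneg
    simp [hneg, abs_of_neg this]
  · have : 0 ≤ q.num := Rat.num_nonneg.2 (not_lt.1 hneg)
    simp [hneg, abs_of_nonneg this]

theorem bits_le : 1 ≤ I.bits ∧ I.model.bits ≤ I.bits ∧ I.dist.bits ≤ I.bits ∧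
    I.weight.bits ≤ I.bits := by
  unfold bits
  omega

theorem mul_add_lt {a b c d : ℕ} (h1 : a < b) (h2 : c < d) : a * d + c < b * d := by
  calc a * d + c < (a + 1) * d := by rw [add_mul]; omega
    _ ≤ b * d := Nat.mul_le_mul_right _ h1

theorem hasEntry_model {j i u v : ℕ} (hj : j < I.D) (hi : i < I.maxMode) (hu : u < I.maxBond)
    (hv : v < I.maxBond) : I.HasEntry (I.toPar.entM j i u v) (I.model.entry j i u v) := by
  refine I.hasEntry_of_getD (fun r hr => ?_) (TT.entry_lt _ I.bits_le.1 I.bits_le.2.1 _ _ _ _)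
  rw [← TT.getD_encode _ hj hi hu hv hr, encode_eq, Par.ent, add_assoc,
    getD_append_add I.length_header]
  refine getD_append_lt ?_
  rw [TT.length_encode]
  exact mul_add_lt (mul_add_lt (mul_add_lt (mul_add_lt hj hi) hu) hv) hr

theorem hasEntry_dist {j i u v : ℕ} (hj : j < I.D) (hi : i < I.maxMode) (hu : u < I.maxBond)
    (hv : v < I.maxBond) : I.HasEntry (I.toPar.entP j i u v) (I.dist.entry j i u v) := by
  refine I.hasEntry_of_getD (fun r hr => ?_) (TT.entry_lt _ I.bits_le.1 I.bits_le.2.2.1 _ _ _ _)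
  have e : I.toPar.ent (I.toPar.entP j i u v) + r = I.toPar.hd +
      (I.D * I.maxMode * I.maxBond * I.maxBond * (2 * I.bits + 1) +
      ((((j * I.maxMode + i) * I.maxBond + u) * I.maxBond + v) * (2 * I.bits + 1) + r)) := by
    simp only [Par.ent, Par.entP, Par.entM, Par.block, toPar]; ring
  rw [← TT.getD_encode _ hj hi hu hv hr, encode_eq, e, getD_append_add I.length_header,
    getD_append_add (TT.length_encode _ _ _ _)]
  refine getD_append_lt ?_
  rw [TT.length_encode]
  exact mul_add_lt (mul_add_lt (mul_add_lt (mul_add_lt hj hi) hu) hv) hr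

theorem hasEntry_weight {j i u v : ℕ} (hj : j < I.D) (hi : i < 2) (hu : u < I.maxBond)
    (hv : v < I.maxBond) : I.HasEntry (I.toPar.entW j i u v) (I.weight.entry j i u v) := by
  refine I.hasEntry_of_getD (fun r hr => ?_) (TT.entry_lt _ I.bits_le.1 I.bits_le.2.2.2 _ _ _ _)
  have e : I.toPar.ent (I.toPar.entW j i u v) + r = I.toPar.hd +
      (I.D * I.maxMode * I.maxBond * I.maxBond * (2 * I.bits + 1) +
      (I.D * I.maxMode * I.maxBond * I.maxBond * (2 * I.bits + 1) +
      ((((j * 2 + i) * I.maxBond + u) * I.maxBond + v) * (2 * I.bits + 1) + r))) := by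
    simp only [Par.ent, Par.entW, Par.block, toPar]; ring
  rw [← TT.getD_encode _ hj hi hu hv hr, encode_eq, e, getD_append_add I.length_header,
    getD_append_add (TT.length_encode _ _ _ _), getD_append_add (TT.length_encode _ _ _ _)]
  refine getD_append_lt ?_
  rw [TT.length_encode]
  exact mul_add_lt (mul_add_lt (mul_add_lt (mul_add_lt hj hi) hu) hv) hr

theorem exists_digits {D N R r : ℕ} (h : r < D * N * R * R) :
    ∃ j < D, ∃ i < N, ∃ u < R, ∃ v < R, r = ((j * N + i) * R + u) * R + v := by
  have split : ∀ {a b r : ℕ}, r < a * b → ∃ y < a, ∃ z < b, r = y * b + z := by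
    intro a b r h
    have hb : 0 < b := Nat.pos_of_ne_zero fun h0 => by simp [h0] at h
    exact ⟨r / b, (Nat.div_lt_iff_lt_mul hb).2 h, r % b, Nat.mod_lt _ hb,
      (Nat.div_add_mod' r b).symm⟩
  obtain ⟨r1, h1, v, hv, rfl⟩ := split h
  obtain ⟨r2, h2, u, hu, rfl⟩ := split h1
  obtain ⟨j, hj, i, hi, rfl⟩ := split h2
  exact ⟨j, hj, i, hi, u, hu, v, hv, rfl⟩

theorem denAt_pos_lt {r : ℕ} (hr : r < I.toPar.entries) :
    0 < I.toPar.denAt I.encode r := by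
  have hblock : I.toPar.block = I.D * I.maxMode * I.maxBond * I.maxBond := rfl
  have hE : I.toPar.entries = I.toPar.block + I.toPar.block +
    I.D * 2 * I.maxBond * I.maxBond := rfl
  have key : ∃ q, I.HasEntry r q := by
    rcases Nat.lt_or_ge r I.toPar.block with h | h
    · rw [hblock] at h
      obtain ⟨j, hj, i, hi, u, hu, v, hv, rfl⟩ := exists_digits h
      exact ⟨_, I.hasEntry_model hj hi hu hv⟩
    obtain ⟨r, rfl⟩ := Nat.exists_eq_add_of_le h
    rcases Nat.lt_or_ge r I.toPar.block with h' | h'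
    · rw [hblock] at h'
      obtain ⟨j, hj, i, hi, u, hu, v, hv, rfl⟩ := exists_digits h'
      exact ⟨_, I.hasEntry_dist hj hi hu hv⟩
    obtain ⟨r, rfl⟩ := Nat.exists_eq_add_of_le h'
    have h'' : r < I.D * 2 * I.maxBond * I.maxBond := by omega
    obtain ⟨j, hj, i, hi, u, hu, v, hv, rfl⟩ := exists_digits h''
    have := I.hasEntry_weight hj hi hu hv
    rw [Par.entW, add_assoc] at this
    exact ⟨_, this⟩
  obtain ⟨q, -, hq⟩ := key
  rw [hq]
  exact q.pos

theorem scaled_eq {e : ℕ} {q : ℚ} (he : e < I.toPar.entries) (h : I.HasEntry e q) :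
    ((I.toPar.scaled I.encode e : ℤ) : ℚ) = I.toPar.common I.encode * q := by
  have hmem : e ∈ range I.toPar.entries := mem_range.2 he
  rw [Par.scaled, Par.common, ← mul_prod_erase _ _ hmem, ← mul_prod_erase _ _ hmem, if_pos rfl,
    h.1, h.2, prod_congr rfl fun r hr => if_neg (ne_of_mem_erase hr)]
  push_cast
  have : (q.den : ℚ) ≠ 0 := by exact_mod_cast q.den_ne_zero
  have hq : (q.num : ℚ) = q.den * q := by rw [mul_comm, Rat.mul_den_eq_num]
  rw [hq]
  ring

theorem common_pos : 0 < I.toPar.common I.encode :=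
  prod_pos fun _ hr => I.denAt_pos_lt (mem_range.1 hr)

theorem maxBond_pos : 0 < I.maxBond := by
  have h := le_sup (f := fun j => max (I.model.d j) (max (I.dist.d j) (I.weight.d j)))
    (mem_univ (0 : Fin (I.D + 1)))
  have := I.model.left
  have h' : max (I.model.d 0) (max (I.dist.d 0) (I.weight.d 0)) ≤ I.maxBond := h
  omega

theorem N_le (j : Fin I.D) : I.N j ≤ I.maxMode := le_sup (f := I.N) (mem_univ j)

theorem fits (hD : 0 < I.D) : Prog.Fits I.toPar I.encode.length ∧
    I.toPar.k ≤ I.encode.length ∧ I.toPar.b ≤ I.encode.length := by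
  have hlen : I.toPar.posY + I.maxBond ≤ I.encode.length := by
    rw [Par.posY, Par.posX, posS_eq, encode_eq]
    simp only [List.length_append, length_header, TT.length_encode, length_oneHot,
      length_inputCode]
    simp only [toPar]
    omega
  have hhd : I.toPar.hd ≤ I.toPar.posY := by
    unfold Par.posY Par.posX Par.posS Par.ent
    omega
  have hN : 0 < I.maxMode := lt_of_lt_of_le ((Nat.zero_le _).trans_lt (I.x ⟨0, hD⟩).isLt)
    (I.N_le ⟨0, hD⟩)
  have hR := I.maxBond_pos
  have hE : 0 < I.toPar.entries := by
    have : 0 < I.D * I.maxMode * I.maxBond * I.maxBond := by positivity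
    have hblock : I.toPar.block = I.D * I.maxMode * I.maxBond * I.maxBond := rfl
    unfold Par.entries
    omega
  unfold Par.hd at hhd
  exact ⟨⟨by omega, by omega, by omega, hE, hlen⟩, by omega, by omega⟩

end Instance

end ITSHAP

namespace ITSHAP

open Finset

/-! ### Operations on tensor trains -/

theorem sum_paths_eq_chain {K : Type} [CommRing K] (A : ℕ → ℕ → ℕ → K) (m D : ℕ) :
    ∀ (a l r : ℕ), l < m → r < m →
    (∑ p : Fin (D + 1) → Fin m, if (p 0 : ℕ) = l ∧ (p (Fin.last D) : ℕ) = r then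
      ∏ j : Fin D, A (a + j) (p j.castSucc) (p j.succ) else 0) = chain A m a D l r := by
  induction D with
  | zero =>
    intro a l r hl hr
    rw [← (Equiv.funUnique (Fin 1) (Fin m)).symm.sum_comp, sum_eq_single ⟨l, hl⟩]
    · simp [chain]
    · intro b _ hb
      have : (b : ℕ) ≠ l := fun h => hb (Fin.ext h)
      simp [this]
    · simp
  | succ D ih =>
    intro a l r hl hr
    rw [← (Fin.consEquiv fun _ : Fin (D + 2) => Fin m).sum_comp, Fintype.sum_prod_type,
      sum_eq_single ⟨l, hl⟩]
    · rw [chain, sum_range]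
      simp only [← ih (a + 1) _ r (Fin.is_lt _) hr, mul_sum]
      rw [sum_comm]
      refine sum_congr rfl fun p _ => ?_
      rw [sum_eq_single (p 0)]
      · simp only [Fin.consEquiv_apply, Fin.cons_zero, ← Fin.succ_last, Fin.cons_succ, true_and,
          mul_ite, mul_zero]
        rw [Fin.prod_univ_succ]
        simp [add_comm, add_left_comm]
      · intro u _ hu
        have : (p 0 : ℕ) ≠ u := fun h => hu (Fin.ext h.symm)
        simp [this]
      · simp
    · intro b _ hb
      have : (b : ℕ) ≠ l := fun h => hb (Fin.ext h)
      simp [this]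
    · simp

namespace TT

variable {D : ℕ} {ι ι₁ ι₂ σ : Fin D → Type} {a b a₁ b₁ a₂ b₂ : ℕ} {K : Type} [Field K]

/-- The contraction of two tensor trains: at every site, the product of the two cores is summed
over a shared index of type `σ j`. -/
def contract [∀ j, Fintype (σ j)] (t₁ : TT ι₁ a₁ b₁ K) (t₂ : TT ι₂ a₂ b₂ K)
    (f : ∀ j, ι j → σ j → ι₁ j) (g : ∀ j, ι j → σ j → ι₂ j) (ha : a₁ * a₂ = a)
    (hb : b₁ * b₂ = b) : TT ι a b K where
  d j := t₁.d j * t₂.d j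
  left := by rw [t₁.left, t₂.left, ha]
  right := by rw [t₁.right, t₂.right, hb]
  core j i u v := ∑ s : σ j, t₁.core j (f j i s) u.divNat v.divNat *
    t₂.core j (g j i s) u.modNat v.modNat

theorem digits_eq_iff {n n' p q p' q' : ℕ} (hn : n = n') (hq : q < n) (hq' : q' < n') :
    q + n * p = q' + n' * p' ↔ p = p' ∧ q = q' := by
  subst hn
  refine ⟨fun h => ?_, by rintro ⟨rfl, rfl⟩; rfl⟩
  have h1 := congrArg (· / n) h
  have h2 := congrArg (· % n) h
  simp only [Nat.add_mul_div_left _ _ (Nat.zero_lt_of_lt hq), Nat.div_eq_of_lt hq,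
    Nat.div_eq_of_lt hq', zero_add] at h1
  simp only [Nat.add_mul_mod_self_left, Nat.mod_eq_of_lt hq, Nat.mod_eq_of_lt hq'] at h2
  exact ⟨h1, h2⟩

theorem eval_contract [∀ j, Fintype (σ j)] (t₁ : TT ι₁ a₁ b₁ K) (t₂ : TT ι₂ a₂ b₂ K)
    (f : ∀ j, ι j → σ j → ι₁ j) (g : ∀ j, ι j → σ j → ι₂ j) (ha : a₁ * a₂ = a)
    (hb : b₁ * b₂ = b) {l : Fin a} {r : Fin b} {l₁ : Fin a₁} {l₂ : Fin a₂} {r₁ : Fin b₁}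
    {r₂ : Fin b₂} (hl : (l : ℕ) = l₂ + a₂ * l₁) (hr : (r : ℕ) = r₂ + b₂ * r₁)
    (x : ∀ j, ι j) :
    (t₁.contract t₂ f g ha hb).eval l x r = ∑ s : ∀ j, σ j,
      t₁.eval l₁ (fun j => f j (x j) (s j)) r₁ * t₂.eval l₂ (fun j => g j (x j) (s j)) r₂ := by
  let e : ((∀ j, Fin (t₁.d j)) × ∀ j, Fin (t₂.d j)) ≃
      ∀ j, Fin ((t₁.contract t₂ f g ha hb).d j) :=
    (Equiv.arrowProdEquivProdArrow _ _ _).symm.trans (Equiv.piCongrRight fun _ => finProdFinEquiv)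
  have hdiv : ∀ p q j, Fin.divNat (m := t₁.d j) (n := t₂.d j) (e (p, q) j) = p j :=
    fun p q j => congrArg Prod.fst (finProdFinEquiv.symm_apply_apply (p j, q j))
  have hmod : ∀ p q j, Fin.modNat (m := t₁.d j) (n := t₂.d j) (e (p, q) j) = q j :=
    fun p q j => congrArg Prod.snd (finProdFinEquiv.symm_apply_apply (p j, q j))
  have hval : ∀ p q j, (e (p, q) j : ℕ) = q j + t₂.d j * p j := fun p q j => rfl
  rw [eval, ← e.sum_comp, Fintype.sum_prod_type]
  simp only [eval, sum_mul_sum]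
  conv_rhs => rw [sum_comm]
  refine sum_congr rfl fun p _ => ?_
  conv_rhs => rw [sum_comm]
  refine sum_congr rfl fun q _ => ?_
  have hl' : (e (p, q) 0 : ℕ) = l ↔ (p 0 : ℕ) = l₁ ∧ (q 0 : ℕ) = l₂ := by
    rw [hl, hval, digits_eq_iff t₂.left (q 0).isLt l₂.isLt]
  have hr' : (e (p, q) (Fin.last D) : ℕ) = r ↔
      (p (Fin.last D) : ℕ) = r₁ ∧ (q (Fin.last D) : ℕ) = r₂ := by
    rw [hr, hval, digits_eq_iff t₂.right (q _).isLt r₂.isLt]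
  by_cases h1 : (p 0 : ℕ) = l₁ ∧ (p (Fin.last D) : ℕ) = r₁
  · by_cases h2 : (q 0 : ℕ) = l₂ ∧ (q (Fin.last D) : ℕ) = r₂
    · rw [if_pos ⟨hl'.2 ⟨h1.1, h2.1⟩, hr'.2 ⟨h1.2, h2.2⟩⟩]
      have hcore : ∀ j, (t₁.contract t₂ f g ha hb).core j (x j) (e (p, q) j.castSucc)
          (e (p, q) j.succ) = ∑ s : σ j, t₁.core j (f j (x j) s) (p j.castSucc) (p j.succ) *
            t₂.core j (g j (x j) s) (q j.castSucc) (q j.succ) := by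
        intro j
        rw [← hdiv p q j.castSucc, ← hdiv p q j.succ, ← hmod p q j.castSucc, ← hmod p q j.succ]
        rfl
      simp only [hcore]
      rw [prod_univ_sum, Fintype.piFinset_univ]
      refine sum_congr rfl fun s _ => ?_
      rw [prod_mul_distrib, if_pos h1, if_pos h2]
    · rw [if_neg fun h => h2 ⟨(hl'.1 h.1).2, (hr'.1 h.2).2⟩]
      simp [if_neg h2]
  · rw [if_neg fun h => h1 ⟨(hl'.1 h.1).1, (hr'.1 h.2).1⟩]
    simp [if_neg h1]

/-- The cores of a tensor train, padded by zeros to bond dimension `R`. -/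
def pad (t : TT ι a b K) (R : ℕ) : TT ι R R K where
  d _ := R
  left := rfl
  right := rfl
  core j i u v := if h : (u : ℕ) < t.d j.castSucc ∧ (v : ℕ) < t.d j.succ then
    t.core j i ⟨u, h.1⟩ ⟨v, h.2⟩ else 0

theorem eval_pad (t : TT ι a b K) {R : ℕ} (hR : ∀ j, t.d j ≤ R) {l : Fin a} {r : Fin b}
    {l' r' : Fin R} (hl : (l' : ℕ) = l) (hr : (r' : ℕ) = r) (x : ∀ j, ι j) :
    (t.pad R).eval l' x r' = t.eval l x r := by
  symm
  refine Fintype.sum_of_injective (fun (p : ∀ j, Fin (t.d j)) j => Fin.castLE (hR j) (p j)) ?_ _ _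
    ?_ ?_
  · intro p q h
    funext j
    exact Fin.castLE_injective (hR j) (congrFun h j)
  · intro p hp
    by_contra hne
    rw [ite_eq_right_iff, Classical.not_imp] at hne
    obtain ⟨⟨h0, -⟩, hprod⟩ := hne
    refine hp ⟨fun j => ⟨p j, ?_⟩, rfl⟩
    induction j using Fin.cases with
    | zero => rw [h0, hl, t.left]; exact l.isLt
    | succ j =>
      by_contra hj
      exact hprod (prod_eq_zero (mem_univ j) (dif_neg fun h => hj h.2))
  · intro p
    simp [pad, hl, hr]

end TT

end ITSHAP

namespace ITSHAP

open Finset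

/-! ### Tensor trains for the Value Tensor and the IT-SHAP tensor -/

namespace TT

variable {D nOut m : ℕ} {N : Fin D → ℕ} {a b a₁ b₁ a₂ b₂ : ℕ} {K : Type} [Field K]

/-- The tensor train of the Value Tensor obtained from those of the distribution and the
model. -/
def valueTT (P : TT (fun j => Fin (N j)) a₁ b₁ K) (M : TT (fun j => Fin (N j)) a₂ b₂ K)
    (ha : a₁ * a₂ = a) (hb : b₁ * b₂ = b) : TT (fun j => Fin (N j) × Fin 2) a b K :=
  P.contract (σ := fun j => Fin (N j)) M (fun _ _ s => s)
    (fun _ i s => if i.2 = 0 then i.1 else s) ha hb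

/-- The tensor train of the IT-SHAP tensor obtained from those of the MWCT and the Value
Tensor. -/
def shapTT (W : TT (fun _ : Fin D => Fin 2) a₁ b₁ K)
    (V : TT (fun j => Fin (N j) × Fin 2) a₂ b₂ K)
    (ha : a₁ * a₂ = a) (hb : b₁ * b₂ = b) : TT (fun j => Fin (N j)) a b K :=
  W.contract (σ := fun _ => Fin 2) V (fun _ _ s => s) (fun _ i s => (i, s)) ha hb

theorem eval_valueTT (P : TT (fun j => Fin (N j)) a₁ b₁ K) (M : TT (fun j => Fin (N j)) a₂ b₂ K)
    (ha : a₁ * a₂ = a) (hb : b₁ * b₂ = b) {l : Fin a} {r : Fin b} {l₁ : Fin a₁} {l₂ : Fin a₂}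
    {r₁ : Fin b₁} {r₂ : Fin b₂} (hl : (l : ℕ) = l₂ + a₂ * l₁) (hr : (r : ℕ) = r₂ + b₂ * r₁)
    (x : ∀ j, Fin (N j)) (τ : Fin D → Fin 2) :
    (P.valueTT M ha hb).eval l (fun j => (x j, τ j)) r =
      ∑ x', P.eval l₁ x' r₁ * M.eval l₂ (intervene x' τ x) r₂ :=
  eval_contract P M _ _ ha hb hl hr _

theorem eval_shapTT (W : TT (fun _ : Fin D => Fin 2) a₁ b₁ K)
    (V : TT (fun j => Fin (N j) × Fin 2) a₂ b₂ K)
    (ha : a₁ * a₂ = a) (hb : b₁ * b₂ = b) {l : Fin a} {r : Fin b} {l₁ : Fin a₁} {l₂ : Fin a₂}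
    {r₁ : Fin b₁} {r₂ : Fin b₂} (hl : (l : ℕ) = l₂ + a₂ * l₁) (hr : (r : ℕ) = r₂ + b₂ * r₁)
    (x : ∀ j, Fin (N j)) :
    (W.shapTT V ha hb).eval l x r =
      ∑ τ, W.eval l₁ τ r₁ * V.eval l₂ (fun j => (x j, τ j)) r₂ :=
  eval_contract W V _ _ ha hb hl hr _

theorem exists_valueTensor (M : TT (fun j => Fin (N j)) 1 nOut K)
    (P : TT (fun j => Fin (N j)) 1 1 K) :
    ∃ V : TT (fun j => Fin (N j) × Fin 2) 1 nOut K, (∀ j, V.d j ≤ M.d j * P.d j) ∧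
      ∀ x τ y, V.eval 0 (fun j => (x j, τ j)) y =
        valueTensor (fun x y => M.eval 0 x y) (fun x => P.eval 0 x 0) x τ y :=
  ⟨P.valueTT M (one_mul 1) (one_mul nOut), fun _ => (mul_comm _ _).le, fun x τ y =>
    eval_valueTT P M _ _ (l₁ := 0) (l₂ := 0) (r₁ := 0) (r₂ := y) (by simp) (by simp) x τ⟩

theorem exists_itShap (conv : LowerOrder) (k : ℕ) (M : (∀ j, Fin (N j)) → Fin nOut → K)
    (P : (∀ j, Fin (N j)) → K) (sets : Fin m → Finset (Fin D))
    (W : TT (fun _ : Fin D => Fin 2) m 1 K)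
    (hW : ∀ a τ, W.eval a τ 0 = mwct K conv k (sets a) τ)
    (V : TT (fun j => Fin (N j) × Fin 2) 1 nOut K)
    (hV : ∀ x τ y, V.eval 0 (fun j => (x j, τ j)) y = valueTensor M P x τ y) :
    ∃ T : TT (fun j => Fin (N j)) m nOut K, (∀ j, T.d j ≤ W.d j * V.d j) ∧
      ∀ a x y, T.eval a x y = itShap conv k M P (sets a) x y := by
  refine ⟨W.shapTT V (mul_one m) (one_mul nOut), fun _ => le_rfl, fun a x y => ?_⟩
  rw [eval_shapTT W V _ _ (l₁ := a) (l₂ := 0) (r₁ := 0) (r₂ := y) (by simp) (by simp)]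
  exact sum_congr rfl fun τ _ => by rw [hW, hV]

theorem core_pad {n : Fin D → ℕ} (t : TT (fun j => Fin (n j)) a b ℚ) (R : ℕ) (j : Fin D)
    (i : Fin (n j)) (u v : Fin R) : (t.pad R).core j i u v = t.entry j i u v := by
  simp [pad, entry]

theorem entry_eq_zero {n : Fin D → ℕ} (t : TT (fun j => Fin (n j)) a b ℚ) {j i u v : ℕ}
    (hj : j < D) (hi : n ⟨j, hj⟩ ≤ i) : t.entry j i u v = 0 := by
  rw [entry, dif_pos hj, dif_neg fun h => absurd h.1 hi.not_gt]

end TT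

namespace Instance

variable (I : Instance)

/-- The explained value of feature `j`. -/
def xval (j : ℕ) : ℕ := if h : j < I.D then I.x ⟨j, h⟩ else 0

/-- The entries of the padded cores of the Value Tensor at the explained input. -/
def valueEntry (j τ s s' : ℕ) : ℚ :=
  ∑ i ∈ range I.maxMode, I.dist.entry j i (s / I.maxBond % I.maxBond) (s' / I.maxBond % I.maxBond) *
    I.model.entry j (if τ = 0 then I.xval j else i) (s % I.maxBond) (s' % I.maxBond)

/-- The entries of the padded cores of the IT-SHAP tensor at the explained input. -/
def shapEntry (j s s' : ℕ) : ℚ :=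
  ∑ τ ∈ range 2, I.weight.entry j τ (s / I.maxBond / I.maxBond) (s' / I.maxBond / I.maxBond) *
    I.valueEntry j τ s s'

theorem d_le (j : Fin (I.D + 1)) : I.model.d j ≤ I.maxBond ∧ I.dist.d j ≤ I.maxBond ∧
    I.weight.d j ≤ I.maxBond := by
  have h : max (I.model.d j) (max (I.dist.d j) (I.weight.d j)) ≤ I.maxBond :=
    le_sup (f := fun j => max (I.model.d j) (max (I.dist.d j) (I.weight.d j))) (mem_univ j)
  omega

theorem s_lt : (I.s : ℕ) < I.maxBond :=
  I.s.isLt.trans_le (I.weight.left ▸ (I.d_le 0).2.2)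

theorem y_lt : (I.y : ℕ) < I.maxBond :=
  I.y.isLt.trans_le (I.model.right ▸ (I.d_le _).1)

theorem answer_eq_chain {conv : LowerOrder}
    (hW : ∀ a τ, I.weight.eval a τ 0 = mwct ℚ conv I.k (I.sets a) τ) :
    I.answer conv = chain I.shapEntry (I.maxBond * (I.maxBond * I.maxBond)) 0 I.D
      (I.maxBond * (I.maxBond * I.s)) I.y := by
  set R := I.maxBond with hR
  have hR0 : 0 < R := I.maxBond_pos
  have hl : R * (R * I.s) < R * (R * R) :=
    Nat.mul_lt_mul_of_pos_left (Nat.mul_lt_mul_of_pos_left I.s_lt hR0) hR0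
  have hr : (I.y : ℕ) < R * (R * R) := I.y_lt.trans_le (Nat.le_mul_of_pos_right _ (by positivity))
  have hr' : (I.y : ℕ) < R * R := I.y_lt.trans_le (Nat.le_mul_of_pos_right _ hR0)
  let V := (I.dist.pad R).valueTT (I.model.pad R) rfl rfl
  let T := (I.weight.pad R).shapTT V rfl rfl
  have hT : T.eval ⟨_, hl⟩ I.x ⟨_, hr⟩ = I.answer conv := by
    rw [TT.eval_shapTT _ _ rfl rfl (l₁ := ⟨I.s, I.s_lt⟩) (l₂ := ⟨0, by positivity⟩)
      (r₁ := ⟨0, hR0⟩) (r₂ := ⟨I.y, hr'⟩) (by simp; ring) (by simp)]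
    refine sum_congr rfl fun τ _ => ?_
    rw [TT.eval_valueTT _ _ rfl rfl (l₁ := ⟨0, hR0⟩) (l₂ := ⟨0, hR0⟩)
      (r₁ := ⟨0, hR0⟩) (r₂ := ⟨I.y, I.y_lt⟩) (by simp) (by simp),
      TT.eval_pad I.weight (fun j => (I.d_le j).2.2) (l := I.s) (r := 0) rfl rfl, hW]
    refine congrArg _ (sum_congr rfl fun x' _ => ?_)
    rw [TT.eval_pad I.dist (fun j => (I.d_le j).2.1) (l := 0) (r := 0) rfl rfl,
      TT.eval_pad I.model (fun j => (I.d_le j).1) (l := 0) (r := I.y) rfl rfl]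
    rfl
  rw [← hT, ← sum_paths_eq_chain _ _ _ _ _ _ hl hr]
  have key : ∀ (j : Fin I.D) (u v : Fin (R * (R * R))),
      T.core j (I.x j) u v = I.shapEntry (0 + j) u v := by
    intro j u v
    have hj : ((j : ℕ) < I.D) := j.isLt
    rw [zero_add, shapEntry, sum_range]
    change ∑ τ : Fin 2, (I.weight.pad R).core j τ u.divNat v.divNat * ∑ i : Fin (I.N j),
      (I.dist.pad R).core j i u.modNat.divNat v.modNat.divNat *
        (I.model.pad R).core j (if τ = 0 then I.x j else i) u.modNat.modNat v.modNat.modNat = _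
    refine sum_congr rfl fun τ _ => ?_
    rw [TT.core_pad, Fin.coe_divNat, Fin.coe_divNat, ← Nat.div_div_eq_div_mul,
      ← Nat.div_div_eq_div_mul, valueEntry,
      ← sum_subset (range_subset_range.2 (I.N_le j)), sum_range]
    · refine congrArg _ (sum_congr rfl fun i _ => ?_)
      rw [TT.core_pad, TT.core_pad]
      simp only [Fin.coe_divNat, Fin.coe_modNat, Nat.mod_mul_right_div_self,
        Nat.mod_mul_right_mod, xval, dif_pos hj]
      by_cases h : τ = 0
      · simp [h, ← hR]
      · simp [h, ← hR]
    · intro i _ hi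
      rw [TT.entry_eq_zero _ hj (not_lt.1 fun h => hi (mem_range.2 h)), zero_mul]
  rw [TT.eval]
  refine sum_congr rfl fun p _ => ?_
  exact if_congr Iff.rfl (prod_congr rfl fun j _ => key _ _ _) rfl

theorem slice_eq {j u v : ℕ} (hj : j < I.D) (hu : u < I.maxBond) (hv : v < I.maxBond) :
    (I.toPar.slice I.encode j u v : ℚ) =
      I.toPar.common I.encode * I.model.entry j (I.xval j) u v := by
  have hx : I.xval j < I.maxMode := by
    rw [xval, dif_pos hj]
    exact (I.x _).isLt.trans_le (I.N_le _)
  rw [Par.slice, sum_eq_single_of_mem (I.xval j) (show _ ∈ range I.toPar.N from mem_range.2 hx)]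
  · rw [I.bitAt_posX hj hx, if_pos (by rw [xval, dif_pos hj]), one_mul]
    exact I.scaled_eq (I.toPar.entM_lt_entries hj hx hu hv) (I.hasEntry_model hj hx hu hv)
  · intro i hi hne
    rw [I.bitAt_posX hj (mem_range.1 hi), if_neg, zero_mul]
    rwa [xval, dif_pos hj] at hne

theorem value_eq {j τ s s' : ℕ} (hj : j < I.D) :
    (I.toPar.value I.encode j τ s s' : ℚ) =
      (I.toPar.common I.encode : ℚ) ^ 2 * I.valueEntry j τ s s' := by
  have hR := I.maxBond_pos
  have e : I.toPar.R = I.maxBond := rfl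
  have hm : ∀ t, t % I.maxBond < I.maxBond := fun t => Nat.mod_lt _ hR
  rw [Par.value, valueEntry, mul_sum, Int.cast_sum]
  refine sum_congr rfl fun i hi => ?_
  have hi := mem_range.1 hi
  rw [e, Int.cast_mul, I.scaled_eq (I.toPar.entP_lt_entries hj hi (hm _) (hm _))
    (I.hasEntry_dist hj hi (hm _) (hm _))]
  split_ifs with h
  · rw [I.slice_eq hj (hm _) (hm _)]
    ring
  · rw [I.scaled_eq (I.toPar.entM_lt_entries hj hi (hm _) (hm _))
      (I.hasEntry_model hj hi (hm _) (hm _))]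
    ring

theorem transfer_eq {j s s' : ℕ} (hj : j < I.D)
    (hs : s < I.maxBond * (I.maxBond * I.maxBond)) (hs' : s' < I.maxBond * (I.maxBond * I.maxBond)) :
    (I.toPar.transfer I.encode j s s' : ℚ) =
      (I.toPar.common I.encode : ℚ) ^ 3 * I.shapEntry j s s' := by
  have e : I.toPar.R = I.maxBond := rfl
  have hd : ∀ t, t < I.maxBond * (I.maxBond * I.maxBond) →
      t / I.maxBond / I.maxBond < I.maxBond := by
    intro t ht
    rw [Nat.div_div_eq_div_mul]
    exact Nat.div_lt_of_lt_mul (by linarith)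
  rw [Par.transfer, shapEntry, mul_sum, Int.cast_sum]
  refine sum_congr rfl fun τ hτ => ?_
  have hτ := mem_range.1 hτ
  rw [e, Int.cast_mul, I.value_eq hj, I.scaled_eq (I.toPar.entW_lt_entries hj hτ (hd _ hs) (hd _ hs'))
    (I.hasEntry_weight hj hτ (hd _ hs) (hd _ hs'))]
  ring

theorem result_eq_chain : I.toPar.result I.encode =
    chain (I.toPar.transfer I.encode) (I.maxBond * (I.maxBond * I.maxBond)) 0 I.D
      (I.maxBond * (I.maxBond * I.s)) I.y := by
  rw [Par.result, sum_eq_single_of_mem (I.s : ℕ)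
    (show _ ∈ range I.toPar.R from mem_range.2 I.s_lt)]
  · rw [I.bitAt_posS I.s_lt, if_pos rfl, one_mul,
      sum_eq_single_of_mem (I.y : ℕ)
        (show _ ∈ range I.toPar.R from mem_range.2 I.y_lt)]
    · rw [I.bitAt_posY I.y_lt, if_pos rfl, one_mul]
      rfl
    · intro y hy hne
      rw [I.bitAt_posY (mem_range.1 hy), if_neg hne, zero_mul]
  · intro w hw hne
    rw [I.bitAt_posS (mem_range.1 hw), if_neg hne, zero_mul]

theorem answer_eq {conv : LowerOrder}
    (hW : ∀ a τ, I.weight.eval a τ 0 = mwct ℚ conv I.k (I.sets a) τ) :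
    I.answer conv = (I.toPar.result I.encode : ℚ) /
      ((I.toPar.common I.encode ^ (3 * I.D) : ℕ) : ℚ) := by
  have hR := I.maxBond_pos
  have hl : I.maxBond * (I.maxBond * I.s) < I.maxBond * (I.maxBond * I.maxBond) :=
    Nat.mul_lt_mul_of_pos_left (Nat.mul_lt_mul_of_pos_left I.s_lt hR) hR
  rw [eq_div_iff (by exact_mod_cast pow_ne_zero _ I.common_pos.ne'), I.answer_eq_chain hW,
    I.result_eq_chain, ← eq_intCast (Int.castRingHom ℚ), map_chain, mul_comm, Nat.cast_pow, pow_mul,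
    ← chain_smul]
  symm
  refine chain_congr (D := I.D) (fun j hj s hs s' hs' => ?_) _ _ _ _ hl (by omega)
  rw [eq_intCast, I.transfer_eq hj hs hs']

end Instance

end ITSHAP

namespace ITSHAP

open Finset

/-! ### Bounds for the result -/

theorem Prog.sq_le_B (n : ℕ) : 9 * n * n + 2 ≤ Prog.B n := by
  have h : Prog.B n = (n + 2) * (n + 2) * (n + 2) ^ 3 := by unfold Prog.B; ring
  have h3 : n * 9 + 8 ≤ (n + 2) ^ 3 := by
    ring_nf
    omega
  rw [h]
  calc 9 * n * n + 2 ≤ (n + 2) * (n + 2) * (n * 9 + 8) := by nlinarith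
    _ ≤ _ := Nat.mul_le_mul_left _ h3

namespace Par

variable {P : Par} {n : ℕ} (x : List Bool)

theorem two_pow_bits_le (hf : Prog.Fits P n) : (2 ^ P.b) ^ P.entries ≤ 2 ^ n := by
  rw [← pow_mul]
  refine Nat.pow_le_pow_right two_pos ?_
  have := hf.pos
  unfold Par.posY Par.posX Par.posS Par.ent at this
  nlinarith

theorem abs_scaled_le (hf : Prog.Fits P n) (e : ℕ) : |P.scaled x e| ≤ 2 ^ n := by
  have h : ∀ r, |if r = e then P.sgnAt x e * P.numAt x e else (P.denAt x r : ℤ)| ≤ 2 ^ P.b := by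
    intro r
    split_ifs
    · rw [abs_mul, Nat.abs_cast]
      have h1 : |P.sgnAt x e| = 1 := by unfold sgnAt; split_ifs <;> simp
      have h2 : P.numAt x e < 2 ^ P.b := sum_bits_lt _ _
      rw [h1, one_mul]
      exact_mod_cast h2.le
    · rw [Nat.abs_cast]
      have h2 : P.denAt x r < 2 ^ P.b := sum_bits_lt _ _
      exact_mod_cast h2.le
  rw [scaled, abs_prod]
  calc _ ≤ ∏ _r ∈ range P.entries, (2 ^ P.b : ℤ) :=
        prod_le_prod (fun _ _ => abs_nonneg _) fun r _ => h r
    _ = (2 ^ P.b) ^ P.entries := by rw [prod_const, card_range]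
    _ ≤ 2 ^ n := by exact_mod_cast two_pow_bits_le hf

theorem common_le (hf : Prog.Fits P n) : P.common x ≤ 2 ^ n := by
  calc _ ≤ ∏ _r ∈ range P.entries, 2 ^ P.b :=
        prod_le_prod (fun _ _ => Nat.zero_le _) fun r _ => (sum_bits_lt _ _).le
    _ = (2 ^ P.b) ^ P.entries := by rw [prod_const, card_range]
    _ ≤ 2 ^ n := two_pow_bits_le hf

theorem abs_sum_range_le {k : ℕ} {f : ℕ → ℤ} {C d : ℤ} (hC : 0 ≤ C) (hd : (k : ℤ) ≤ d)
    (h : ∀ i < k, |f i| ≤ C) : |∑ i ∈ range k, f i| ≤ d * C := by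
  refine (abs_sum_le_sum_abs _ _).trans ?_
  refine (sum_le_card_nsmul _ _ C fun i hi => h i (mem_range.1 hi)).trans ?_
  rw [card_range, nsmul_eq_mul]
  exact mul_le_mul_of_nonneg_right hd hC

theorem abs_transfer_le (hf : Prog.Fits P n) (j s s' : ℕ) :
    |P.transfer x j s s'| ≤ 2 * (2 ^ n) ^ 5 := by
  have hs := abs_scaled_le x hf
  have hN : ((P.N : ℕ) : ℤ) ≤ 2 ^ n := by exact_mod_cast hf.N.trans Nat.lt_two_pow_self.le
  have h1 : (1 : ℤ) ≤ 2 ^ n := one_le_pow₀ (by norm_num)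
  generalize (2 ^ n : ℤ) = C at *
  have hslice : ∀ u v, |P.slice x j u v| ≤ C * C := by
    refine fun u v => abs_sum_range_le (by linarith) hN fun i _ => ?_
    rw [abs_mul]
    have : |bitAt x (P.posX + (j * P.N + i))| ≤ 1 := by
      unfold bitAt
      cases x.getD (P.posX + (j * P.N + i)) false <;> simp
    nlinarith [hs (P.entM j i u v), abs_nonneg (P.scaled x (P.entM j i u v))]
  have hvalue : ∀ τ, |P.value x j τ s s'| ≤ C * (C * (C * C)) := by
    refine fun τ => abs_sum_range_le (by positivity) hN fun i _ => ?_
    rw [abs_mul]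
    refine mul_le_mul (hs _) ?_ (abs_nonneg _) (by linarith)
    split_ifs
    · exact hslice _ _
    · exact (hs _).trans (by nlinarith)
  calc _ ≤ 2 * (C * (C * (C * (C * C)))) := by
        refine abs_sum_range_le (by positivity) (by norm_num) fun τ _ => ?_
        rw [abs_mul]
        exact mul_le_mul (hs _) (hvalue _) (abs_nonneg _) (by linarith)
    _ = _ := by ring

end Par

namespace Instance

variable (I : Instance)

theorem bounds (hD : 0 < I.D) :
    |I.toPar.result I.encode| < 2 ^ (Prog.B I.encode.length - 1) ∧
      I.toPar.common I.encode ^ (3 * I.D) < 2 ^ Prog.B I.encode.length := by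
  obtain ⟨hf, -, -⟩ := I.fits hD
  generalize hn : I.encode.length = n at *
  have hB := Prog.sq_le_B n
  have hDn : I.D ≤ n := hf.D
  have hn0 : n ≠ 0 := (Nat.lt_of_lt_of_le hD hDn).ne'
  have hB1 : 9 * n * n < Prog.B n - 1 := by omega
  have hB2 : 9 * n * n < Prog.B n := by omega
  generalize Prog.B n = β at *
  constructor
  · have hR := I.maxBond_pos
    have hl : I.maxBond * (I.maxBond * I.s) < I.maxBond * (I.maxBond * I.maxBond) :=
      Nat.mul_lt_mul_of_pos_left (Nat.mul_lt_mul_of_pos_left I.s_lt hR) hR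
    have h2 : (2 : ℤ) ≤ 2 ^ n := le_self_pow₀ (by norm_num) hn0
    have hRn : ((I.maxBond : ℕ) : ℤ) ≤ 2 ^ n := by
      exact_mod_cast hf.R.trans Nat.lt_two_pow_self.le
    rw [I.result_eq_chain]
    have hstep : ((I.maxBond * (I.maxBond * I.maxBond) : ℕ) : ℤ) * (2 * (2 ^ n) ^ 5) ≤
        (2 ^ n) ^ 9 := by
      push_cast
      generalize (2 ^ n : ℤ) = C at *
      calc (I.maxBond : ℤ) * (I.maxBond * I.maxBond) * (2 * C ^ 5)
          ≤ C * (C * C) * (C * C ^ 5) := by gcongr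
        _ = C ^ 9 := by ring
    have hC : (0 : ℤ) ≤ 2 * (2 ^ n) ^ 5 := by positivity
    have ht : ∀ j < I.D, ∀ s < I.maxBond * (I.maxBond * I.maxBond),
        ∀ s' < I.maxBond * (I.maxBond * I.maxBond),
        |I.toPar.transfer I.encode j s s'| ≤ 2 * (2 ^ n) ^ 5 :=
      fun j _ s _ s' _ => Par.abs_transfer_le _ hf j s s'
    refine (abs_chain_le hC ht I.D 0 _ _ hl (zero_add _).le).trans_lt ?_
    generalize (2 * (2 ^ n) ^ 5 : ℤ) = C' at *
    calc _ ≤ ((2 ^ n) ^ 9 : ℤ) ^ I.D := pow_le_pow_left₀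
          (mul_nonneg (Nat.cast_nonneg _) hC) hstep _
      _ = 2 ^ (9 * n * I.D) := by rw [← pow_mul, ← pow_mul, mul_left_comm, mul_assoc]
      _ ≤ 2 ^ (9 * n * n) := pow_le_pow_right₀ (by norm_num) (Nat.mul_le_mul_left _ hDn)
      _ < 2 ^ (β - 1) := pow_lt_pow_right₀ (by norm_num) hB1
  · calc _ ≤ (2 ^ n) ^ (3 * I.D) := Nat.pow_le_pow_left (Par.common_le _ hf) _
      _ = 2 ^ (3 * n * I.D) := by rw [← pow_mul, mul_left_comm, mul_assoc]
      _ ≤ 2 ^ (9 * n * n) := Nat.pow_le_pow_right two_pos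
          (Nat.mul_le_mul (Nat.mul_le_mul_right _ (by norm_num)) hDn)
      _ < _ := Nat.pow_lt_pow_right (by norm_num) hB2

theorem inNC2 (conv : LowerOrder) (valid : Instance → Prop)
    (h : ∀ I, valid I → I.WellPosed conv) :
    InNC2 encode valid fun I y => IsRatCode y (I.answer conv) := by
  have hB : ∀ n, 32 ≤ Prog.B n := fun n => (Prog.B_large n).1
  have hnd : ∀ n a b c, a < 32 → b < 32 → c < 32 →
      nd (Prog.B n) a b c 0 0 0 < Prog.B n ^ 6 := by
    intro n a b c ha hb hc
    have := hB n
    exact nd_lt ⟨by omega, by omega, by omega, by omega, by omega, by omega⟩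
  refine inNC2_of_sumProd Prog.sys Prog.uniform_sys (fun n => ?_) (fun n => ?_)
    (fun n => hnd n _ _ _ (by norm_num) (by norm_num) (by norm_num))
    (fun n => hnd n _ _ _ (by norm_num) (by norm_num) (by norm_num))
    (fun n => hnd n _ _ _ (by norm_num) (by norm_num) (by norm_num))
    Prog.sys_levels fun I hI X hX => ?_
  · have := hB n
    change 0 < Prog.B n
    omega
  · have := hB n
    change 0 < Prog.B n
    omega
  obtain ⟨hD, -, -, -, -, hW⟩ := h I hI
  obtain ⟨hf, hk, hb⟩ := I.fits hD
  obtain ⟨h1, h2, h3⟩ := Prog.X_final hX hf hk hb hD I.matches_encode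
  exact ⟨_, _, h1, h2, h3, (I.bounds hD).1, pow_ne_zero _ I.common_pos.ne', (I.bounds hD).2,
    I.answer_eq hW⟩

/-! ### The length of the code -/

theorem length_flatMap_finRange_le {D L : ℕ} {f : Fin D → List Bool}
    (h : ∀ j, (f j).length ≤ L) : ((List.finRange D).flatMap f).length ≤ D * L := by
  rw [List.length_flatMap]
  refine (List.sum_le_card_nsmul _ L ?_).trans (by simp)
  simpa using h

theorem length_trailer_le : I.trailer.length ≤
    I.m * I.D + (I.D * (I.maxMode + 1) + (I.D + 1) * (3 * (I.maxBond + 1))) := by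
  rw [trailer, List.length_append, List.length_append]
  refine add_le_add (length_flatMap_finRange_le fun a => by simp) (add_le_add
    (length_flatMap_finRange_le fun j => ?_) (length_flatMap_finRange_le fun j => ?_))
  · rw [length_unary]
    exact Nat.succ_le_succ (I.N_le j)
  · simp only [List.length_append, length_unary]
    have := I.d_le j
    omega

theorem maxBond_le {c : ℕ} (h : I.PolyRanks c) :
    I.maxBond ≤ 1 + 2 * I.sizeParam + (c * I.sizeParam ^ c + c) := by
  refine Finset.sup_le fun j _ => ?_
  have hs : I.D + I.k ≤ I.sizeParam ∧ I.nOut ≤ I.sizeParam ∧ I.m ≤ I.sizeParam := by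
    unfold sizeParam
    omega
  by_cases h0 : j = 0
  · subst h0
    rw [I.model.left, I.dist.left, I.weight.left]
    omega
  by_cases h1 : j = Fin.last I.D
  · subst h1
    rw [I.model.right, I.dist.right, I.weight.right]
    omega
  have hp : c * (I.D + I.k) ^ c + c ≤ c * I.sizeParam ^ c + c := by
    have := hs.1
    gcongr
  have := h j h0 h1
  omega

theorem length_encode_le (c : ℕ) :
    ∃ e : ℕ, ∀ I : Instance, I.PolyRanks c → I.encode.length ≤ e * I.sizeParam ^ e + e := by
  have hs : PolyBdd id fun s : ℕ => s := PolyBdd.self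
  have hr : PolyBdd id fun s : ℕ => 1 + 2 * s + (c * s ^ c + c) :=
    ((PolyBdd.const 1).add ((PolyBdd.const 2).mul hs)).add
      (((PolyBdd.const c).mul (hs.pow c)).add (PolyBdd.const c))
  have key : ∀ ρ : ℕ → ℕ, PolyBdd id ρ → PolyBdd id fun s : ℕ =>
      (5 * s + ρ s + 5) + 4 * ((s + 1) * (s + 1) * ρ s * ρ s * (2 * s + 1)) + 2 * ρ s + s * s +
        (s * s + (s * (s + 1) + (s + 1) * (3 * (ρ s + 1)))) := by
    intro ρ hρ
    have h1 : PolyBdd id fun s : ℕ => s + 1 := hs.add (PolyBdd.const 1)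
    exact ((((((PolyBdd.const 5).mul hs).add hρ).add (PolyBdd.const 5)).add
      ((PolyBdd.const 4).mul ((((h1.mul h1).mul hρ).mul hρ).mul
        (((PolyBdd.const 2).mul hs).add (PolyBdd.const 1))))).add
      ((PolyBdd.const 2).mul hρ)).add (hs.mul hs) |>.add
      ((hs.mul hs).add ((hs.mul h1).add (h1.mul ((PolyBdd.const 3).mul (hρ.add
        (PolyBdd.const 1))))))
  obtain ⟨e, he⟩ := key _ hr
  refine ⟨e, fun I hI => le_trans ?_ (he I.sizeParam)⟩
  have hR := I.maxBond_le hI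
  have ht := I.length_trailer_le
  rw [encode_eq]
  simp only [List.length_append, length_header, TT.length_encode, length_oneHot, length_inputCode,
    Par.hd, toPar]
  generalize 1 + 2 * I.sizeParam + (c * I.sizeParam ^ c + c) = ρ at *
  have hs' : I.sizeParam = I.D + I.k + I.maxMode + I.nOut + I.m + I.bits := rfl
  generalize I.sizeParam = s at *
  have hD : I.D ≤ s := by omega
  have hN : I.maxMode ≤ s := by omega
  have hm : I.m ≤ s := by omega
  have hb : I.bits ≤ s := by omega
  have e1 : I.D * I.maxMode * I.maxBond * I.maxBond * (2 * I.bits + 1) ≤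
      (s + 1) * (s + 1) * ρ * ρ * (2 * s + 1) := by gcongr <;> omega
  have e2 : I.D * 2 * I.maxBond * I.maxBond * (2 * I.bits + 1) ≤
      2 * ((s + 1) * (s + 1) * ρ * ρ * (2 * s + 1)) := by
    calc _ ≤ s * (2 * (s + 1)) * ρ * ρ * (2 * s + 1) := by gcongr; omega
      _ ≤ (s + 1) * (2 * (s + 1)) * ρ * ρ * (2 * s + 1) := by gcongr; omega
      _ = _ := by ring
  have e3 : I.D * I.maxMode ≤ s * s := by gcongr
  have e4 : I.m * I.D + (I.D * (I.maxMode + 1) + (I.D + 1) * (3 * (I.maxBond + 1))) ≤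
      s * s + (s * (s + 1) + (s + 1) * (3 * (ρ + 1))) := by gcongr
  omega

end Instance

end ITSHAP

theorem mainTheorem1 (conv : ITSHAP.LowerOrder) :
    -- entries of the IT-SHAP tensor are computable in NC², for every polynomial rank bound
    (∀ c : ℕ,
      ITSHAP.InNC2 ITSHAP.Instance.encode
        (fun I => I.WellPosed conv ∧ I.PolyRanks c)
        (fun I y => ITSHAP.IsRatCode y (I.answer conv)) ∧
      ∃ e : ℕ, ∀ I : ITSHAP.Instance, I.WellPosed conv → I.PolyRanks c →
        I.encode.length ≤ e * I.sizeParam ^ e + e) ∧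
    -- rank bounds for the Value Tensor and for the IT-SHAP tensor
    (∀ (D k nOut m : ℕ) (N : Fin D → ℕ)
      (M : ITSHAP.TT (fun j => Fin (N j)) 1 nOut ℝ)
      (P : ITSHAP.TT (fun j => Fin (N j)) 1 1 ℝ)
      (sets : Fin m → Finset (Fin D))
      (W : ITSHAP.TT (fun _ : Fin D => Fin 2) m 1 ℝ),
      1 ≤ D → 1 ≤ k →
      (∀ x, 0 ≤ P.eval 0 x 0) → ∑ x, P.eval 0 x 0 = 1 →
      (∀ a, ITSHAP.Admissible conv k (sets a)) →
      (∀ a τ, W.eval a τ 0 = ITSHAP.mwct ℝ conv k (sets a) τ) →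
      (∃ V : ITSHAP.TT (fun j => Fin (N j) × Fin 2) 1 nOut ℝ,
        (∀ j, V.d j ≤ M.d j * P.d j) ∧
        ∀ x τ y, V.eval 0 (fun j => (x j, τ j)) y =
          ITSHAP.valueTensor (fun x y => M.eval 0 x y) (fun x => P.eval 0 x 0) x τ y) ∧
      ∀ V : ITSHAP.TT (fun j => Fin (N j) × Fin 2) 1 nOut ℝ,
        (∀ x τ y, V.eval 0 (fun j => (x j, τ j)) y =
          ITSHAP.valueTensor (fun x y => M.eval 0 x y) (fun x => P.eval 0 x 0) x τ y) →
        ∃ T : ITSHAP.TT (fun j => Fin (N j)) m nOut ℝ,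
          (∀ j, T.d j ≤ W.d j * V.d j) ∧
          ∀ a x y, T.eval a x y =
            ITSHAP.itShap conv k (fun x y => M.eval 0 x y) (fun x => P.eval 0 x 0)
              (sets a) x y) := by
  refine ⟨fun c => ⟨ITSHAP.Instance.inNC2 conv _ fun I hI => hI.1, ?_⟩,
    fun D k nOut m N M P sets W _ _ _ _ _ hW => ⟨M.exists_valueTensor P, fun V hV =>
      ITSHAP.TT.exists_itShap conv k _ _ sets W hW V hV⟩⟩
  obtain ⟨e, he⟩ := ITSHAP.Instance.length_encode_le c
  exact ⟨e, fun I _ hI => he I hI⟩
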